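/- Let $d\ge 1$, $\mathbb T^d=\mathbb R^d/\mathbb Z^d$, let $\alpha\ge 0$ with $\alpha<\frac{2}{d-2}$ if $d\ge 3$ (no upper restriction if $d\le 2$), and let $1<\gamma<2$, $\frac1\gamma+\frac1{\gamma'}=1$. Fix constants $C_1,c_1,C_2,c_2,c_3,C_3,C_4>0$, $k_0>0$, $K$ and $T_{\max}$. Consider terminal times $0<T\le T_{\max}$ and the following data. (i) A $C^\infty$ Lagrangian $L_0:\mathbb T^d\times\mathbb R^d\to[0,\infty)$, strictly convex in $v$, with $C_1\frac{|v|^{\gamma'}}{\gamma'}-c_1\le L_0(x,v)\le C_2\frac{|v|^{\gamma'}}{\gamma'}+c_2$, whose Legendre transform $H_0(x,p)=\sup_v[-v\cdot p-L_0(x,v)]$ satisfies $p\cdot D_pH_0(x,p)-H_0(x,p)\ge c_3|p|^\gamma-C_3$ and $|D_pH_0(x,p)|\le C_4|p|^{\gamma-1}+C_4$ for all $x,p$. (ii) $C^\infty$ functions $\Psi:\mathbb T^d\to\mathbb R$, $b:\mathbb T^d\times[0,T]\to\mathbb R^d$, $V:\mathbb T^d\times\mathbb R\to\mathbb R$, bounded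 with bounded derivatives of all orders, with $|\Psi|,|b|,|V|\le K$. (iii) A $C^\infty$ function $m_0:\mathbb T^d\to\mathbb R$ with $\int_{\mathbb T^d}m_0\,dx=1$ and $k_0\le m_0\le K$. A $C^\infty$ solution is a pair of functions $u,m\in C^\infty(\mathbb T^d\times[0,T])$ with $m>0$ and $$\begin{cases}-u_t-\Delta u+m^\alpha H_0\big(x,\tfrac{Du}{m^\alpha}\big)+b\cdot Du=V(x,m),\\ m_t-\Delta m-\operatorname{div}\big(D_pH_0\big(x,\tfrac{Du}{m^\alpha}\big)m\big)-\operatorname{div}(bm)=0,\\ u(x,T)=\Psi(x),\quad m(x,0)=m_0(x),\end{cases}$$ where the two equations hold for $0<t<T$ in the classical sense; in particular, the flux $D_pH_0(x,\frac{Du}{m^\alpha})\,m$ is differentiable in $x$ (which is automatic when $H_0$ is $C^\infty$). **Theorem.** There exist $r_0>0$ and $\delta>0$ such that for every $r\ge r_0$ there are a time $t_1=t_1(r)>0$ and a constant $C=C(r)>0$, with $r_0,\delta,t_1,C$ depending only on $d,\alpha,\gamma$ and on the constants fixed above, such that for every $T\in(0,T_{\max}]$, all data as in (i)-(iii) and every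 $C^\infty$ solution $(u,m)$, $$\int_{\mathbb T^d}\frac{dx}{m^r(x,t)}\le C\left[1+\frac1{(t_1-t)^\delta}\right]\qquad\text{for all }t\in[0,T]\text{ with }t<t_1 .$$ -/

import Mathlib

open Set MeasureTheory
open scoped ContDiff InnerProductSpace

noncomputable section

namespace CongestionMFG

/-- Euclidean space `ℝ^d`. Functions on the torus `𝕋^d = ℝ^d / ℤ^d` are `ℤ^d`-periodic functions on
it. -/
abbrev Space (d : ℕ) : Type := EuclideanSpace ℝ (Fin d)

/-- `ℤ^d`-periodicity, i.e. `f` is a function on the torus `𝕋^d`. -/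
def IsPeriodic {d : ℕ} {X : Type*} (f : Space d → X) : Prop :=
  ∀ (k : Fin d → ℤ) (x : Space d), f (x + WithLp.toLp 2 (fun i => (k i : ℝ))) = f x

/-- The integral over `𝕋^d`, that is, over the unit cell `[0,1)^d`. -/
def cellIntegral {d : ℕ} (f : Space d → ℝ) : ℝ :=
  ∫ x in {x : Space d | ∀ i, x i ∈ Ico (0 : ℝ) 1}, f x

/-- The divergence `∑ i, ∂F_i / ∂x_i` of a vector field. -/
def divergence {d : ℕ} (F : Space d → Space d) (x : Space d) : ℝ :=
  ∑ i, (fderiv ℝ F x (EuclideanSpace.single i 1)) i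

/-- `f` is `C^∞` on `s`, and `f` and its derivatives of all orders are bounded on `s`. -/
def SmoothBounded {E F : Type*} [NormedAddCommGroup E] [NormedSpace ℝ E]
    [NormedAddCommGroup F] [NormedSpace ℝ F] (f : E → F) (s : Set E) : Prop :=
  ContDiffOn ℝ ∞ f s ∧ ∀ n : ℕ, ∃ B : ℝ, ∀ z ∈ s, ‖iteratedFDerivWithin ℝ n f s z‖ ≤ B

/-- The Hamiltonian `H₀(x,p) = sup_v [-v·p - L₀(x,v)]`, the Legendre transform of `L₀`. -/
def hamiltonian {d : ℕ} (L : Space d → Space d → ℝ) (x p : Space d) : ℝ :=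
  ⨆ v : Space d, (-⟪v, p⟫_ℝ - L x v)

/-- The gradient `D_p H₀(x,p)` of the Hamiltonian in the momentum variable. -/
def hamiltonianGrad {d : ℕ} (L : Space d → Space d → ℝ) (x p : Space d) : Space d :=
  gradient (hamiltonian L x) p

/-- The assumptions on the Lagrangian `L₀ : 𝕋^d × ℝ^d → ℝ` and its Legendre transform `H₀`, with
conjugate exponents `γ, γ'` and explicit constants. -/
structure IsLagrangian {d : ℕ} (γ γ' C₁ c₁ C₂ c₂ c₃ C₃ C₄ : ℝ)
    (L : Space d → Space d → ℝ) : Prop where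
  periodic : ∀ v, IsPeriodic (fun x => L x v)
  smooth : ContDiff ℝ ∞ (fun z : Space d × Space d => L z.1 z.2)
  strictConvex : ∀ x, StrictConvexOn ℝ univ (L x)
  nonneg : ∀ x v, 0 ≤ L x v
  lower : ∀ x v, C₁ * (‖v‖ ^ γ' / γ') - c₁ ≤ L x v
  upper : ∀ x v, L x v ≤ C₂ * (‖v‖ ^ γ' / γ') + c₂
  coercive : ∀ x p,
    c₃ * ‖p‖ ^ γ - C₃ ≤ ⟪p, hamiltonianGrad L x p⟫_ℝ - hamiltonian L x p
  growth : ∀ x p, ‖hamiltonianGrad L x p‖ ≤ C₄ * ‖p‖ ^ (γ - 1) + C₄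

/-- The assumptions on the terminal cost `Ψ`, the reference velocity `b` on `𝕋^d × [0,T]`, the
potential `V` on `𝕋^d × ℝ` and the initial density `m₀`; `K` bounds their sup norms and `k₀` bounds
`m₀` from below. -/
structure IsData {d : ℕ} (K k₀ T : ℝ) (Ψ : Space d → ℝ) (b : Space d → ℝ → Space d)
    (V : Space d → ℝ → ℝ) (m₀ : Space d → ℝ) : Prop where
  periodic_Ψ : IsPeriodic Ψ
  smooth_Ψ : SmoothBounded Ψ univ
  bound_Ψ : ∀ x, |Ψ x| ≤ K
  periodic_b : ∀ t ∈ Icc 0 T, IsPeriodic (fun x => b x t)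
  smooth_b : SmoothBounded (fun z : Space d × ℝ => b z.1 z.2) (univ ×ˢ Icc 0 T)
  bound_b : ∀ x, ∀ t ∈ Icc 0 T, ‖b x t‖ ≤ K
  periodic_V : ∀ s, IsPeriodic (fun x => V x s)
  smooth_V : SmoothBounded (fun z : Space d × ℝ => V z.1 z.2) univ
  bound_V : ∀ x s, |V x s| ≤ K
  periodic_m₀ : IsPeriodic m₀
  smooth_m₀ : ContDiff ℝ ∞ m₀
  integral_m₀ : cellIntegral m₀ = 1
  lower_m₀ : ∀ x, k₀ ≤ m₀ x
  bound_m₀ : ∀ x, m₀ x ≤ K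

/-- The rescaled momentum `Du / m^α` at `(x,t)`. -/
def momentum {d : ℕ} (α : ℝ) (u m : Space d → ℝ → ℝ) (x : Space d) (t : ℝ) : Space d :=
  (m x t ^ α)⁻¹ • gradient (fun y => u y t) x

/-- `(u, m)` is a `C^∞` solution on `𝕋^d × [0,T]`, with `m > 0`, of the mean-field game system with
congestion: `u` and `m` are smooth up to `t = 0` and `t = T`, the two equations hold for
`0 < t < T`, and the terminal and initial conditions hold. The field `flux` only says that the
divergence in the Fokker-Planck equation is a classical one; it is automatic when `H₀` is
smooth. -/
structure IsSolution {d : ℕ} (α T : ℝ) (L : Space d → Space d → ℝ) (Ψ : Space d → ℝ)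
    (b : Space d → ℝ → Space d) (V : Space d → ℝ → ℝ) (m₀ : Space d → ℝ)
    (u m : Space d → ℝ → ℝ) : Prop where
  periodic_u : ∀ t ∈ Icc 0 T, IsPeriodic (fun x => u x t)
  periodic_m : ∀ t ∈ Icc 0 T, IsPeriodic (fun x => m x t)
  smooth_u : ContDiffOn ℝ ∞ (fun z : Space d × ℝ => u z.1 z.2) (univ ×ˢ Icc 0 T)
  smooth_m : ContDiffOn ℝ ∞ (fun z : Space d × ℝ => m z.1 z.2) (univ ×ˢ Icc 0 T)
  pos : ∀ x, ∀ t ∈ Icc 0 T, 0 < m x t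
  flux : ∀ t ∈ Ioo 0 T,
    Differentiable ℝ (fun y => m y t • hamiltonianGrad L y (momentum α u m y t))
  hamilton_jacobi : ∀ x, ∀ t ∈ Ioo 0 T,
    -deriv (fun s => u x s) t - Laplacian.laplacian (fun y => u y t) x
      + m x t ^ α * hamiltonian L x (momentum α u m x t)
      + ⟪b x t, gradient (fun y => u y t) x⟫_ℝ = V x (m x t)
  fokker_planck : ∀ x, ∀ t ∈ Ioo 0 T,
    deriv (fun s => m x s) t - Laplacian.laplacian (fun y => m y t) x
      - divergence (fun y => m y t • hamiltonianGrad L y (momentum α u m y t)) x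
      - divergence (fun y => m y t • b y t) x = 0
  terminal : ∀ x, u x T = Ψ x
  initial : ∀ x, m x 0 = m₀ x

end CongestionMFG

end

/-!
Write `p = Du / m^α`, let `H₀(x,p)` be the Hamiltonian, and integrate over the torus throughout.

The engine is an identity for the time derivative of `∫ (a + c u) m^q` along a solution
(`IsSolution.hasDerivAt_energy`). Inserting both equations, the second-order terms and the
divergence of the flux combine into a single divergence, the mixed terms `Du · Dm` cancel, and only
first-order terms remain. The divergence theorem is used in the form that asks for a continuous
divergence only, so no regularity of `H₀` beyond the differentiability of the flux is needed.

With `a` constant, `c = -1` and `q = -r` the Hamilton-Jacobi equation yields the good term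
`-m^(α-r) |p|^γ` and the Fokker-Planck equation the good term `-(a - u) m^(-r-2) |Dm|²`, provided
that `a - u` is positive and bounded. The bad term is the squared drift
`m^(-r) |D_p H₀ + b|² ≲ m^(-r) (|p|^(2γ-2) + 1)`. Since `γ < 2`, it is absorbed by the first good
term up to `m^(-r-κ)` with `κ` independent of `r` (`Constants.exists_drift_absorption`). For large
`r` this is a slightly superlinear power of `m^(-r)`, and a Sobolev inequality together with the
second good term reduces it to a power of `∫ m^(-r)` (`exists_negative_power_interpolation`). The
resulting differential inequality `y' ≤ C (1 + y)^N`, with `y(0)` controlled by `k₀`, bounds `y` up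
to a time `t₁` that depends on the constants only (`le_of_rate_bound`). As the bound is uniform up
to `t₁`, the exponent `δ` is immaterial.

It remains to bound `u` on both sides.

* From below, by the maximum principle, as `H₀(x,0) ≤ 0` (`IsSolution.neg_le`).
* From above, `H₀(x,p) ≥ K |p| - C` absorbs the drift and gives `-u_t - Δu ≤ C (1 + m^α)`. Hence `u`
  is bounded by Duhamel's formula for the heat kernel as soon as `m^α` is bounded in
  `L^∞(0,T; L^s)` with `s > d / 2` (`exists_u_upper`). For `s = (1 + α) / α` this is the condition
  `α < 2 / (d - 2)`.

The required bound of `∫ m^(1+α)` is `exists_energy_bound`. The derivative of `∫ u m` contains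
`-m^(1+α) |p|^γ`, which absorbs the drift term in the derivative of `∫ m^(1+α)`; the dissipation
absorbs `m^(1+α)` itself because `∫ m = 1`; and `∫ u m` at time `0` is controlled by the mean value
of `u(·,0)`, hence, integrating the Hamilton-Jacobi equation, by the time integral of `∫ m^α`, which
is of lower order.
-/

namespace CongestionMFG

open scoped Pointwise Topology

/-! ### The unit cell and periodic functions -/

/-- The unit cell `[0,1)^d`, a fundamental domain of the torus. -/
def cell (d : ℕ) : Set (Space d) := {x | ∀ i, x i ∈ Ico (0 : ℝ) 1}

/-- The closed unit cell `[0,1]^d`. -/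
def closedCell (d : ℕ) : Set (Space d) := {x | ∀ i, x i ∈ Icc (0 : ℝ) 1}

/-- The lattice vector with integer coordinates `k`. -/
noncomputable def latticeVec {d : ℕ} (k : Fin d → ℤ) : Space d :=
  WithLp.toLp 2 (fun i => (k i : ℝ))

lemma cell_eq_fundamentalDomain (d : ℕ) :
    cell d = ZSpan.fundamentalDomain (EuclideanSpace.basisFun (Fin d) ℝ).toBasis := by
  ext x
  simp [cell, ZSpan.mem_fundamentalDomain]

lemma cell_eq_preimage (d : ℕ) :
    cell d = (MeasurableEquiv.toLp 2 (Fin d → ℝ)).symm ⁻¹' (univ.pi fun _ => Ico (0 : ℝ) 1) := by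
  ext x; simp [cell, Set.mem_pi]

lemma measurableSet_cell (d : ℕ) : MeasurableSet (cell d) := by
  rw [cell_eq_preimage]
  exact (MeasurableEquiv.toLp 2 (Fin d → ℝ)).symm.measurable
    (MeasurableSet.univ_pi fun _ => measurableSet_Ico)

lemma volume_cell (d : ℕ) : volume (cell d) = 1 := by
  rw [cell_eq_preimage,
    (EuclideanSpace.volume_preserving_symm_measurableEquiv_toLp (Fin d)).measure_preimage
      (MeasurableSet.univ_pi fun _ => measurableSet_Ico).nullMeasurableSet,
    volume_pi_pi]
  simp

instance (d : ℕ) : IsProbabilityMeasure (volume.restrict (cell d)) :=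
  ⟨by simp [volume_cell]⟩

lemma cell_subset_closedCell (d : ℕ) : cell d ⊆ closedCell d :=
  fun _ hx i => Ico_subset_Icc_self (hx i)

lemma isCompact_closedCell (d : ℕ) : IsCompact (closedCell d) := by
  have : closedCell d = (EuclideanSpace.equiv (Fin d) ℝ).symm '' (Icc 0 1) := by
    rw [ContinuousLinearEquiv.image_symm_eq_preimage]
    ext x
    simp [closedCell, Pi.le_def, forall_and]
  rw [this]
  exact isCompact_Icc.image (EuclideanSpace.equiv (Fin d) ℝ).symm.continuous

lemma norm_le_of_mem_cell {d : ℕ} {w : Space d} (hw : w ∈ cell d) : ‖w‖ ^ 2 ≤ d := by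
  rw [EuclideanSpace.norm_sq_eq]
  calc ∑ i, ‖w i‖ ^ 2 ≤ ∑ _i : Fin d, (1 : ℝ) := by
        refine Finset.sum_le_sum fun i _ => ?_
        have := hw i
        rw [Real.norm_eq_abs, sq_abs]
        nlinarith [this.1, this.2]
    _ = d := by simp

lemma exists_add_latticeVec_mem_cell {d : ℕ} (x : Space d) :
    ∃ k : Fin d → ℤ, x + latticeVec k ∈ cell d := by
  refine ⟨fun i => -⌊x i⌋, fun i => ?_⟩
  have h1 := Int.floor_le (x i)
  have h2 := Int.lt_floor_add_one (x i)
  simp only [latticeVec, PiLp.add_apply, Int.cast_neg, mem_Ico]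
  constructor <;> linarith

lemma IsPeriodic.exists_mem_cell {d : ℕ} {X : Type*} {f : Space d → X} (hf : IsPeriodic f)
    (x : Space d) : ∃ y ∈ cell d, f y = f x := by
  obtain ⟨k, hk⟩ := exists_add_latticeVec_mem_cell x
  exact ⟨_, hk, hf k x⟩

/-- A continuous periodic function of `(x,t)`, `t` in a compact interval, is bounded. -/
lemma exists_norm_le_of_periodic {d : ℕ} {E : Type*} [NormedAddCommGroup E]
    {f : Space d → ℝ → E} {a b : ℝ}
    (hc : ContinuousOn (fun z : Space d × ℝ => f z.1 z.2) (univ ×ˢ Icc a b))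
    (hf : ∀ t ∈ Icc a b, IsPeriodic (fun x => f x t)) :
    ∃ B : ℝ, 0 ≤ B ∧ ∀ x, ∀ t ∈ Icc a b, ‖f x t‖ ≤ B := by
  obtain ⟨B, hB⟩ := ((isCompact_closedCell d).prod (isCompact_Icc (a := a) (b := b))
    ).exists_bound_of_continuousOn
    (hc.mono (prod_mono (subset_univ _) le_rfl))
  refine ⟨max B 0, le_max_right _ _, fun x t ht => ?_⟩
  obtain ⟨y, hy, hyx⟩ := (hf t ht).exists_mem_cell x
  have h := hB (y, t) ⟨cell_subset_closedCell d hy, ht⟩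
  simp only [hyx] at h
  exact h.trans (le_max_left _ _)

lemma IsPeriodic.exists_norm_le {d : ℕ} {E : Type*} [NormedAddCommGroup E]
    {f : Space d → E} (hf : IsPeriodic f) (hc : Continuous f) : ∃ B : ℝ, 0 ≤ B ∧ ∀ x, ‖f x‖ ≤ B := by
  obtain ⟨B, h0, hB⟩ := exists_norm_le_of_periodic (f := fun x (_ : ℝ) => f x) (a := 0) (b := 0)
    (hc.comp continuous_fst).continuousOn (fun _ _ => hf)
  exact ⟨B, h0, fun x => hB x 0 (by simp)⟩

lemma integrableOn_cell {d : ℕ} {E : Type*} [NormedAddCommGroup E] {f : Space d → E}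
    (hf : Continuous f) : IntegrableOn f (cell d) :=
  (hf.continuousOn.integrableOn_compact (isCompact_closedCell d)).mono_set
    (cell_subset_closedCell d)

section cellIntegral
variable {d : ℕ} {f g : Space d → ℝ}

lemma cellIntegral_eq (f : Space d → ℝ) : cellIntegral f = ∫ x in cell d, f x := rfl

lemma cellIntegral_mono (hf : Continuous f) (hg : Continuous g) (h : ∀ x, f x ≤ g x) :
    cellIntegral f ≤ cellIntegral g :=
  integral_mono (integrableOn_cell hf) (integrableOn_cell hg) h

lemma cellIntegral_add (hf : Continuous f) (hg : Continuous g) :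
    cellIntegral (fun x => f x + g x) = cellIntegral f + cellIntegral g :=
  integral_add (integrableOn_cell hf) (integrableOn_cell hg)

lemma cellIntegral_sub (hf : Continuous f) (hg : Continuous g) :
    cellIntegral (fun x => f x - g x) = cellIntegral f - cellIntegral g :=
  integral_sub (integrableOn_cell hf) (integrableOn_cell hg)

lemma cellIntegral_const_mul (c : ℝ) (f : Space d → ℝ) :
    cellIntegral (fun x => c * f x) = c * cellIntegral f :=
  integral_const_mul c f

lemma cellIntegral_const (c : ℝ) : cellIntegral (fun _ : Space d => c) = c := by
  simp [cellIntegral_eq]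

lemma cellIntegral_nonneg (h : ∀ x, 0 ≤ f x) : 0 ≤ cellIntegral f := integral_nonneg h

lemma ofReal_cellIntegral (hf : Continuous f) (h : ∀ x, 0 ≤ f x) :
    ENNReal.ofReal (cellIntegral f) = ∫⁻ x in cell d, ENNReal.ofReal (f x) :=
  ofReal_integral_eq_lintegral_ofReal (integrableOn_cell hf) (ae_of_all _ h)

end cellIntegral

lemma IsPeriodic.vadd_eq {d : ℕ} {X : Type*} {f : Space d → X} (hf : IsPeriodic f)
    (v : (Submodule.span ℤ
      (Set.range (EuclideanSpace.basisFun (Fin d) ℝ).toBasis)).toAddSubgroup) (x : Space d) :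
    f (v +ᵥ x) = f x := by
  obtain ⟨v, hv⟩ := v
  obtain ⟨k, rfl⟩ := (Submodule.mem_span_range_iff_exists_fun ℤ).1 hv
  have : (⟨_, hv⟩ : (Submodule.span ℤ
      (Set.range (EuclideanSpace.basisFun (Fin d) ℝ).toBasis)).toAddSubgroup) +ᵥ x = x + WithLp.toLp 2 (fun i => (k i : ℝ)) := by
    rw [AddSubgroup.vadd_def, vadd_eq_add, add_comm]
    congr 1
    ext i
    simp [EuclideanSpace.basisFun_apply, Finset.sum_apply, Pi.single_apply]
  rw [this]
  exact hf k x

/-- The integral of a periodic function over a cell does not change under translation. -/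
lemma lintegral_cell_add {d : ℕ} {g : Space d → ENNReal} (hg : IsPeriodic g) (y : Space d) :
    ∫⁻ w in cell d, g (y + w) = ∫⁻ w in cell d, g w := by
  have h1 := ZSpan.isAddFundamentalDomain' (EuclideanSpace.basisFun (Fin d) ℝ).toBasis
    (volume : Measure (Space d))
  rw [← cell_eq_fundamentalDomain] at h1
  have h2 := h1.vadd_of_comm y
  have : ∫⁻ w in cell d, g (y + w) = ∫⁻ w in y +ᵥ cell d, g w := by
    have hmp : MeasurePreserving (fun w : Space d => y + w) volume volume :=
      measurePreserving_add_left _ y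
    exact hmp.setLIntegral_comp_emb (measurableEmbedding_addLeft y) g (cell d)
  rw [this]
  have : Countable (Submodule.span ℤ
      (Set.range (EuclideanSpace.basisFun (Fin d) ℝ).toBasis)).toAddSubgroup :=
    inferInstanceAs (Countable (Submodule.span ℤ
      (Set.range (EuclideanSpace.basisFun (Fin d) ℝ).toBasis)))
  exact h2.setLIntegral_eq h1 g hg.vadd_eq

/-- If a kernel is dominated by the cell averages of another kernel, then its integral against a
periodic function is controlled by the integral of that function over one cell. -/
lemma lintegral_mul_le_of_le_average {d : ℕ} {k Q g : Space d → ENNReal}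
    (hQ : Measurable Q) (hg : Measurable g) (hper : IsPeriodic g)
    (h : ∀ y, k y ≤ ∫⁻ w in cell d, Q (y - w)) :
    ∫⁻ y, k y * g y ≤ (∫⁻ y, Q y) * ∫⁻ y in cell d, g y := by
  calc ∫⁻ y, k y * g y ≤ ∫⁻ y, ∫⁻ w in cell d, Q (y - w) * g y := by
        refine lintegral_mono fun y => ?_
        dsimp only
        rw [lintegral_mul_const _ (by fun_prop)]
        gcongr
        exact h y
    _ = ∫⁻ w in cell d, ∫⁻ y, Q (y - w) * g y := by
        rw [lintegral_lintegral_swap]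
        fun_prop
    _ = ∫⁻ w in cell d, ∫⁻ y, Q y * g (y + w) := by
        refine lintegral_congr fun w => ?_
        rw [← lintegral_add_right_eq_self (fun y => Q (y - w) * g y) w]
        simp
    _ = ∫⁻ y, ∫⁻ w in cell d, Q y * g (y + w) := by
        rw [lintegral_lintegral_swap]
        fun_prop
    _ = ∫⁻ y, Q y * ∫⁻ w in cell d, g w := by
        refine lintegral_congr fun y => ?_
        rw [lintegral_const_mul _ (by fun_prop), lintegral_cell_add hper]
    _ = _ := lintegral_mul_const _ hQ

/-- The divergence theorem on the torus. Only the divergence, not the full derivative, has to be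
continuous. -/
lemma cellIntegral_divergence {d : ℕ} {F : Space d → Space d} (hF : Differentiable ℝ F)
    (hper : IsPeriodic F) (hc : Continuous (divergence F)) :
    cellIntegral (divergence F) = 0 := by
  rcases d with _ | n
  · have : divergence F = fun _ => 0 := by
      funext x; simp [divergence]
    rw [this, cellIntegral_const]
  let e := (EuclideanSpace.equiv (Fin (n + 1)) ℝ)
  have hmp := EuclideanSpace.volume_preserving_symm_measurableEquiv_toLp (Fin (n + 1))
  have hmp' := hmp.symm
  let f : (Fin (n + 1) → ℝ) → Fin (n + 1) → ℝ := fun y => e (F (e.symm y))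
  let f' : (Fin (n + 1) → ℝ) → (Fin (n + 1) → ℝ) →L[ℝ] (Fin (n + 1) → ℝ) := fun y =>
    (e : Space (n + 1) →L[ℝ] (Fin (n + 1) → ℝ)).comp
      ((fderiv ℝ F (e.symm y)).comp (e.symm : (Fin (n + 1) → ℝ) →L[ℝ] Space (n + 1)))
  have hd : ∀ y, HasFDerivAt f (f' y) y := fun y =>
    e.hasFDerivAt.comp y ((hF _).hasFDerivAt.comp y e.symm.hasFDerivAt)
  have hdiv : ∀ y, ∑ i, f' y (Pi.single i 1) i = divergence F (e.symm y) := by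
    intro y
    rfl
  have hcont : Continuous (fun y => ∑ i, f' y (Pi.single i 1) i) := by
    simp_rw [hdiv]
    exact hc.comp e.symm.continuous
  have key := integral_divergence_of_hasFDerivAt_off_countable (0 : Fin (n + 1) → ℝ) 1
    (fun _ => zero_le_one) f f' ∅ countable_empty
    (fun y _ => (hd y).continuousAt.continuousWithinAt) (fun y _ => hd y)
    (hcont.continuousOn.integrableOn_compact isCompact_Icc)
  have hz : ∫ y in Icc (0 : Fin (n + 1) → ℝ) 1, ∑ i, f' y (Pi.single i 1) i = 0 := by
    rw [key]
    refine Finset.sum_eq_zero fun i _ => ?_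
    rw [sub_eq_zero]
    refine integral_congr_ae (ae_of_all _ fun y => ?_)
    have h := hper (Pi.single i 1) (e.symm (i.insertNth 0 y))
    have h2 : e.symm (i.insertNth 0 y) + WithLp.toLp 2 (fun j => ((Pi.single i 1 : Fin (n + 1) → ℤ) j : ℝ))
        = e.symm (i.insertNth 1 y) := by
      ext j
      refine Fin.succAboveCases i ?_ (fun j => ?_) j
      · simp [e]
      · simp [e]
    rw [h2] at h
    change e (F (e.symm (i.insertNth 1 y))) i = e (F (e.symm (i.insertNth 0 y))) i
    rw [h]
  have h1 : cellIntegral (divergence F)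
      = ∫ y in univ.pi (fun _ : Fin (n + 1) => Ico (0 : ℝ) 1), divergence F (e.symm y) := by
    rw [cellIntegral_eq, cell_eq_preimage,
      ← hmp.setIntegral_preimage_emb (MeasurableEquiv.measurableEmbedding _)]
    rfl
  rw [h1, setIntegral_congr_set (t := Icc 0 1)]
  · simpa only [hdiv] using hz
  · exact Measure.univ_pi_Ico_ae_eq_Icc (f := (0 : Fin (n + 1) → ℝ)) (g := 1)

/-! ### Differential calculus on the torus -/

section Space
variable {d : ℕ}

lemma inner_gradient (f : Space d → ℝ) (x v : Space d) :
    ⟪gradient f x, v⟫_ℝ = fderiv ℝ f x v := by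
  simp [gradient]

lemma gradient_apply (f : Space d → ℝ) (x : Space d) (i : Fin d) :
    gradient f x i = fderiv ℝ f x (EuclideanSpace.single i 1) := by
  rw [← inner_gradient, EuclideanSpace.inner_single_right]
  simp

lemma inner_eq_sum (v w : Space d) : ⟪v, w⟫_ℝ = ∑ i, v i * w i := by
  simp [PiLp.inner_apply, mul_comm]

lemma gradient_add {f g : Space d → ℝ} {x : Space d} (hf : DifferentiableAt ℝ f x)
    (hg : DifferentiableAt ℝ g x) :
    gradient (fun y => f y + g y) x = gradient f x + gradient g x := by
  simp [gradient, fderiv_fun_add hf hg]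

lemma gradient_const_mul {f : Space d → ℝ} {x : Space d} (hf : DifferentiableAt ℝ f x) (c : ℝ) :
    gradient (fun y => c * f y) x = c • gradient f x := by
  simp [gradient, fderiv_const_mul hf]

lemma gradient_const (c : ℝ) (x : Space d) : gradient (fun _ : Space d => c) x = 0 := by
  simp [gradient]

lemma gradient_mul {f g : Space d → ℝ} {x : Space d} (hf : DifferentiableAt ℝ f x)
    (hg : DifferentiableAt ℝ g x) :
    gradient (fun y => f y * g y) x = f x • gradient g x + g x • gradient f x := by
  simp [gradient, fderiv_fun_mul hf hg]

lemma gradient_rpow {f : Space d → ℝ} {x : Space d} (hf : DifferentiableAt ℝ f x) (h0 : 0 < f x)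
    (q : ℝ) : gradient (fun y => f y ^ q) x = (q * f x ^ (q - 1)) • gradient f x := by
  have h := hf.hasFDerivAt.rpow_const (p := q) (Or.inl h0.ne')
  rw [gradient, h.fderiv, map_smul, gradient]

lemma continuous_gradient {f : Space d → ℝ} (hf : ContDiff ℝ 1 f) : Continuous (gradient f) :=
  (InnerProductSpace.toDual ℝ (Space d)).symm.continuous.comp (hf.continuous_fderiv one_ne_zero)

lemma contDiff_gradient {f : Space d → ℝ} (hf : ContDiff ℝ ∞ f) : ContDiff ℝ ∞ (gradient f) :=
  (InnerProductSpace.toDual ℝ (Space d)).symm.contDiff.comp (hf.fderiv_right le_rfl)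

lemma IsPeriodic.fderiv {F : Type*} [NormedAddCommGroup F] [NormedSpace ℝ F] {f : Space d → F}
    (hf : IsPeriodic f) : IsPeriodic (fderiv ℝ f) := by
  intro k x
  rw [← fderiv_comp_add_right (f := f)]
  congr 1
  funext y
  exact hf k y

lemma IsPeriodic.gradient {f : Space d → ℝ} (hf : IsPeriodic f) :
    IsPeriodic (gradient f) := fun k x => by
  simp only [_root_.gradient]
  rw [hf.fderiv k x]

lemma divergence_add {F G : Space d → Space d} {x : Space d} (hF : DifferentiableAt ℝ F x)
    (hG : DifferentiableAt ℝ G x) :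
    divergence (fun y => F y + G y) x = divergence F x + divergence G x := by
  simp [divergence, fderiv_fun_add hF hG, Finset.sum_add_distrib]

lemma divergence_smul {φ : Space d → ℝ} {F : Space d → Space d} {x : Space d}
    (hφ : DifferentiableAt ℝ φ x) (hF : DifferentiableAt ℝ F x) :
    divergence (fun y => φ y • F y) x = φ x * divergence F x + ⟪gradient φ x, F x⟫_ℝ := by
  simp only [divergence, fderiv_fun_smul hφ hF, inner_eq_sum, gradient_apply, Finset.mul_sum,
    ← Finset.sum_add_distrib]
  simp

lemma laplacian_eq_divergence {f : Space d → ℝ} (hf : ContDiff ℝ ∞ f) (x : Space d) :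
    Laplacian.laplacian f x = divergence (gradient f) x := by
  rw [InnerProductSpace.laplacian_eq_iteratedFDeriv_orthonormalBasis f
    (EuclideanSpace.basisFun (Fin d) ℝ)]
  refine Finset.sum_congr rfl fun i _ => ?_
  rw [iteratedFDeriv_two_apply]
  have h1 : HasFDerivAt (gradient f) (fderiv ℝ (gradient f) x) x :=
    ((contDiff_gradient hf).differentiable (by simp) x).hasFDerivAt
  have h2 : HasFDerivAt (fun y => gradient f y i) _ x :=
    (EuclideanSpace.proj (𝕜 := ℝ) i : Space d →L[ℝ] ℝ).hasFDerivAt.comp x h1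
  have h3 : HasFDerivAt (fderiv ℝ f) (fderiv ℝ (fderiv ℝ f) x) x :=
    (((hf.fderiv_right (m := ∞) le_rfl).differentiable (by simp)) x).hasFDerivAt
  have h4 := h3.clm_apply (hasFDerivAt_const (EuclideanSpace.single i (1 : ℝ)) x)
  simp only [gradient_apply] at h2
  have h5 := congrArg (fun l => l (EuclideanSpace.single i (1 : ℝ))) (h2.unique h4)
  simpa using h5.symm

lemma continuous_laplacian {f : Space d → ℝ} (hf : ContDiff ℝ ∞ f) :
    Continuous (Laplacian.laplacian f) := by
  have : Laplacian.laplacian f = divergence (gradient f) := funext (laplacian_eq_divergence hf)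
  rw [this]
  have h := (contDiff_gradient hf).continuous_fderiv (by simp)
  unfold divergence
  fun_prop

lemma iteratedFDeriv_two_nonneg_of_isLocalMin {f : Space d → ℝ} (hf : ContDiff ℝ ∞ f)
    {x : Space d} (hx : IsLocalMin f x) (v : Space d) :
    0 ≤ iteratedFDeriv ℝ 2 f x ![v, v] := by
  set g : ℝ → ℝ := fun s => f (x + s • v) with hg
  have hl : ∀ s : ℝ, HasDerivAt (fun s : ℝ => x + s • v) v s := fun s => by
    simpa using ((hasDerivAt_id s).smul_const v).const_add x
  have hg1 : ∀ s, HasDerivAt g (fderiv ℝ f (x + s • v) v) s := fun s =>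
    ((hf.differentiable (by simp)) _).hasFDerivAt.comp_hasDerivAt s (hl s)
  have hdg : deriv g = fun s => fderiv ℝ f (x + s • v) v := funext fun s => (hg1 s).deriv
  have hg2 : HasDerivAt (deriv g) (iteratedFDeriv ℝ 2 f x ![v, v]) 0 := by
    have h0 : HasFDerivAt (fderiv ℝ f) (fderiv ℝ (fderiv ℝ f) x) (x + (0 : ℝ) • v) := by
      rw [zero_smul, add_zero]
      exact (((hf.fderiv_right (m := ∞) le_rfl).differentiable (by simp)) x).hasFDerivAt
    have h : HasDerivAt (fun s : ℝ => fderiv ℝ f (x + s • v)) (fderiv ℝ (fderiv ℝ f) x v) 0 :=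
      HasFDerivAt.comp_hasDerivAt (f := fun s : ℝ => x + s • v) (0 : ℝ) h0 (hl 0)
    have h' := h.clm_apply (hasDerivAt_const (0 : ℝ) v)
    rw [map_zero, add_zero] at h'
    rw [hdg, iteratedFDeriv_two_apply]
    exact h'
  have hmin : IsLocalMin g 0 := by
    have hc : ContinuousAt (fun s : ℝ => x + s • v) 0 := (hl 0).continuousAt
    have := hc.tendsto
    simp only [zero_smul, add_zero] at this
    have h3 := this.eventually hx
    simpa [IsLocalMin, IsMinFilter, hg] using h3
  by_contra hneg
  push Not at hneg
  have hd0 : deriv g 0 = 0 := hmin.deriv_eq_zero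
  have hmax : IsLocalMax g 0 :=
    isLocalMax_of_deriv_deriv_neg (by rw [hg2.deriv]; exact hneg) hd0 (hg1 0).continuousAt
  have hconst : g =ᶠ[𝓝 0] fun _ => g 0 := by
    filter_upwards [hmin, hmax] with s h1 h2 using le_antisymm h2 h1
  have h4 : deriv g =ᶠ[𝓝 0] fun _ => 0 := by
    have := hconst.deriv
    simpa using this
  have h5 := h4.deriv_eq
  rw [hg2.deriv] at h5
  simp at h5
  linarith

lemma laplacian_nonneg_of_isLocalMin {f : Space d → ℝ} (hf : ContDiff ℝ ∞ f)
    {x : Space d} (hx : IsLocalMin f x) : 0 ≤ Laplacian.laplacian f x := by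
  rw [InnerProductSpace.laplacian_eq_iteratedFDeriv_orthonormalBasis f
    (EuclideanSpace.basisFun (Fin d) ℝ)]
  exact Finset.sum_nonneg fun i _ => iteratedFDeriv_two_nonneg_of_isLocalMin hf hx _

end Space

/-! ### Functions of space and time -/

section SpaceTime
variable {d : ℕ} {f : Space d → ℝ → ℝ} {a b : ℝ}

/-- `f(x,t)` is smooth for `x` in the whole space and `t` in the open interval `(a,b)`. -/
def SmoothOnStrip (f : Space d → ℝ → ℝ) (a b : ℝ) : Prop :=
  ContDiffOn ℝ ∞ (fun z : Space d × ℝ => f z.1 z.2) (univ ×ˢ Ioo a b)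

lemma contDiff_slice {F : Type*} [NormedAddCommGroup F] [NormedSpace ℝ F] {f : Space d → ℝ → F}
    {s : Set ℝ}
    (hf : ContDiffOn ℝ ∞ (fun z : Space d × ℝ => f z.1 z.2) (univ ×ˢ s)) {t : ℝ} (ht : t ∈ s) :
    ContDiff ℝ ∞ (fun y => f y t) := by
  rw [← contDiffOn_univ]
  exact hf.comp (t := univ ×ˢ s) (f := fun y : Space d => (y, t)) (by fun_prop)
    (fun y _ => ⟨mem_univ _, ht⟩)

namespace SmoothOnStrip

lemma contDiffAt (hf : SmoothOnStrip f a b) {x : Space d} {t : ℝ} (ht : t ∈ Ioo a b) :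
    ContDiffAt ℝ ∞ (fun z : Space d × ℝ => f z.1 z.2) (x, t) :=
  ContDiffOn.contDiffAt hf ((isOpen_univ.prod isOpen_Ioo).mem_nhds ⟨mem_univ _, ht⟩)

lemma hasFDerivAt (hf : SmoothOnStrip f a b) {x : Space d} {t : ℝ} (ht : t ∈ Ioo a b) :
    HasFDerivAt (fun z : Space d × ℝ => f z.1 z.2)
      (fderiv ℝ (fun z : Space d × ℝ => f z.1 z.2) (x, t)) (x, t) :=
  ((hf.contDiffAt ht).differentiableAt (by simp)).hasFDerivAt

lemma continuousOn_fderiv (hf : SmoothOnStrip f a b) :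
    ContinuousOn (fderiv ℝ (fun z : Space d × ℝ => f z.1 z.2)) (univ ×ˢ Ioo a b) :=
  ContDiffOn.continuousOn_fderiv_of_isOpen hf (isOpen_univ.prod isOpen_Ioo) (by simp)

lemma hasDerivAt (hf : SmoothOnStrip f a b) {x : Space d} {t : ℝ} (ht : t ∈ Ioo a b) :
    HasDerivAt (f x) (fderiv ℝ (fun z : Space d × ℝ => f z.1 z.2) (x, t) (0, 1)) t :=
  (hf.hasFDerivAt ht).comp_hasDerivAt t ((hasDerivAt_const t x).prodMk (hasDerivAt_id t))

lemma differentiableAt (hf : SmoothOnStrip f a b) {x : Space d} {t : ℝ} (ht : t ∈ Ioo a b) :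
    DifferentiableAt ℝ (f x) t := (hf.hasDerivAt ht).differentiableAt

lemma fderiv_slice (hf : SmoothOnStrip f a b) {x : Space d} {t : ℝ} (ht : t ∈ Ioo a b)
    (v : Space d) :
    fderiv ℝ (fun y => f y t) x v
      = fderiv ℝ (fun z : Space d × ℝ => f z.1 z.2) (x, t) (v, 0) := by
  have h := HasFDerivAt.comp (f := fun y : Space d => (y, t)) x (hf.hasFDerivAt ht)
    ((hasFDerivAt_id x).prodMk (hasFDerivAt_const t x))
  have h2 := congrArg (fun l => l v) h.fderiv
  exact h2

lemma continuousOn_deriv (hf : SmoothOnStrip f a b) :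
    ContinuousOn (fun z : Space d × ℝ => deriv (f z.1) z.2) (univ ×ˢ Ioo a b) := by
  have h : ContinuousOn (fun z : Space d × ℝ =>
      fderiv ℝ (fun z : Space d × ℝ => f z.1 z.2) z (0, 1)) (univ ×ˢ Ioo a b) :=
    hf.continuousOn_fderiv.clm_apply continuousOn_const
  exact h.congr fun z hz => (hf.hasDerivAt hz.2).deriv

lemma continuous_deriv_slice (hf : SmoothOnStrip f a b) {t : ℝ} (ht : t ∈ Ioo a b) :
    Continuous (fun x => deriv (f x) t) := by
  rw [← continuousOn_univ]
  exact hf.continuousOn_deriv.comp (f := fun x : Space d => (x, t)) (by fun_prop)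
    (fun x _ => ⟨mem_univ _, ht⟩)

/-- Differentiation under the integral over the torus. -/
lemma hasDerivAt_cellIntegral (hf : SmoothOnStrip f a b) {t : ℝ} (ht : t ∈ Ioo a b) :
    HasDerivAt (fun s => cellIntegral (fun x => f x s))
      (cellIntegral (fun x => deriv (f x) t)) t := by
  obtain ⟨ε, hε, hball⟩ := Metric.nhds_basis_closedBall.mem_iff.1 (isOpen_Ioo.mem_nhds ht)
  obtain ⟨B, hB⟩ := ((isCompact_closedCell d).prod (isCompact_closedBall t ε)
    ).exists_bound_of_continuousOn
    (hf.continuousOn_deriv.mono (prod_mono (subset_univ _) hball))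
  have hcont : ∀ s ∈ Ioo a b, Continuous (fun x => f x s) := fun s hs =>
    (contDiff_slice hf hs).continuous
  refine (hasDerivAt_integral_of_dominated_loc_of_deriv_le (μ := volume.restrict (cell d))
    (F := fun s x => f x s) (F' := fun s x => deriv (f x) s) (bound := fun _ => B)
    (Metric.closedBall_mem_nhds t hε) ?_ (integrableOn_cell (hcont t ht))
    (hf.continuous_deriv_slice ht).aestronglyMeasurable ?_ (integrable_const B) ?_).2
  · filter_upwards [isOpen_Ioo.mem_nhds ht] with s hs using (hcont s hs).aestronglyMeasurable
  · filter_upwards [ae_restrict_mem (measurableSet_cell d)] with x hx s hs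
    exact hB (x, s) ⟨cell_subset_closedCell d hx, hs⟩
  · exact ae_of_all _ fun x s hs => (hf.differentiableAt (hball hs)).hasDerivAt

end SmoothOnStrip

lemma continuousOn_cellIntegral
    (hf : ContinuousOn (fun z : Space d × ℝ => f z.1 z.2) (univ ×ˢ Icc a b)) :
    ContinuousOn (fun s => cellIntegral (fun x => f x s)) (Icc a b) := by
  obtain ⟨B, hB⟩ := ((isCompact_closedCell d).prod (isCompact_Icc (a := a) (b := b))
    ).exists_bound_of_continuousOn (hf.mono (prod_mono (subset_univ _) le_rfl))
  refine continuousOn_of_dominated (μ := volume.restrict (cell d)) (bound := fun _ => B) ?_ ?_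
    (integrable_const B) ?_
  · intro s hs
    have : Continuous (fun x => f x s) := by
      rw [← continuousOn_univ]
      exact hf.comp (f := fun x : Space d => (x, s)) (by fun_prop) (fun x _ => ⟨mem_univ _, hs⟩)
    exact this.aestronglyMeasurable
  · intro s hs
    filter_upwards [ae_restrict_mem (measurableSet_cell d)] with x hx
    exact hB (x, s) ⟨cell_subset_closedCell d hx, hs⟩
  · exact ae_of_all _ fun x => hf.comp (f := fun s : ℝ => (x, s)) (by fun_prop)
      (fun s hs => ⟨mem_univ _, hs⟩)

end SpaceTime

/-! ### Time derivatives of the integrals of `(a + c u) m^q` -/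

section Slice
variable {d : ℕ}

/-- Integration by parts on the torus for the system at a fixed time. Both Laplacians and the
divergence of the flux `m B` disappear: they combine into the divergence of
`-c m^q Du + q (a + c u) m^(q-1) (Dm + m B)`, and the mixed terms `Du · Dm` cancel. -/
lemma cellIntegral_rate_eq {u m ut mt N : Space d → ℝ} {B : Space d → Space d}
    (hu : ContDiff ℝ ∞ u) (hm : ContDiff ℝ ∞ m) (hpu : IsPeriodic u) (hpm : IsPeriodic m)
    (hpos : ∀ x, 0 < m x) (hB : Differentiable ℝ (fun y => m y • B y)) (hpB : IsPeriodic B)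
    (hut : Continuous ut) (hmt : Continuous mt)
    (hHJ : ∀ x, ut x = -Laplacian.laplacian u x + N x)
    (hFP : ∀ x, mt x = Laplacian.laplacian m x + divergence (fun y => m y • B y) x)
    (a c q : ℝ) :
    Continuous (fun x => c * m x ^ q * N x
        - q * (q - 1) * (a + c * u x) * m x ^ (q - 2) * ‖gradient m x‖ ^ 2
        - q * c * m x ^ q * ⟪gradient u x, B x⟫_ℝ
        - q * (q - 1) * (a + c * u x) * m x ^ (q - 1) * ⟪gradient m x, B x⟫_ℝ) ∧
    cellIntegral (fun x => c * ut x * m x ^ q + q * (a + c * u x) * m x ^ (q - 1) * mt x)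
      = cellIntegral (fun x => c * m x ^ q * N x
        - q * (q - 1) * (a + c * u x) * m x ^ (q - 2) * ‖gradient m x‖ ^ 2
        - q * c * m x ^ q * ⟪gradient u x, B x⟫_ℝ
        - q * (q - 1) * (a + c * u x) * m x ^ (q - 1) * ⟪gradient m x, B x⟫_ℝ) := by
  have hne : ∀ x, m x ≠ 0 := fun x => (hpos x).ne'
  have hmc : Continuous m := hm.continuous
  have hpow : ∀ s : ℝ, ContDiff ℝ ∞ (fun x => m x ^ s) := fun s => hm.rpow_const_of_ne hne
  have hBc : Continuous B := by
    have : B = fun x => (m x)⁻¹ • (m x • B x) := by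
      funext x; rw [inv_smul_smul₀ (hne x)]
    rw [this]
    exact (hmc.inv₀ hne).smul hB.continuous
  have hgu := contDiff_gradient hu
  have hgm := contDiff_gradient hm
  have hguc : Continuous (gradient u) := hgu.continuous
  have hgmc : Continuous (gradient m) := hgm.continuous
  have hNc : Continuous N := by
    have : N = fun x => ut x + Laplacian.laplacian u x := by
      funext x; rw [hHJ x]; ring
    rw [this]
    exact hut.add (continuous_laplacian hu)
  have huc := hu.continuous
  have hpc : ∀ s : ℝ, Continuous (fun x => m x ^ s) := fun s => (hpow s).continuous
  have hRc : Continuous (fun x => c * m x ^ q * N x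
        - q * (q - 1) * (a + c * u x) * m x ^ (q - 2) * ‖gradient m x‖ ^ 2
        - q * c * m x ^ q * ⟪gradient u x, B x⟫_ℝ
        - q * (q - 1) * (a + c * u x) * m x ^ (q - 1) * ⟪gradient m x, B x⟫_ℝ) := by
    have := hpc q; have := hpc (q - 1); have := hpc (q - 2)
    fun_prop
  have hLc : Continuous (fun x => c * ut x * m x ^ q
      + q * (a + c * u x) * m x ^ (q - 1) * mt x) := by
    have := hpc q; have := hpc (q - 1)
    fun_prop
  refine ⟨hRc, ?_⟩
  set φ₁ : Space d → ℝ := fun x => -c * m x ^ q with hφ₁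
  set φ₂ : Space d → ℝ := fun x => (q * (a + c * u x)) * m x ^ (q - 1) with hφ₂
  set W : Space d → Space d :=
    fun x => φ₁ x • gradient u x + φ₂ x • (gradient m x + m x • B x) with hW
  have hud : Differentiable ℝ u := hu.differentiable (by simp)
  have hmd : Differentiable ℝ m := hm.differentiable (by simp)
  have hpd : ∀ s : ℝ, Differentiable ℝ (fun x => m x ^ s) := fun s =>
    (hpow s).differentiable (by simp)
  have hgud : Differentiable ℝ (gradient u) := hgu.differentiable (by simp)
  have hgmd : Differentiable ℝ (gradient m) := hgm.differentiable (by simp)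
  have hφ₁d : Differentiable ℝ φ₁ := (hpd q).const_mul _
  have hlin : Differentiable ℝ (fun x => q * (a + c * u x)) :=
    ((hud.const_mul c).const_add a).const_mul q
  have hφ₂d : Differentiable ℝ φ₂ := hlin.mul (hpd (q - 1))
  have hWd : Differentiable ℝ W := (hφ₁d.smul hgud).add (hφ₂d.smul (hgmd.add hB))
  have hWp : IsPeriodic W := by
    intro k x
    have h1 := hpu k x; have h2 := hpm k x; have h3 := hpB k x
    have h4 := hpu.gradient k x; have h5 := hpm.gradient k x
    simp only [hW, hφ₁, hφ₂]
    rw [h1, h2, h3, h4, h5]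
  have hg₁ : ∀ x, gradient φ₁ x = (-c * (q * m x ^ (q - 1))) • gradient m x := fun x => by
    rw [hφ₁, gradient_const_mul ((hpd q) x), gradient_rpow (hmd x) (hpos x), smul_smul]
  have hg₂ : ∀ x, gradient φ₂ x = (q * (a + c * u x) * ((q - 1) * m x ^ (q - 2))) • gradient m x
      + (m x ^ (q - 1) * (q * c)) • gradient u x := fun x => by
    have e1 : gradient (fun x => q * (a + c * u x)) x = (q * c) • gradient u x := by
      have : (fun x => q * (a + c * u x)) = fun x => q * a + (q * c) * u x := by
        funext x; ring
      rw [this, gradient_add (differentiableAt_const _) ((hud x).const_mul _), gradient_const,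
        zero_add, gradient_const_mul (hud x)]
    rw [hφ₂, gradient_mul (hlin x) ((hpd (q - 1)) x), gradient_rpow (hmd x) (hpos x), e1,
      smul_smul, smul_smul]
    norm_num [sub_sub]
  have hdiv : ∀ x, divergence W x = (c * ut x * m x ^ q + q * (a + c * u x) * m x ^ (q - 1) * mt x)
      - (c * m x ^ q * N x
        - q * (q - 1) * (a + c * u x) * m x ^ (q - 2) * ‖gradient m x‖ ^ 2
        - q * c * m x ^ q * ⟪gradient u x, B x⟫_ℝ
        - q * (q - 1) * (a + c * u x) * m x ^ (q - 1) * ⟪gradient m x, B x⟫_ℝ) := by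
    intro x
    have e1 : divergence W x = divergence (fun y => φ₁ y • gradient u y) x
        + divergence (fun y => φ₂ y • (gradient m y + m y • B y)) x :=
      divergence_add ((hφ₁d.smul hgud) x) ((hφ₂d.smul (hgmd.add hB)) x)
    have e2 := divergence_smul (hφ₁d x) (hgud x)
    have e3 : divergence (fun y => φ₂ y • (gradient m y + m y • B y)) x
        = φ₂ x * divergence (fun y => gradient m y + m y • B y) x
          + ⟪gradient φ₂ x, gradient m x + m x • B x⟫_ℝ :=
      divergence_smul (hφ₂d x) ((hgmd.add hB) x)
    have e4 : divergence (fun y => gradient m y + m y • B y) x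
        = divergence (gradient m) x + divergence (fun y => m y • B y) x :=
      divergence_add (hgmd x) (hB x)
    have h1 : m x ^ (q - 1) = m x ^ (q - 2) * m x := by
      rw [← Real.rpow_add_one (hne x)]; congr 1; ring
    have h2 : m x ^ q = m x ^ (q - 2) * m x * m x := by
      rw [← h1, ← Real.rpow_add_one (hne x)]; congr 1; ring
    rw [e1, e2, e3, e4, ← laplacian_eq_divergence hu, ← laplacian_eq_divergence hm, hg₁, hg₂,
      hFP x, hHJ x]
    simp only [inner_add_left, inner_add_right, inner_smul_left, inner_smul_right,
      real_inner_self_eq_norm_sq, hφ₁, hφ₂, real_inner_comm (gradient u x) (gradient m x)]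
    simp only [conj_trivial]
    rw [h2, h1]
    ring
  have hdc : Continuous (divergence W) := by
    rw [show divergence W = _ from funext hdiv]
    exact hLc.sub hRc
  have hzero := cellIntegral_divergence hWd hWp hdc
  rw [show divergence W = _ from funext hdiv, cellIntegral_sub hLc hRc] at hzero
  linarith

end Slice

section Rate
variable {d : ℕ}

/-- The integrand of the time derivative of `∫ (a + c u) m^q` along a solution, after integration
by parts. -/
noncomputable def energyRate (α : ℝ) (L : Space d → Space d → ℝ) (b : Space d → ℝ → Space d)
    (V : Space d → ℝ → ℝ) (u m : Space d → ℝ → ℝ) (a c q t : ℝ) (x : Space d) : ℝ :=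
  c * m x t ^ q * (m x t ^ α * hamiltonian L x (momentum α u m x t)
      + ⟪b x t, gradient (fun y => u y t) x⟫_ℝ - V x (m x t))
    - q * (q - 1) * (a + c * u x t) * m x t ^ (q - 2) * ‖gradient (fun y => m y t) x‖ ^ 2
    - q * c * m x t ^ q * ⟪gradient (fun y => u y t) x,
        hamiltonianGrad L x (momentum α u m x t) + b x t⟫_ℝ
    - q * (q - 1) * (a + c * u x t) * m x t ^ (q - 1) * ⟪gradient (fun y => m y t) x,
        hamiltonianGrad L x (momentum α u m x t) + b x t⟫_ℝ

variable {α T : ℝ} {L : Space d → Space d → ℝ} {Ψ : Space d → ℝ}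
  {b : Space d → ℝ → Space d} {V : Space d → ℝ → ℝ} {m₀ : Space d → ℝ} {u m : Space d → ℝ → ℝ}

lemma IsSolution.smoothOnStrip_u (h : IsSolution α T L Ψ b V m₀ u m) : SmoothOnStrip u 0 T :=
  h.smooth_u.mono (prod_mono le_rfl Ioo_subset_Icc_self)

lemma IsSolution.smoothOnStrip_m (h : IsSolution α T L Ψ b V m₀ u m) : SmoothOnStrip m 0 T :=
  h.smooth_m.mono (prod_mono le_rfl Ioo_subset_Icc_self)

lemma isPeriodic_hamiltonianGrad (hL : ∀ v, IsPeriodic (fun x => L x v)) (k : Fin d → ℤ)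
    (x p : Space d) :
    hamiltonianGrad L (x + WithLp.toLp 2 (fun i => (k i : ℝ))) p = hamiltonianGrad L x p := by
  have : hamiltonian L (x + WithLp.toLp 2 (fun i => (k i : ℝ))) = hamiltonian L x := by
    funext p
    simp only [hamiltonian]
    congr 1
    funext v
    exact congrArg (fun r => -⟪v, p⟫_ℝ - r) (hL v k x)
  rw [hamiltonianGrad, this, hamiltonianGrad]

lemma IsSolution.contDiffOn_energy (h : IsSolution α T L Ψ b V m₀ u m) (a c q : ℝ) :
    ContDiffOn ℝ ∞ (fun z : Space d × ℝ => (a + c * u z.1 z.2) * m z.1 z.2 ^ q)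
      (univ ×ˢ Icc 0 T) :=
  (contDiffOn_const.add (contDiffOn_const.mul h.smooth_u)).mul
    (h.smooth_m.rpow_const_of_ne fun z hz => (h.pos z.1 z.2 hz.2).ne')

lemma IsSolution.continuousOn_energy (h : IsSolution α T L Ψ b V m₀ u m) (a c q : ℝ) :
    ContinuousOn (fun s => cellIntegral (fun x => (a + c * u x s) * m x s ^ q)) (Icc 0 T) :=
  continuousOn_cellIntegral (h.contDiffOn_energy a c q).continuousOn

lemma IsSolution.hasDerivAt_energy (h : IsSolution α T L Ψ b V m₀ u m)
    (hL : ∀ v, IsPeriodic (fun x => L x v))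
    (hbp : ∀ t ∈ Icc 0 T, IsPeriodic (fun x => b x t))
    (hbs : SmoothBounded (fun z : Space d × ℝ => b z.1 z.2) (univ ×ˢ Icc 0 T))
    {t : ℝ} (ht : t ∈ Ioo 0 T) (a c q : ℝ) :
    Continuous (energyRate α L b V u m a c q t) ∧
    HasDerivAt (fun s => cellIntegral (fun x => (a + c * u x s) * m x s ^ q))
      (cellIntegral (energyRate α L b V u m a c q t)) t := by
  have htc : t ∈ Icc 0 T := Ioo_subset_Icc_self ht
  have hstrip : SmoothOnStrip (fun x s => (a + c * u x s) * m x s ^ q) 0 T :=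
    (h.contDiffOn_energy a c q).mono (prod_mono le_rfl Ioo_subset_Icc_self)
  have hu := h.smoothOnStrip_u
  have hm := h.smoothOnStrip_m
  have hderiv : ∀ x, deriv (fun s => (a + c * u x s) * m x s ^ q) t
      = c * deriv (fun s => u x s) t * m x t ^ q
        + q * (a + c * u x t) * m x t ^ (q - 1) * deriv (fun s => m x s) t := fun x => by
    have h1 : HasDerivAt (fun s => u x s) _ t := (hu.differentiableAt ht).hasDerivAt
    have h2 : HasDerivAt (fun s => m x s) _ t := (hm.differentiableAt ht).hasDerivAt
    have h3 := ((h1.const_mul c).const_add a).mul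
      (h2.rpow_const (p := q) (Or.inl (h.pos x t htc).ne'))
    refine (HasDerivAt.deriv h3).trans ?_
    ring
  have hus := contDiff_slice h.smooth_u htc
  have hms := contDiff_slice h.smooth_m htc
  have hbd : Differentiable ℝ (fun y => b y t) :=
    (contDiff_slice hbs.1 htc).differentiable (by simp)
  have hmb : Differentiable ℝ (fun y => m y t • b y t) :=
    (hms.differentiable (by simp)).smul hbd
  have hsplit : (fun y => m y t • (hamiltonianGrad L y (momentum α u m y t) + b y t))
      = fun y => m y t • hamiltonianGrad L y (momentum α u m y t) + m y t • b y t := by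
    funext y; rw [smul_add]
  have key := cellIntegral_rate_eq (u := fun y => u y t) (m := fun y => m y t)
    (ut := fun x => deriv (fun s => u x s) t) (mt := fun x => deriv (fun s => m x s) t)
    (N := fun x => m x t ^ α * hamiltonian L x (momentum α u m x t)
      + ⟪b x t, gradient (fun y => u y t) x⟫_ℝ - V x (m x t))
    (B := fun y => hamiltonianGrad L y (momentum α u m y t) + b y t)
    hus hms (h.periodic_u t htc) (h.periodic_m t htc)
    (fun x => h.pos x t htc) (by rw [hsplit]; exact (h.flux t ht).add hmb)
    (fun k x => by
      have e1 := hbp t htc k x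
      have e2 := h.periodic_m t htc k x
      have e3 := (h.periodic_u t htc).gradient k x
      simp only [momentum] at *
      rw [e1, e2, e3, isPeriodic_hamiltonianGrad hL])
    (hu.continuous_deriv_slice ht) (hm.continuous_deriv_slice ht)
    (fun x => by have := h.hamilton_jacobi x t ht; linarith)
    (fun x => by
      have := h.fokker_planck x t ht
      rw [hsplit, divergence_add ((h.flux t ht) x) (hmb x)]
      linarith) a c q
  refine ⟨key.1, ?_⟩
  have hfin := hstrip.hasDerivAt_cellIntegral ht
  simp only [hderiv] at hfin
  rw [key.2] at hfin
  exact hfin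

end Rate

/-! ### Sobolev inequalities on the torus -/

/-- Young's inequality in the form needed to absorb sublinear terms. -/
lemma exists_rpow_mul_le {τ : ℝ} (h0 : 0 < τ) (h1 : τ < 1) {ε : ℝ} (hε : 0 < ε) :
    ∃ C : ℝ, 0 < C ∧ ∀ S Z : ℝ, 0 ≤ S → 0 ≤ Z → S ^ τ * Z ≤ ε * S + C * Z ^ (1 / (1 - τ)) := by
  have h1' : 0 < 1 - τ := by linarith
  refine ⟨(1 / ε) ^ (τ / (1 - τ)), by positivity, fun S Z hS hZ => ?_⟩
  rcases le_or_gt Z (ε * S ^ (1 - τ)) with h | h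
  · have : S ^ τ * Z ≤ ε * S := by
      calc S ^ τ * Z ≤ S ^ τ * (ε * S ^ (1 - τ)) := by gcongr
        _ = ε * (S ^ τ * S ^ (1 - τ)) := by ring
        _ = ε * S := by
          rw [← Real.rpow_add_of_nonneg hS h0.le h1'.le]; simp
    have h2 : 0 ≤ (1 / ε) ^ (τ / (1 - τ)) * Z ^ (1 / (1 - τ)) := by positivity
    linarith
  · have hS1 : S ^ (1 - τ) ≤ 1 / ε * Z := by
      rw [one_div, le_inv_mul_iff₀ hε]; exact h.le
    have hS2 : S ^ τ ≤ (1 / ε * Z) ^ (τ / (1 - τ)) := by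
      have := Real.rpow_le_rpow (by positivity) hS1 (z := τ / (1 - τ)) (by positivity)
      rwa [← Real.rpow_mul hS, mul_div_cancel₀ _ h1'.ne'] at this
    have h3 : (1 / ε * Z) ^ (τ / (1 - τ)) * Z = (1 / ε) ^ (τ / (1 - τ)) * Z ^ (1 / (1 - τ)) := by
      rw [Real.mul_rpow (by positivity) hZ, mul_assoc]
      congr 1
      nth_rewrite 2 [← Real.rpow_one Z]
      rw [← Real.rpow_add_of_nonneg hZ (by positivity) zero_le_one]
      congr 1
      field_simp
      ring
    have h4 : S ^ τ * Z ≤ (1 / ε * Z) ^ (τ / (1 - τ)) * Z := by gcongr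
    have : 0 ≤ ε * S := by positivity
    linarith

lemma norm_gradient {d : ℕ} (f : Space d → ℝ) (x : Space d) :
    ‖gradient f x‖ = ‖fderiv ℝ f x‖ := by
  simp [gradient]

lemma norm_le_nat_of_mem_cell {d : ℕ} {w : Space d} (hw : w ∈ cell d) : ‖w‖ ≤ d := by
  have h := norm_le_of_mem_cell hw
  rcases d with _ | n
  · have : ‖w‖ ^ 2 ≤ 0 := by simpa using h
    have := norm_nonneg w
    simp only [Nat.cast_zero]
    nlinarith
  · have h1 : (1 : ℝ) ≤ ((n + 1 : ℕ) : ℝ) := by push_cast; linarith [n.cast_nonneg (α := ℝ)]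
    nlinarith [norm_nonneg w]

/-- A ball meets finitely many cells, so integrals of periodic functions over it are controlled by
the integral over one cell. -/
lemma lintegral_closedBall_le {d : ℕ} (R : ℝ) {g : Space d → ENNReal} (hg : Measurable g)
    (hper : IsPeriodic g) :
    ∫⁻ y in Metric.closedBall 0 R, g y
      ≤ volume (Metric.closedBall (0 : Space d) (R + d)) * ∫⁻ y in cell d, g y := by
  have h := lintegral_mul_le_of_le_average
    (k := (Metric.closedBall (0 : Space d) R).indicator 1)
    (Q := (Metric.closedBall (0 : Space d) (R + d)).indicator 1)
    (measurable_one.indicator measurableSet_closedBall) hg hper ?_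
  · rw [lintegral_indicator_one measurableSet_closedBall] at h
    refine le_trans (le_of_eq ?_) h
    rw [← lintegral_indicator measurableSet_closedBall]
    refine lintegral_congr fun y => ?_
    by_cases hy : y ∈ Metric.closedBall (0 : Space d) R <;> simp [hy, indicator]
  · intro y
    by_cases hy : y ∈ Metric.closedBall (0 : Space d) R
    · rw [indicator_of_mem hy]
      have : ∫⁻ w in cell d,
          (Metric.closedBall (0 : Space d) (R + d)).indicator (1 : Space d → ENNReal) (y - w)
          = ∫⁻ w in cell d, 1 := by
        refine setLIntegral_congr_fun (measurableSet_cell d) fun w hw => ?_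
        have h1 := norm_le_nat_of_mem_cell hw
        rw [mem_closedBall_zero_iff] at hy
        have h2 := norm_sub_le y w
        rw [indicator_of_mem]
        · rfl
        · rw [mem_closedBall_zero_iff]; linarith
      rw [this]
      simp
    · rw [indicator_of_notMem hy]; simp

/-- A Sobolev inequality `W^{1,1} ⊂ L^p` on the torus with the non-optimal exponent
`p = (d+2)/(d+1)`, deduced from the Gagliardo-Nirenberg-Sobolev inequality in dimension `d + 2` for
a compactly supported function which does not depend on two extra variables near the cell. The two
extra dimensions make the inequality available for all `d` and keep `p < 2` when `d ≥ 1`. -/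
lemma exists_sobolev_one (d : ℕ) :
    ∃ C : ℝ, 0 < C ∧ ∀ v : Space d → ℝ, ContDiff ℝ 1 v → IsPeriodic v → (∀ x, 0 ≤ v x) →
      cellIntegral (fun x => v x ^ (1 + 1 / ((d : ℝ) + 1)))
        ≤ C * cellIntegral (fun x => ‖gradient v x‖ + v x) ^ (1 + 1 / ((d : ℝ) + 1)) := by
  have : (volume : Measure (ℝ × ℝ)).IsAddHaarMeasure :=
    inferInstanceAs ((volume : Measure ℝ).prod (volume : Measure ℝ)).IsAddHaarMeasure
  have : (volume : Measure (Space d × ℝ × ℝ)).IsAddHaarMeasure :=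
    inferInstanceAs ((volume : Measure (Space d)).prod (volume : Measure (ℝ × ℝ))).IsAddHaarMeasure
  set p : ℝ := 1 + 1 / ((d : ℝ) + 1) with hp
  have hd0 : (0 : ℝ) ≤ d := d.cast_nonneg
  have hp0 : 0 < p := by positivity
  let χ : ContDiffBump (0 : Space d × ℝ × ℝ) := ⟨d + 1, d + 2, by positivity, by linarith⟩
  have hχd : Continuous (fderiv ℝ χ) := (χ.contDiff (n := 1)).continuous_fderiv one_ne_zero
  obtain ⟨B, hB⟩ := (χ.hasCompactSupport.fderiv ℝ).exists_bound_of_continuous hχd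
  have hB0 : 0 ≤ B := (norm_nonneg _).trans (hB 0)
  set C₁ := lintegralPowLePowLIntegralFDerivConst (volume : Measure (Space d × ℝ × ℝ)) p
  set Vb := (volume (Metric.closedBall (0 : Space d) ((d : ℝ) + 2 + d))).toReal
  set Vr := (volume (Metric.closedBall (0 : ℝ × ℝ) ((d : ℝ) + 2))).toReal
  refine ⟨(C₁ + 1) * ((1 + B) * Vr * Vb) ^ p + 1, by positivity, fun v hv hper hv0 => ?_⟩
  set f : Space d × ℝ × ℝ → ℝ := fun z => χ z * v z.1 with hf
  have hfc : ContDiff ℝ 1 f := χ.contDiff.mul (hv.comp contDiff_fst)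
  have hfs : HasCompactSupport f := χ.hasCompactSupport.mul_right
  have hconj : ((Module.finrank ℝ (Space d × ℝ × ℝ) : ℕ) : ℝ).HolderConjugate p := by
    have : Module.finrank ℝ (Space d × ℝ × ℝ) = d + 2 := by simp
    rw [this, Real.holderConjugate_iff]
    push_cast
    refine ⟨by linarith, ?_⟩
    rw [hp]
    field_simp
    ring
  have key := lintegral_pow_le_pow_lintegral_fderiv (volume : Measure (Space d × ℝ × ℝ)) hfc hfs
    hconj
  have hvc : Continuous v := hv.continuous
  have hgc : Continuous (fun x => ‖gradient v x‖ + v x) := (continuous_gradient hv).norm.add hvc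
  have hg0 : ∀ x, 0 ≤ ‖gradient v x‖ + v x := fun x => add_nonneg (norm_nonneg _) (hv0 x)
  have hpc : Continuous (fun x => v x ^ p) := hvc.rpow_const fun _ => Or.inr hp0.le
  -- the left-hand side, restricted to the product of the cell with a unit square
  have hleft : ENNReal.ofReal (cellIntegral (fun x => v x ^ p)) ≤ ∫⁻ z, ‖f z‖ₑ ^ p := by
    rw [ofReal_cellIntegral hpc fun x => Real.rpow_nonneg (hv0 x) _]
    calc ∫⁻ x in cell d, ENNReal.ofReal (v x ^ p)
        = ∫⁻ z in cell d ×ˢ (Icc (0 : ℝ) 1 ×ˢ Icc (0 : ℝ) 1), ENNReal.ofReal (v z.1 ^ p) := by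
          have hm : Measurable fun x => ENNReal.ofReal (v x ^ p) := by fun_prop
          rw [Measure.volume_eq_prod, ← Measure.prod_restrict,
            lintegral_prod _ (by fun_prop)]
          refine lintegral_congr fun x => ?_
          simp only [lintegral_const, Measure.restrict_apply_univ, Measure.volume_eq_prod,
            Measure.prod_prod]
          simp
      _ ≤ ∫⁻ z in cell d ×ˢ (Icc (0 : ℝ) 1 ×ˢ Icc (0 : ℝ) 1), ‖f z‖ₑ ^ p := by
          refine setLIntegral_mono' ((measurableSet_cell d).prod
            (measurableSet_Icc.prod measurableSet_Icc)) fun z hz => ?_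
          have h1 : χ z = 1 := by
            refine χ.one_of_mem_closedBall ?_
            rw [mem_closedBall_zero_iff]
            change ‖z‖ ≤ (d : ℝ) + 1
            have h2 := norm_le_nat_of_mem_cell hz.1
            have h3 := hz.2.1
            have h4 := hz.2.2
            rw [mem_Icc] at h3 h4
            refine norm_prod_le_iff.2 ⟨by linarith, norm_prod_le_iff.2 ⟨?_, ?_⟩⟩
            · rw [Real.norm_eq_abs, abs_of_nonneg h3.1]; linarith
            · rw [Real.norm_eq_abs, abs_of_nonneg h4.1]; linarith
          rw [hf]
          simp only [h1, one_mul]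
          rw [Real.enorm_of_nonneg (hv0 _), ENNReal.ofReal_rpow_of_nonneg (hv0 _) hp0.le]
      _ ≤ ∫⁻ z, ‖f z‖ₑ ^ p := setLIntegral_le_lintegral _ _
  -- the right-hand side: the derivative lives on a product of balls
  have hright : ∫⁻ z, ‖fderiv ℝ f z‖ₑ
      ≤ ENNReal.ofReal ((1 + B) * Vr * Vb * cellIntegral (fun x => ‖gradient v x‖ + v x)) := by
    have hb : ∀ z, ‖fderiv ℝ f z‖ₑ ≤ (Metric.closedBall (0 : Space d) ((d : ℝ) + 2) ×ˢ
        Metric.closedBall (0 : ℝ × ℝ) ((d : ℝ) + 2)).indicator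
        (fun z => ENNReal.ofReal ((1 + B) * (‖gradient v z.1‖ + v z.1))) z := by
      intro z
      by_cases hz : z ∈ Metric.closedBall (0 : Space d) ((d : ℝ) + 2) ×ˢ
        Metric.closedBall (0 : ℝ × ℝ) ((d : ℝ) + 2)
      · rw [indicator_of_mem hz, ← ofReal_norm]
        refine ENNReal.ofReal_le_ofReal ?_
        have hvz : HasFDerivAt (fun z : Space d × ℝ × ℝ => v z.1)
            ((fderiv ℝ v z.1).comp (ContinuousLinearMap.fst ℝ (Space d) (ℝ × ℝ))) z :=
          ((hv.differentiable one_ne_zero) z.1).hasFDerivAt.comp z hasFDerivAt_fst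
        have hχz : HasFDerivAt χ (fderiv ℝ χ z) z :=
          (((χ.contDiff (n := 1)).differentiable one_ne_zero) z).hasFDerivAt
        have hfz : HasFDerivAt f _ z := hχz.mul hvz
        rw [hfz.fderiv, norm_gradient]
        have h1 : ‖(fderiv ℝ v z.1).comp (ContinuousLinearMap.fst ℝ (Space d) (ℝ × ℝ))‖
            ≤ ‖fderiv ℝ v z.1‖ := by
          refine (ContinuousLinearMap.opNorm_comp_le _ _).trans ?_
          exact mul_le_of_le_one_right (norm_nonneg _) (ContinuousLinearMap.norm_fst_le _ _ _)
        refine (norm_add_le _ _).trans ?_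
        rw [norm_smul, norm_smul, Real.norm_of_nonneg (hv0 _), Real.norm_of_nonneg (χ.nonneg)]
        have h2 : χ z ≤ 1 := χ.le_one
        have h3 : 0 ≤ χ z := χ.nonneg
        have h4 := hB z
        have h5 := hv0 z.1
        have h6 := norm_nonneg (fderiv ℝ v z.1)
        calc χ z * ‖(fderiv ℝ v z.1).comp (ContinuousLinearMap.fst ℝ (Space d) (ℝ × ℝ))‖
              + v z.1 * ‖fderiv ℝ χ z‖
            ≤ 1 * ‖fderiv ℝ v z.1‖ + v z.1 * B := by gcongr
          _ ≤ (1 + B) * (‖fderiv ℝ v z.1‖ + v z.1) := by nlinarith [mul_nonneg hB0 h6]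
      · rw [indicator_of_notMem hz]
        have hz' : z ∉ tsupport f := by
          intro hzs
          have h1 : z ∈ tsupport χ := tsupport_mul_subset_left hzs
          rw [χ.tsupport_eq, mem_closedBall_zero_iff] at h1
          change ‖z‖ ≤ (d : ℝ) + 2 at h1
          rw [norm_prod_le_iff] at h1
          exact hz ⟨mem_closedBall_zero_iff.2 h1.1, mem_closedBall_zero_iff.2 h1.2⟩
        have : fderiv ℝ f z = 0 := by
          by_contra hne
          exact hz' (support_fderiv_subset ℝ (Function.mem_support.2 hne))
        have h0 : ‖fderiv ℝ f z‖ = 0 := by rw [this]; exact norm_zero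
        rw [← ofReal_norm, h0, ENNReal.ofReal_zero]
    have hm : Measurable fun x => ENNReal.ofReal ((1 + B) * (‖gradient v x‖ + v x)) := by
      exact (ENNReal.continuous_ofReal.comp (continuous_const.mul hgc)).measurable
    have hfin1 : volume (Metric.closedBall (0 : Space d) ((d : ℝ) + 2 + d)) ≠ ⊤ :=
      measure_closedBall_lt_top.ne
    have hfin2 : volume (Metric.closedBall (0 : ℝ × ℝ) ((d : ℝ) + 2)) ≠ ⊤ :=
      measure_closedBall_lt_top.ne
    calc ∫⁻ z, ‖fderiv ℝ f z‖ₑ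
        ≤ ∫⁻ z in Metric.closedBall (0 : Space d) ((d : ℝ) + 2) ×ˢ
          Metric.closedBall (0 : ℝ × ℝ) ((d : ℝ) + 2),
            ENNReal.ofReal ((1 + B) * (‖gradient v z.1‖ + v z.1)) := by
          rw [← lintegral_indicator (measurableSet_closedBall.prod measurableSet_closedBall)]
          exact lintegral_mono hb
      _ = ENNReal.ofReal Vr * ∫⁻ x in Metric.closedBall (0 : Space d) ((d : ℝ) + 2),
            ENNReal.ofReal ((1 + B) * (‖gradient v x‖ + v x)) := by
          rw [Measure.volume_eq_prod, ← Measure.prod_restrict]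
          refine (lintegral_prod _ (hm.comp measurable_fst).aemeasurable).trans ?_
          simp only [Function.comp_apply]
          simp only [lintegral_const, Measure.restrict_apply_univ]
          rw [lintegral_mul_const _ hm, mul_comm, ENNReal.ofReal_toReal hfin2]
      _ ≤ ENNReal.ofReal Vr * (ENNReal.ofReal Vb * ∫⁻ x in cell d,
            ENNReal.ofReal ((1 + B) * (‖gradient v x‖ + v x))) := by
          gcongr
          rw [ENNReal.ofReal_toReal hfin1]
          refine lintegral_closedBall_le _ hm fun k x => ?_
          have e1 := hper k x
          have e2 := hper.gradient k x
          simp only [e1, e2]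
      _ = _ := by
          rw [← ofReal_cellIntegral (by fun_prop) (fun x => mul_nonneg (by linarith) (hg0 x)),
            ← ENNReal.ofReal_mul (by positivity), ← ENNReal.ofReal_mul (by positivity),
            cellIntegral_const_mul]
          congr 1
          ring
  set I := cellIntegral (fun x => ‖gradient v x‖ + v x) with hI
  have hI0 : 0 ≤ I := cellIntegral_nonneg hg0
  have h1 : ENNReal.ofReal (cellIntegral (fun x => v x ^ p))
      ≤ ENNReal.ofReal (C₁ * ((1 + B) * Vr * Vb * I) ^ p) := by
    refine hleft.trans (key.trans ?_)
    rw [ENNReal.ofReal_mul (by positivity), ENNReal.ofReal_coe_nnreal,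
      ← ENNReal.ofReal_rpow_of_nonneg (by positivity) hp0.le]
    gcongr
  have h2 := (ENNReal.ofReal_le_ofReal_iff (by positivity)).1 h1
  refine h2.trans ?_
  rw [Real.mul_rpow (by positivity) hI0]
  have h3 : 0 ≤ ((1 + B) * Vr * Vb) ^ p := by positivity
  have h4 : 0 ≤ I ^ p := by positivity
  nlinarith [mul_nonneg h3 h4]

/-- The Sobolev inequality applied to `w ^ 2`. -/
lemma exists_sobolev_sq (d : ℕ) :
    ∃ C : ℝ, 0 < C ∧ ∀ w : Space d → ℝ, ContDiff ℝ 1 w → IsPeriodic w →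
      cellIntegral (fun x => (w x ^ 2) ^ (1 + 1 / ((d : ℝ) + 1)))
        ≤ C * ((1 + cellIntegral (fun x => w x ^ 2))
          * (1 + cellIntegral (fun x => w x ^ 2) + cellIntegral (fun x => ‖gradient w x‖ ^ 2)))
            ^ ((1 + 1 / ((d : ℝ) + 1)) / 2) := by
  obtain ⟨C, hC, h⟩ := exists_sobolev_one d
  set p : ℝ := 1 + 1 / ((d : ℝ) + 1) with hp
  have hp0 : 0 < p := by positivity
  refine ⟨C * 3 ^ p, by positivity, fun w hw hper => ?_⟩
  have hwc := hw.continuous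
  have hgc := continuous_gradient hw
  have hwd : Differentiable ℝ w := hw.differentiable one_ne_zero
  refine (h (fun x => w x ^ 2) (hw.pow 2) (fun k x => by have := hper k x; simp only [this])
    (fun x => sq_nonneg _)).trans ?_
  set X := cellIntegral (fun x => w x ^ 2) with hX
  set G := cellIntegral (fun x => ‖gradient w x‖ ^ 2) with hG
  have hX0 : 0 ≤ X := cellIntegral_nonneg fun x => sq_nonneg _
  have hG0 : 0 ≤ G := cellIntegral_nonneg fun x => sq_nonneg _
  set y := √(1 + X) with hy
  set s := √(1 + X + G) with hs
  have hy0 : 0 < y := Real.sqrt_pos.2 (by linarith)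
  have hs0 : 0 < s := Real.sqrt_pos.2 (by linarith)
  have hy2 : y ^ 2 = 1 + X := Real.sq_sqrt (by linarith)
  have hs2 : s ^ 2 = 1 + X + G := Real.sq_sqrt (by linarith)
  have hys : y ≤ s := Real.sqrt_le_sqrt (by linarith)
  have hgrad : ∀ x, ‖gradient (fun x => w x ^ 2) x‖ = 2 * |w x| * ‖gradient w x‖ := fun x => by
    have : (fun x => w x ^ 2) = fun x => w x * w x := by funext x; ring
    rw [this, gradient_mul (hwd x) (hwd x), ← add_smul, norm_smul, Real.norm_eq_abs, ← two_mul,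
      abs_mul, abs_two]
  have hpt : ∀ x, ‖gradient (fun x => w x ^ 2) x‖ + w x ^ 2
      ≤ (y / s) * ‖gradient w x‖ ^ 2 + (s / y + 1) * w x ^ 2 := fun x => by
    rw [hgrad x]
    have h1 : 0 ≤ (y * ‖gradient w x‖ - s * |w x|) ^ 2 := sq_nonneg _
    have h2 : (y / s) * ‖gradient w x‖ ^ 2 + (s / y) * |w x| ^ 2 - 2 * |w x| * ‖gradient w x‖
        = (y * ‖gradient w x‖ - s * |w x|) ^ 2 / (y * s) := by
      field_simp
      ring
    have h3 : 0 ≤ (y * ‖gradient w x‖ - s * |w x|) ^ 2 / (y * s) := by positivity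
    rw [← h2, sq_abs] at h3
    linarith
  have hP : cellIntegral (fun x => ‖gradient (fun x => w x ^ 2) x‖ + w x ^ 2) ≤ 3 * (y * s) := by
    have hc1 : Continuous (fun x => ‖gradient (fun x => w x ^ 2) x‖ + w x ^ 2) :=
      (continuous_gradient (hw.pow 2)).norm.add (hwc.pow 2)
    calc _ ≤ cellIntegral (fun x => (y / s) * ‖gradient w x‖ ^ 2 + (s / y + 1) * w x ^ 2) :=
          cellIntegral_mono hc1 (by fun_prop) hpt
      _ = (y / s) * G + (s / y + 1) * X := by
          rw [cellIntegral_add (by fun_prop) (by fun_prop), cellIntegral_const_mul,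
            cellIntegral_const_mul]
      _ ≤ (y / s) * s ^ 2 + (s / y + 1) * y ^ 2 := by
          gcongr <;> linarith
      _ = 2 * (y * s) + y * y := by field_simp; ring
      _ ≤ 3 * (y * s) := by nlinarith
  have hP0 : 0 ≤ cellIntegral (fun x => ‖gradient (fun x => w x ^ 2) x‖ + w x ^ 2) :=
    cellIntegral_nonneg fun x => by positivity
  have hfin : ((1 + X) * (1 + X + G)) ^ (p / 2) = (y * s) ^ p := by
    rw [← hs2, ← hy2, ← mul_pow, ← Real.rpow_natCast, ← Real.rpow_mul (by positivity)]
    congr 1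
    push_cast
    ring
  rw [hfin, mul_assoc, ← Real.mul_rpow (by norm_num) (by positivity)]
  gcongr

lemma gradient_rpow_norm_sq {d : ℕ} {m : Space d → ℝ} (hm : ContDiff ℝ ∞ m) (hpos : ∀ x, 0 < m x)
    (s : ℝ) (x : Space d) :
    ‖gradient (fun y => m y ^ s) x‖ ^ 2 = s ^ 2 * (m x ^ (2 * s - 2) * ‖gradient m x‖ ^ 2) := by
  rw [gradient_rpow ((hm.differentiable (by simp)) x) (hpos x), norm_smul, mul_pow,
    Real.norm_eq_abs, sq_abs, mul_pow, ← Real.rpow_natCast (m x ^ (s - 1)),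
    ← Real.rpow_mul (hpos x).le, mul_assoc]
  congr 3
  push_cast
  ring

/-- A slightly superlinear power of `m ^ (-r)` is controlled by an arbitrarily small multiple of
the dissipation and a power of `∫ m ^ (-r)`. -/
lemma exists_negative_power_interpolation {d : ℕ} (hd : 1 ≤ d) :
    ∃ N : ℝ, 1 ≤ N ∧ ∀ r ε : ℝ, 0 < r → 0 < ε → ∃ C : ℝ, 0 < C ∧
      ∀ m : Space d → ℝ, ContDiff ℝ ∞ m → IsPeriodic m → (∀ x, 0 < m x) →
      cellIntegral (fun x => m x ^ (-r * (1 + 1 / ((d : ℝ) + 1))))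
        ≤ ε * cellIntegral (fun x => m x ^ (-r - 2) * ‖gradient m x‖ ^ 2)
          + C * (1 + cellIntegral (fun x => m x ^ (-r))) ^ N := by
  obtain ⟨C, hC, h⟩ := exists_sobolev_sq d
  set p : ℝ := 1 + 1 / ((d : ℝ) + 1) with hp
  have hp1 : 1 < p := by
    have : 0 < 1 / ((d : ℝ) + 1) := by positivity
    linarith
  have hp2 : p < 2 := by
    have : 1 / ((d : ℝ) + 1) < 1 := by
      rw [div_lt_one (by positivity)]
      have : (0 : ℝ) < d := by exact_mod_cast hd
      linarith
    linarith
  set τ := p / 2 with hτ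
  have hτ0 : 0 < τ := by positivity
  have hτ1 : τ < 1 := by rw [hτ]; linarith
  refine ⟨τ * (1 / (1 - τ)), ?_, fun r ε hr hε => ?_⟩
  · rw [mul_one_div, le_div_iff₀ (by linarith)]; rw [hτ]; linarith
  set ε' := ε / (r / 2) ^ 2 with hε'
  have hε'0 : 0 < ε' := by positivity
  obtain ⟨C₂, hC₂, hY⟩ := exists_rpow_mul_le hτ0 hτ1 hε'0
  refine ⟨ε' + C₂ * C ^ (1 / (1 - τ)), by positivity, fun m hm hper hpos => ?_⟩
  have hw : ContDiff ℝ 1 (fun x => m x ^ (-r / 2)) :=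
    (hm.rpow_const_of_ne fun x => (hpos x).ne').of_le (by simp)
  have hwp : IsPeriodic (fun x => m x ^ (-r / 2)) := fun k x => by
    have := hper k x; simp only [this]
  have key := h _ hw hwp
  have e1 : ∀ x, (m x ^ (-r / 2)) ^ 2 = m x ^ (-r) := fun x => by
    rw [← Real.rpow_natCast, ← Real.rpow_mul (hpos x).le]; congr 1; push_cast; ring
  have e2 : ∀ x, (m x ^ (-r)) ^ p = m x ^ (-r * p) := fun x => by
    rw [← Real.rpow_mul (hpos x).le]
  have e3 : ∀ x, ‖gradient (fun x => m x ^ (-r / 2)) x‖ ^ 2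
      = (r / 2) ^ 2 * (m x ^ (-r - 2) * ‖gradient m x‖ ^ 2) := fun x => by
    rw [gradient_rpow_norm_sq hm hpos]
    congr 1
    · ring
    · congr 2; ring
  simp only [e1, e2, e3, cellIntegral_const_mul] at key
  set X := cellIntegral (fun x => m x ^ (-r)) with hX
  set G := cellIntegral (fun x => m x ^ (-r - 2) * ‖gradient m x‖ ^ 2) with hG
  have hX0 : 0 ≤ X := cellIntegral_nonneg fun x => (Real.rpow_pos_of_pos (hpos x) _).le
  have hG0 : 0 ≤ G := cellIntegral_nonneg fun x => by
    have := Real.rpow_pos_of_pos (hpos x) (-r - 2); positivity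
  refine key.trans ?_
  have hS : 0 ≤ 1 + X + (r / 2) ^ 2 * G := by positivity
  have h1 := hY (1 + X + (r / 2) ^ 2 * G) (C * (1 + X) ^ τ) hS (by positivity)
  rw [Real.mul_rpow hC.le (by positivity), ← Real.rpow_mul (by positivity)] at h1
  rw [Real.mul_rpow (by positivity) hS]
  have h2 : ε' * (1 + X + (r / 2) ^ 2 * G) = ε' * (1 + X) + ε * G := by
    rw [hε']; field_simp
  have h3 : 1 + X ≤ (1 + X) ^ (τ * (1 / (1 - τ))) := by
    refine Real.self_le_rpow_of_one_le (by linarith) ?_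
    rw [mul_one_div, le_div_iff₀ (by linarith)]; rw [hτ]; linarith
  nlinarith [mul_le_mul_of_nonneg_left h3 hε'0.le]

/-- Interpolation between the mass and the dissipation of `∫ m ^ (1 + α)`. -/
lemma exists_mass_interpolation (d : ℕ) {α ε : ℝ} (hα : 0 < α) (hε : 0 < ε) :
    ∃ C : ℝ, 0 < C ∧ ∀ m : Space d → ℝ, ContDiff ℝ ∞ m → IsPeriodic m → (∀ x, 0 < m x) →
      cellIntegral m = 1 →
      cellIntegral (fun x => m x ^ (1 + α))
        ≤ ε * cellIntegral (fun x => m x ^ (α - 1) * ‖gradient m x‖ ^ 2) + C := by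
  obtain ⟨C, hC, h⟩ := exists_sobolev_sq d
  set p : ℝ := 1 + 1 / ((d : ℝ) + 1) with hp
  have hp1 : 0 < p - 1 := by
    have : 0 < 1 / ((d : ℝ) + 1) := by positivity
    linarith
  set η : ℝ := min (1 / 4) (ε / (4 * ((1 + α) / 2) ^ 2)) with hη
  have hη0 : 0 < η := by positivity
  have hη1 : η ≤ 1 / 4 := min_le_left _ _
  have hη2 : 4 * η * ((1 + α) / 2) ^ 2 ≤ ε := by
    have : η ≤ ε / (4 * ((1 + α) / 2) ^ 2) := min_le_right _ _
    rw [le_div_iff₀ (by positivity)] at this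
    linarith
  set s := (1 + α) * (p - 1) with hs
  have hs0 : 0 < s := by positivity
  have hθ0 : 0 < α / (1 + α) := by positivity
  have hθ1 : α / (1 + α) < 1 := by rw [div_lt_one (by positivity)]; linarith
  obtain ⟨C₂, hC₂, hY⟩ := exists_rpow_mul_le hθ0 hθ1 hη0
  set Z := (C / η) ^ (α / s) with hZ
  have hZ0 : 0 < Z := by positivity
  refine ⟨2 * (2 * η + C₂ * Z ^ (1 / (1 - α / (1 + α)))), by positivity,
    fun m hm hper hpos hmass => ?_⟩
  have hw : ContDiff ℝ 1 (fun x => m x ^ ((1 + α) / 2)) :=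
    (hm.rpow_const_of_ne fun x => (hpos x).ne').of_le (by simp)
  have hwp : IsPeriodic (fun x => m x ^ ((1 + α) / 2)) := fun k x => by
    have := hper k x; simp only [this]
  have key := h _ hw hwp
  have e1 : ∀ x, (m x ^ ((1 + α) / 2)) ^ 2 = m x ^ (1 + α) := fun x => by
    rw [← Real.rpow_natCast, ← Real.rpow_mul (hpos x).le]; congr 1; push_cast; ring
  have e3 : ∀ x, ‖gradient (fun x => m x ^ ((1 + α) / 2)) x‖ ^ 2
      = ((1 + α) / 2) ^ 2 * (m x ^ (α - 1) * ‖gradient m x‖ ^ 2) := fun x => by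
    rw [gradient_rpow_norm_sq hm hpos]
    congr 3; ring
  simp only [e1, e3, cellIntegral_const_mul] at key
  set X := cellIntegral (fun x => m x ^ (1 + α)) with hX
  set G := cellIntegral (fun x => m x ^ (α - 1) * ‖gradient m x‖ ^ 2) with hG
  have hX0 : 0 ≤ X := cellIntegral_nonneg fun x => (Real.rpow_pos_of_pos (hpos x) _).le
  have hG0 : 0 ≤ G := cellIntegral_nonneg fun x => by
    have := Real.rpow_pos_of_pos (hpos x) (α - 1); positivity
  set S := 1 + X + ((1 + α) / 2) ^ 2 * G with hS
  have hG1 : 0 ≤ ((1 + α) / 2) ^ 2 * G := by positivity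
  have hS1 : 1 ≤ S := by linarith
  have hS0 : 0 < S := by linarith
  have hkey : cellIntegral (fun x => (m x ^ (1 + α)) ^ p) ≤ C * S ^ p := by
    refine key.trans ?_
    gcongr
    calc ((1 + X) * S) ^ (p / 2) ≤ (S * S) ^ (p / 2) := by
          gcongr; linarith
      _ = S ^ p := by
          rw [Real.mul_rpow hS0.le hS0.le, ← Real.rpow_add hS0]; congr 1; ring
  -- the level at which `m ^ (1 + α)` is split
  set A := (C / η * S ^ (p - 1)) ^ (1 / s) with hA
  have hA0 : 0 < A := by positivity
  have hAs : A ^ s = C / η * S ^ (p - 1) := by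
    rw [hA, ← Real.rpow_mul (by positivity), one_div_mul_cancel hs0.ne', Real.rpow_one]
  have hAα : A ^ α = S ^ (α / (1 + α)) * Z := by
    rw [hA, ← Real.rpow_mul (by positivity), Real.mul_rpow (by positivity) (by positivity),
      ← Real.rpow_mul hS0.le, mul_comm, hZ]
    congr 2
    · rw [hs]; field_simp
    · ring
  have hpt : ∀ x, m x ^ (1 + α) ≤ A ^ α * m x + (A ^ s)⁻¹ * (m x ^ (1 + α)) ^ p := by
    intro x
    have hmx := hpos x
    rcases le_or_gt (m x) A with hle | hgt
    · have h1 : m x ^ (1 + α) = m x ^ α * m x := by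
        rw [add_comm, Real.rpow_add_one hmx.ne']
      have h2 : m x ^ α ≤ A ^ α := by gcongr
      have h3 : 0 ≤ (A ^ s)⁻¹ * (m x ^ (1 + α)) ^ p := by positivity
      have h4 := mul_le_mul_of_nonneg_right h2 hmx.le
      linarith
    · have h1 : (m x ^ (1 + α)) ^ p = m x ^ s * m x ^ (1 + α) := by
        rw [← Real.rpow_mul hmx.le, ← Real.rpow_add hmx]; congr 1; rw [hs]; ring
      have h2 : A ^ s ≤ m x ^ s := by gcongr
      have h3 : 1 ≤ (A ^ s)⁻¹ * m x ^ s := by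
        rw [← div_eq_inv_mul, one_le_div (by positivity)]; exact h2
      have h4 : 0 < m x ^ (1 + α) := by positivity
      have h5 : 0 ≤ A ^ α * m x := by positivity
      rw [h1, ← mul_assoc]
      nlinarith [mul_le_mul_of_nonneg_right h3 h4.le]
  have hmc := hm.continuous
  have hmp : Continuous (fun x => m x ^ (1 + α)) := hmc.rpow_const fun x => Or.inl (hpos x).ne'
  have hmpp : Continuous (fun x => (m x ^ (1 + α)) ^ p) :=
    hmp.rpow_const fun x => Or.inl (Real.rpow_pos_of_pos (hpos x) _).ne'
  have hint := cellIntegral_mono hmp (by fun_prop) hpt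
  rw [cellIntegral_add (by fun_prop) (by fun_prop), cellIntegral_const_mul, cellIntegral_const_mul,
    hmass, mul_one] at hint
  have h1 : (A ^ s)⁻¹ * cellIntegral (fun x => (m x ^ (1 + α)) ^ p) ≤ η * S := by
    calc _ ≤ (A ^ s)⁻¹ * (C * S ^ p) := by gcongr
      _ = η * S := by
        have : S ^ p = S ^ (p - 1) * S := by
          rw [← Real.rpow_add_one hS0.ne']; congr 1; ring
        have h3 : 0 < S ^ (p - 1) := by positivity
        rw [hAs, this]
        field_simp
  have h2 := hY S Z hS0.le hZ0.le
  rw [← hAα] at h2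
  have h3 : X ≤ 2 * η * S + C₂ * Z ^ (1 / (1 - α / (1 + α))) := by linarith
  have h4 : 2 * η * X ≤ 1 / 2 * X := by gcongr; linarith
  have h5 : 4 * η * ((1 + α) / 2) ^ 2 * G ≤ ε * G := by gcongr
  rw [hS] at h3
  linarith

/-! ### The Hamiltonian -/

section Hamiltonian
variable {d : ℕ} {γ γ' C₁ c₁ C₂ c₂ c₃ C₃ C₄ : ℝ} {L : Space d → Space d → ℝ}

namespace IsLagrangian

lemma hamiltonian_zero_nonpos (h : IsLagrangian γ γ' C₁ c₁ C₂ c₂ c₃ C₃ C₄ L) (x : Space d) :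
    hamiltonian L x 0 ≤ 0 :=
  Real.iSup_nonpos fun v => by simpa using h.nonneg x v

lemma bddAbove (h : IsLagrangian γ γ' C₁ c₁ C₂ c₂ c₃ C₃ C₄ L) (hC₁ : 0 < C₁) (hγ' : 1 < γ')
    (x p : Space d) : BddAbove (range fun v : Space d => -⟪v, p⟫_ℝ - L x v) := by
  have hγ0 : 0 < γ' := by linarith
  have hγ1 : 0 < γ' - 1 := by linarith
  set ρ : ℝ := (γ' * ‖p‖ / C₁) ^ (1 / (γ' - 1)) with hρ
  refine ⟨ρ * ‖p‖ + c₁, ?_⟩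
  rintro _ ⟨v, rfl⟩
  have h1 := h.lower x v
  have h2 : -⟪v, p⟫_ℝ ≤ ‖v‖ * ‖p‖ := by
    have := abs_real_inner_le_norm v p
    rw [abs_le] at this
    linarith [this.1]
  rcases le_or_gt ‖v‖ ρ with hle | hgt
  · have h3 : 0 ≤ C₁ * (‖v‖ ^ γ' / γ') := by positivity
    have h4 : ‖v‖ * ‖p‖ ≤ ρ * ‖p‖ := by gcongr
    simp only
    linarith
  · -- for large `v` the superlinear lower bound of `L` beats the linear term
    have hρ0 : 0 ≤ ρ := by positivity
    have hv0 : 0 < ‖v‖ := lt_of_le_of_lt hρ0 hgt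
    have h3 : γ' * ‖p‖ / C₁ ≤ ‖v‖ ^ (γ' - 1) := by
      have : ρ ^ (γ' - 1) ≤ ‖v‖ ^ (γ' - 1) := by gcongr
      rwa [hρ, ← Real.rpow_mul (by positivity), one_div_mul_cancel hγ1.ne', Real.rpow_one] at this
    rw [div_le_iff₀ hC₁] at h3
    have h4 : ‖v‖ ^ γ' = ‖v‖ ^ (γ' - 1) * ‖v‖ := by
      rw [← Real.rpow_add_one hv0.ne']; congr 1; ring
    have h5 : ‖v‖ * ‖p‖ ≤ C₁ * (‖v‖ ^ γ' / γ') := by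
      rw [h4, ← mul_div_assoc, le_div_iff₀ hγ0]
      nlinarith [mul_le_mul_of_nonneg_right h3 hv0.le]
    have h6 : 0 ≤ ρ * ‖p‖ := by positivity
    simp only
    linarith

lemma le_hamiltonian (h : IsLagrangian γ γ' C₁ c₁ C₂ c₂ c₃ C₃ C₄ L) (hC₁ : 0 < C₁)
    (hC₂ : 0 < C₂) (hγ' : 1 < γ') {R : ℝ} (hR : 0 ≤ R) (x p : Space d) :
    R * ‖p‖ - (C₂ * (R ^ γ' / γ') + c₂) ≤ hamiltonian L x p := by
  set v : Space d := (-(R / ‖p‖)) • p with hv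
  have h1 := le_ciSup (h.bddAbove hC₁ hγ' x p) v
  refine le_trans ?_ h1
  have hn : ‖v‖ ≤ R := by
    rw [hv, norm_smul, norm_neg, norm_div, norm_norm, Real.norm_of_nonneg hR]
    rcases eq_or_ne ‖p‖ 0 with h0 | h0
    · rw [h0]; simpa using hR
    · rw [div_mul_cancel₀ _ h0]
  have hi : -⟪v, p⟫_ℝ = R * ‖p‖ := by
    rw [hv, inner_smul_left, real_inner_self_eq_norm_sq, conj_trivial]
    rcases eq_or_ne ‖p‖ 0 with h0 | h0
    · rw [h0]; simp
    · field_simp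
  have hu := h.upper x v
  have hγ0 : 0 < γ' := by linarith
  have h2 : C₂ * (‖v‖ ^ γ' / γ') ≤ C₂ * (R ^ γ' / γ') := by gcongr
  rw [hi]
  linarith

lemma norm_drift_sq_le (h : IsLagrangian γ γ' C₁ c₁ C₂ c₂ c₃ C₃ C₄ L) (hC₄ : 0 < C₄)
    {K : ℝ} (x p : Space d) {w : Space d} (hw : ‖w‖ ≤ K) :
    ‖hamiltonianGrad L x p + w‖ ^ 2
      ≤ 2 * (C₄ + K) ^ 2 * (‖p‖ ^ (2 * γ - 2) + 1) := by
  have hK : 0 ≤ K := (norm_nonneg w).trans hw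
  have h1 := h.growth x p
  have h2 := norm_add_le (hamiltonianGrad L x p) w
  have h3 : 0 ≤ ‖p‖ ^ (γ - 1) := by positivity
  have h4 : ‖hamiltonianGrad L x p + w‖ ≤ (C₄ + K) * (‖p‖ ^ (γ - 1) + 1) := by nlinarith
  have h5 : ‖p‖ ^ (2 * γ - 2) = (‖p‖ ^ (γ - 1)) ^ 2 := by
    rw [← Real.rpow_natCast, ← Real.rpow_mul (norm_nonneg _)]; congr 1; push_cast; ring
  calc ‖hamiltonianGrad L x p + w‖ ^ 2 ≤ ((C₄ + K) * (‖p‖ ^ (γ - 1) + 1)) ^ 2 := by gcongr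
    _ = (C₄ + K) ^ 2 * (‖p‖ ^ (γ - 1) + 1) ^ 2 := by ring
    _ ≤ (C₄ + K) ^ 2 * (2 * ((‖p‖ ^ (γ - 1)) ^ 2 + 1)) := by
      gcongr
      nlinarith [sq_nonneg (‖p‖ ^ (γ - 1) - 1)]
    _ = _ := by rw [h5]; ring

end IsLagrangian

end Hamiltonian

/-! ### The value function is bounded from below -/

section LowerBound
variable {d : ℕ} {γ γ' C₁ c₁ C₂ c₂ c₃ C₃ C₄ α T K k₀ : ℝ} {L : Space d → Space d → ℝ}
  {Ψ : Space d → ℝ} {b : Space d → ℝ → Space d} {V : Space d → ℝ → ℝ} {m₀ : Space d → ℝ}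
  {u m : Space d → ℝ → ℝ}

lemma nonneg_of_hasDerivAt_of_forall_le_right {f : ℝ → ℝ} {f' t c : ℝ} (hf : HasDerivAt f f' t)
    (htc : t < c) (h : ∀ s ∈ Ioo t c, f t ≤ f s) : 0 ≤ f' := by
  have h1 := hf.tendsto_slope.mono_left (nhdsWithin_mono t fun s (hs : s ∈ Ioi t) => ne_of_gt hs)
  refine ge_of_tendsto h1 ?_
  filter_upwards [Ioo_mem_nhdsGT htc] with s hs
  rw [slope_def_field]
  exact div_nonneg (sub_nonneg.2 (h s hs)) (sub_nonneg.2 hs.1.le)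

/-- At a minimum point of `u + (K + ε) (T - t)` the momentum vanishes and `H₀(x,0) ≤ 0`, so the
Hamilton-Jacobi equation excludes a minimum before the terminal time. -/
lemma IsSolution.neg_le_add_of_pos (h : IsSolution α T L Ψ b V m₀ u m)
    (hL : IsLagrangian γ γ' C₁ c₁ C₂ c₂ c₃ C₃ C₄ L) (hdata : IsData K k₀ T Ψ b V m₀)
    {ε : ℝ} (hε : 0 < ε) {t : ℝ} (ht : t ∈ Ioc 0 T) (x : Space d) :
    -K ≤ u x t + (K + ε) * (T - t) := by
  have hIcc : Icc t T ⊆ Icc 0 T := Icc_subset_Icc_left ht.1.le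
  have hwc : ContinuousOn (fun z : Space d × ℝ => u z.1 z.2 + (K + ε) * (T - z.2))
      (univ ×ˢ Icc t T) :=
    (h.smooth_u.continuousOn.mono (prod_mono le_rfl hIcc)).add (by fun_prop)
  obtain ⟨y₀, hy₀, -⟩ := IsPeriodic.exists_mem_cell (f := fun _ : Space d => (0 : ℝ))
    (fun _ _ => rfl) x
  obtain ⟨⟨x', t'⟩, ⟨hx', ht'⟩, hmin⟩ := ((isCompact_closedCell d).prod
    (isCompact_Icc (a := t) (b := T))).exists_isMinOn
    ⟨(y₀, t), cell_subset_closedCell d hy₀, left_mem_Icc.2 ht.2⟩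
    (hwc.mono (prod_mono (subset_univ _) le_rfl))
  have hall : ∀ y, ∀ s ∈ Icc t T, u x' t' + (K + ε) * (T - t') ≤ u y s + (K + ε) * (T - s) := by
    intro y s hs
    obtain ⟨z, hz, hzy⟩ := (h.periodic_u s (hIcc hs)).exists_mem_cell y
    have := isMinOn_iff.1 hmin (z, s) ⟨cell_subset_closedCell d hz, hs⟩
    simp only at hzy this
    rwa [hzy] at this
  refine le_trans ?_ (hall x t (left_mem_Icc.2 ht.2))
  rcases eq_or_lt_of_le ht'.2 with heq | hlt
  · simp only at heq
    rw [heq, h.terminal]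
    have := (abs_le.1 (hdata.bound_Ψ x')).1
    linarith
  · exfalso
    simp only at hlt ht'
    have hto : t' ∈ Ioo 0 T := ⟨ht.1.trans_le ht'.1, hlt⟩
    have htc : t' ∈ Icc 0 T := hIcc ht'
    have hus := contDiff_slice h.smooth_u htc
    have hloc : IsLocalMin (fun y => u y t') x' :=
      Filter.Eventually.of_forall fun y => by
        have := hall y t' ht'
        simp only
        linarith
    have hlap := laplacian_nonneg_of_isLocalMin hus hloc
    have hgrad : gradient (fun y => u y t') x' = 0 := by
      rw [gradient, hloc.fderiv_eq_zero, map_zero]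
    have hdt : K + ε ≤ deriv (fun s => u x' s) t' := by
      have h1 : HasDerivAt (fun s => u x' s) _ t' :=
        (h.smoothOnStrip_u.differentiableAt hto).hasDerivAt
      have h2 := h1.add (((hasDerivAt_id t').const_sub T).const_mul (K + ε))
      have h3 := nonneg_of_hasDerivAt_of_forall_le_right h2 hlt fun s hs =>
        hall x' s ⟨ht'.1.trans hs.1.le, hs.2.le⟩
      linarith
    have hHJ := h.hamilton_jacobi x' t' hto
    have hmom : momentum α u m x' t' = 0 := by rw [momentum, hgrad, smul_zero]
    rw [hmom, hgrad, inner_zero_right] at hHJ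
    have hV := (abs_le.1 (hdata.bound_V x' (m x' t'))).1
    have hH : m x' t' ^ α * hamiltonian L x' 0 ≤ 0 :=
      mul_nonpos_of_nonneg_of_nonpos (Real.rpow_nonneg (h.pos x' t' htc).le _)
        (hL.hamiltonian_zero_nonpos x')
    linarith

lemma IsSolution.neg_le (h : IsSolution α T L Ψ b V m₀ u m)
    (hL : IsLagrangian γ γ' C₁ c₁ C₂ c₂ c₃ C₃ C₄ L) (hdata : IsData K k₀ T Ψ b V m₀)
    (hT : 0 < T) {t : ℝ} (ht : t ∈ Icc 0 T) (x : Space d) :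
    -(K * (1 + T)) ≤ u x t := by
  have hK : 0 ≤ K := (abs_nonneg _).trans (hdata.bound_Ψ 0)
  have hpos : ∀ t ∈ Ioc 0 T, -(K * (1 + T)) ≤ u x t := by
    intro t ht
    have h1 : -K ≤ u x t + K * (T - t) := by
      refine le_of_forall_pos_le_add fun δ hδ => ?_
      have h2 := h.neg_le_add_of_pos hL hdata (ε := δ / T) (by positivity) ht x
      have h3 : δ / T * (T - t) ≤ δ := by
        rw [div_mul_eq_mul_div, div_le_iff₀ hT]
        nlinarith [ht.1]
      linarith
    nlinarith [ht.1]
  rcases eq_or_lt_of_le ht.1 with h0 | h0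
  · rw [← h0]
    have hc : ContinuousOn (fun s => u x s) (Icc 0 T) :=
      h.smooth_u.continuousOn.comp (f := fun s : ℝ => (x, s)) (by fun_prop)
        (fun s hs => ⟨mem_univ _, hs⟩)
    have h1 : Filter.Tendsto (fun s => u x s) (𝓝[>] 0) (𝓝 (u x 0)) :=
      (hc 0 (left_mem_Icc.2 hT.le)).mono_left
        (nhdsWithin_le_of_mem (Filter.mem_of_superset (Ioo_mem_nhdsGT hT) Ioo_subset_Icc_self))
    refine ge_of_tendsto h1 ?_
    filter_upwards [Ioo_mem_nhdsGT hT] with s hs using hpos s ⟨hs.1, hs.2.le⟩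
  · exact hpos t ⟨h0, ht.2⟩

end LowerBound

/-! ### Energy estimates -/

/-- The constants on which the estimates are allowed to depend. -/
structure Constants where
  (d : ℕ)
  (α γ γ' C₁ c₁ C₂ c₂ c₃ C₃ C₄ K k₀ Tmax : ℝ)
  one_le_d : 1 ≤ d
  α_nonneg : 0 ≤ α
  α_lt : 2 < d → α < 2 / ((d : ℝ) - 2)
  one_lt_γ : 1 < γ
  γ_lt_two : γ < 2
  one_lt_γ' : 1 < γ'
  C₁_pos : 0 < C₁
  C₂_pos : 0 < C₂
  c₂_pos : 0 < c₂
  c₃_pos : 0 < c₃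
  C₃_pos : 0 < C₃
  C₄_pos : 0 < C₄
  K_nonneg : 0 ≤ K
  k₀_pos : 0 < k₀
  Tmax_pos : 0 < Tmax

/-- Data satisfying the assumptions with the given constants, together with a solution. -/
structure Problem (P : Constants) where
  (T : ℝ)
  (L : Space P.d → Space P.d → ℝ)
  (Ψ : Space P.d → ℝ)
  (b : Space P.d → ℝ → Space P.d)
  (V : Space P.d → ℝ → ℝ)
  (m₀ : Space P.d → ℝ)
  (u m : Space P.d → ℝ → ℝ)
  T_pos : 0 < T
  T_le : T ≤ P.Tmax
  lagrangian : IsLagrangian P.γ P.γ' P.C₁ P.c₁ P.C₂ P.c₂ P.c₃ P.C₃ P.C₄ L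
  data : IsData P.K P.k₀ T Ψ b V m₀
  solution : IsSolution P.α T L Ψ b V m₀ u m

lemma sub_le_of_hasDerivAt {f f' : ℝ → ℝ} {T C : ℝ} (hc : ContinuousOn f (Icc 0 T))
    (hd : ∀ t ∈ Ioo 0 T, HasDerivAt f (f' t) t) (hle : ∀ t ∈ Ioo 0 T, f' t ≤ C)
    {s t : ℝ} (hs : s ∈ Icc 0 T) (ht : t ∈ Icc 0 T) (hst : s ≤ t) : f t - f s ≤ C * (t - s) := by
  refine (convex_Icc 0 T).image_sub_le_mul_sub_of_deriv_le hc ?_ ?_ s hs t ht hst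
  · rw [interior_Icc]
    exact fun x hx => (hd x hx).differentiableAt.differentiableWithinAt
  · rw [interior_Icc]
    intro x hx
    rw [(hd x hx).deriv]
    exact hle x hx

lemma rpow_le_add_div {m α A : ℝ} (hm : 0 < m) (hα : 0 ≤ α) (hA : 0 < A) :
    m ^ α ≤ A ^ α + m ^ (1 + α) / A := by
  have h0 : 0 ≤ m ^ (1 + α) / A := by positivity
  have h0' : 0 ≤ A ^ α := by positivity
  rcases le_or_gt m A with h | h
  · have : m ^ α ≤ A ^ α := by gcongr
    linarith
  · have h1 : m ^ (1 + α) = m ^ α * m := by rw [add_comm, Real.rpow_add_one hm.ne']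
    have h2 : m ^ α ≤ m ^ (1 + α) / A := by
      rw [le_div_iff₀ hA, h1]
      gcongr
    linarith

namespace Problem
variable {P : Constants} (S : Problem P)

/-- The rescaled momentum `Du / m^α` of the solution. -/
noncomputable def p (x : Space P.d) (t : ℝ) : Space P.d := momentum P.α S.u S.m x t

/-- The gradient `D_p H₀` along the solution. -/
noncomputable def D (x : Space P.d) (t : ℝ) : Space P.d := hamiltonianGrad S.L x (S.p x t)

/-- The gradient of the density. -/
noncomputable def Dm (x : Space P.d) (t : ℝ) : Space P.d := gradient (fun y => S.m y t) x

/-- The integral `∫ (a + c u) m^q` at time `t`. -/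
noncomputable def energy (a c q t : ℝ) : ℝ :=
  cellIntegral (fun x => (a + c * S.u x t) * S.m x t ^ q)

/-- The integrand of the derivative of `Problem.energy`. -/
noncomputable def rate (a c q t : ℝ) (x : Space P.d) : ℝ :=
  energyRate P.α S.L S.b S.V S.u S.m a c q t x

lemma m_pos (x : Space P.d) {t : ℝ} (ht : t ∈ Icc 0 S.T) : 0 < S.m x t := S.solution.pos x t ht

lemma contDiff_m {t : ℝ} (ht : t ∈ Icc 0 S.T) : ContDiff ℝ ∞ (fun x => S.m x t) :=
  contDiff_slice S.solution.smooth_m ht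

lemma contDiff_u {t : ℝ} (ht : t ∈ Icc 0 S.T) : ContDiff ℝ ∞ (fun x => S.u x t) :=
  contDiff_slice S.solution.smooth_u ht

lemma continuous_m {t : ℝ} (ht : t ∈ Icc 0 S.T) : Continuous (fun x => S.m x t) :=
  (S.contDiff_m ht).continuous

lemma continuous_u {t : ℝ} (ht : t ∈ Icc 0 S.T) : Continuous (fun x => S.u x t) :=
  (S.contDiff_u ht).continuous

lemma continuous_rpow {t : ℝ} (ht : t ∈ Icc 0 S.T) (q : ℝ) :
    Continuous (fun x => S.m x t ^ q) :=
  (S.continuous_m ht).rpow_const fun x => Or.inl (S.m_pos x ht).ne'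

lemma continuous_Dm {t : ℝ} (ht : t ∈ Icc 0 S.T) : Continuous (fun x => S.Dm x t) :=
  (contDiff_gradient (S.contDiff_m ht)).continuous

lemma continuousOn_energy (a c q : ℝ) : ContinuousOn (S.energy a c q) (Icc 0 S.T) :=
  S.solution.continuousOn_energy a c q

lemma continuous_rate {t : ℝ} (ht : t ∈ Ioo 0 S.T) (a c q : ℝ) : Continuous (S.rate a c q t) :=
  (S.solution.hasDerivAt_energy S.lagrangian.periodic S.data.periodic_b S.data.smooth_b ht
    a c q).1

lemma hasDerivAt_energy {t : ℝ} (ht : t ∈ Ioo 0 S.T) (a c q : ℝ) :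
    HasDerivAt (S.energy a c q) (cellIntegral (S.rate a c q t)) t :=
  (S.solution.hasDerivAt_energy S.lagrangian.periodic S.data.periodic_b S.data.smooth_b ht
    a c q).2

lemma gradient_u_eq {t : ℝ} (ht : t ∈ Icc 0 S.T) (x : Space P.d) :
    gradient (fun y => S.u y t) x = (S.m x t ^ P.α) • S.p x t := by
  have : S.m x t ^ P.α ≠ 0 := (Real.rpow_pos_of_pos (S.m_pos x ht) _).ne'
  rw [p, momentum, smul_inv_smul₀ this]

/-- The rate in terms of the rescaled momentum. -/
lemma rate_eq {t : ℝ} (ht : t ∈ Icc 0 S.T) (a c q : ℝ) (x : Space P.d) :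
    S.rate a c q t x =
      c * (S.m x t ^ q * S.m x t ^ P.α) * (hamiltonian S.L x (S.p x t) + ⟪S.b x t, S.p x t⟫_ℝ
        - q * (⟪S.p x t, S.D x t⟫_ℝ + ⟪S.b x t, S.p x t⟫_ℝ))
      - c * S.m x t ^ q * S.V x (S.m x t)
      - q * (q - 1) * (a + c * S.u x t) * (S.m x t ^ (q - 2) * ‖S.Dm x t‖ ^ 2
        + S.m x t ^ (q - 1) * ⟪S.Dm x t, S.D x t + S.b x t⟫_ℝ) := by
  rw [rate, energyRate, S.gradient_u_eq ht, inner_smul_left, inner_smul_right, inner_add_right,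
    real_inner_comm (S.b x t) (S.p x t)]
  simp only [conj_trivial, D, p, Dm]
  ring

lemma u_lower (x : Space P.d) {t : ℝ} (ht : t ∈ Icc 0 S.T) :
    -(P.K * (1 + P.Tmax)) ≤ S.u x t := by
  refine le_trans ?_ (S.solution.neg_le S.lagrangian S.data S.T_pos ht x)
  have := P.K_nonneg
  have := S.T_le
  have : P.K * (1 + S.T) ≤ P.K * (1 + P.Tmax) := by gcongr
  linarith

lemma mass_eq {t : ℝ} (ht : t ∈ Icc 0 S.T) : cellIntegral (fun x => S.m x t) = 1 := by
  have h0 : (0 : ℝ) ∈ Icc 0 S.T := left_mem_Icc.2 S.T_pos.le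
  have he : ∀ t, S.energy 1 0 1 t = cellIntegral (fun x => S.m x t) := fun t => by
    simp [energy]
  have hr : ∀ t ∈ Ioo 0 S.T, cellIntegral (S.rate 1 0 1 t) = 0 := fun t ht => by
    have : S.rate 1 0 1 t = fun _ => 0 := by
      funext x; rw [S.rate_eq (Ioo_subset_Icc_self ht)]; ring
    rw [this, cellIntegral_const]
  have h1 := sub_le_of_hasDerivAt (S.continuousOn_energy 1 0 1)
    (fun t ht => S.hasDerivAt_energy ht 1 0 1) (C := 0) (fun t ht => (hr t ht).le) h0 ht ht.1
  have h2 := sub_le_of_hasDerivAt (S.continuousOn_energy 1 0 1).neg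
    (fun t ht => (S.hasDerivAt_energy ht 1 0 1).neg) (C := 0)
    (fun t ht => by rw [hr t ht]; simp) h0 ht ht.1
  simp only [Pi.neg_apply, he] at h1 h2
  have h3 : cellIntegral (fun x => S.m x 0) = 1 := by
    rw [← S.data.integral_m₀]; congr 1; funext x; exact S.solution.initial x
  linarith

end Problem

namespace Constants
variable (P : Constants)

/-- The constant in the lower bound `H₀(x,p) ≥ K |p| - P.cH`. -/
noncomputable def cH : ℝ := P.C₂ * (P.K ^ P.γ' / P.γ') + P.c₂

lemma cH_pos : 0 < P.cH := by
  have h1 := P.C₂_pos; have h2 := P.c₂_pos; have h3 := P.one_lt_γ'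
  have h4 := P.K_nonneg
  have : 0 < P.γ' := by linarith
  unfold cH
  positivity

/-- The constant in the bound of the squared drift `|D_p H₀ + b|²`. -/
noncomputable def cD : ℝ := 2 * (P.C₄ + P.K) ^ 2

lemma cD_pos : 0 < P.cD := by
  have h1 := P.C₄_pos; have h2 := P.K_nonneg
  unfold cD
  positivity

end Constants

namespace Problem
variable {P : Constants} (S : Problem P)

lemma norm_b_le (x : Space P.d) {t : ℝ} (ht : t ∈ Icc 0 S.T) : ‖S.b x t‖ ≤ P.K :=
  S.data.bound_b x t ht

lemma abs_inner_b_le (x : Space P.d) {t : ℝ} (ht : t ∈ Icc 0 S.T) :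
    |⟪S.b x t, S.p x t⟫_ℝ| ≤ P.K * ‖S.p x t‖ :=
  (abs_real_inner_le_norm _ _).trans (by gcongr; exact S.norm_b_le x ht)

/-- The first-order terms of the Hamilton-Jacobi equation are bounded from below: the drift is
absorbed by the superlinear growth of the Hamiltonian. -/
lemma neg_cH_le (x : Space P.d) {t : ℝ} (ht : t ∈ Icc 0 S.T) :
    -P.cH ≤ hamiltonian S.L x (S.p x t) + ⟪S.b x t, S.p x t⟫_ℝ := by
  have h1 := S.lagrangian.le_hamiltonian P.C₁_pos P.C₂_pos P.one_lt_γ' P.K_nonneg x (S.p x t)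
  have h2 := (abs_le.1 (S.abs_inner_b_le x ht)).1
  unfold Constants.cH
  linarith

lemma coercive (x : Space P.d) (t : ℝ) :
    P.c₃ * ‖S.p x t‖ ^ P.γ - P.C₃
      ≤ ⟪S.p x t, S.D x t⟫_ℝ - hamiltonian S.L x (S.p x t) :=
  S.lagrangian.coercive x (S.p x t)

lemma norm_drift_sq_le (x : Space P.d) {t : ℝ} (ht : t ∈ Icc 0 S.T) :
    ‖S.D x t + S.b x t‖ ^ 2 ≤ P.cD * (‖S.p x t‖ ^ (2 * P.γ - 2) + 1) :=
  S.lagrangian.norm_drift_sq_le P.C₄_pos x (S.p x t) (S.norm_b_le x ht)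

lemma abs_V_le (x : Space P.d) (t : ℝ) : |S.V x (S.m x t)| ≤ P.K := S.data.bound_V x _

/-- Young's inequality for the cross term between `Dm` and the drift. -/
lemma neg_cross_le (x : Space P.d) {t : ℝ} (ht : t ∈ Icc 0 S.T) (q : ℝ) :
    -(S.m x t ^ (q - 2) * ‖S.Dm x t‖ ^ 2
        + S.m x t ^ (q - 1) * ⟪S.Dm x t, S.D x t + S.b x t⟫_ℝ)
      ≤ -(1 / 2) * (S.m x t ^ (q - 2) * ‖S.Dm x t‖ ^ 2)
        + 1 / 2 * (S.m x t ^ q * ‖S.D x t + S.b x t‖ ^ 2) := by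
  have hm := S.m_pos x ht
  set B := S.D x t + S.b x t
  have h1 : S.m x t ^ (q - 1) = S.m x t ^ (q - 2) * S.m x t := by
    rw [← Real.rpow_add_one hm.ne']; congr 1; ring
  have h2 : S.m x t ^ q = S.m x t ^ (q - 2) * S.m x t * S.m x t := by
    rw [← h1, ← Real.rpow_add_one hm.ne']; congr 1; ring
  have h3 : 0 < S.m x t ^ (q - 2) := Real.rpow_pos_of_pos hm _
  have h4 := (abs_le.1 (abs_real_inner_le_norm (S.Dm x t) B)).1
  rw [h1, h2]
  have h5 : 0 ≤ S.m x t ^ (q - 2) * (‖S.Dm x t‖ - S.m x t * ‖B‖) ^ 2 := by positivity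
  have h6 := mul_le_mul_of_nonneg_left h4 (mul_pos h3 hm).le
  nlinarith

/-- Bound of the rate of `∫ u m`: the Lagrangian controls `m^(1+α) |p|^γ`. -/
lemma rate_um_le (x : Space P.d) {t : ℝ} (ht : t ∈ Icc 0 S.T) :
    S.rate 0 1 1 t x ≤ -P.c₃ * (S.m x t ^ (1 + P.α) * ‖S.p x t‖ ^ P.γ)
      + P.C₃ * S.m x t ^ (1 + P.α) + P.K * S.m x t := by
  have hm := S.m_pos x ht
  rw [S.rate_eq ht]
  have h1 : S.m x t ^ (1 : ℝ) * S.m x t ^ P.α = S.m x t ^ (1 + P.α) := by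
    rw [← Real.rpow_add hm]
  have h2 : 0 < S.m x t ^ (1 + P.α) := Real.rpow_pos_of_pos hm _
  have h3 := mul_le_mul_of_nonneg_left (S.coercive x t) h2.le
  have h4 := mul_le_mul_of_nonneg_left ((abs_le.1 (S.abs_V_le x t)).1) hm.le
  rw [h1, Real.rpow_one]
  nlinarith

/-- Bound of the rate of `∫ m^(1+α)`. -/
lemma rate_pow_le (x : Space P.d) {t : ℝ} (ht : t ∈ Icc 0 S.T) :
    S.rate 1 0 (1 + P.α) t x
      ≤ -((1 + P.α) * P.α / 2) * (S.m x t ^ (P.α - 1) * ‖S.Dm x t‖ ^ 2)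
        + ((1 + P.α) * P.α / 2 * P.cD) * (S.m x t ^ (1 + P.α) * ‖S.p x t‖ ^ P.γ)
        + ((1 + P.α) * P.α * P.cD) * S.m x t ^ (1 + P.α) := by
  have hm := S.m_pos x ht
  have hα := P.α_nonneg
  have hD := P.cD_pos
  have h2 : 0 < S.m x t ^ (1 + P.α) := Real.rpow_pos_of_pos hm _
  rw [S.rate_eq ht]
  have h1 := S.neg_cross_le x ht (1 + P.α)
  have e1 : (1 + P.α - 2) = P.α - 1 := by ring
  rw [e1] at h1 ⊢
  have h3 := S.norm_drift_sq_le x ht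
  have h4 : ‖S.p x t‖ ^ (2 * P.γ - 2) ≤ ‖S.p x t‖ ^ P.γ + 1 := by
    have h0 := norm_nonneg (S.p x t)
    have hg := P.one_lt_γ; have hg2 := P.γ_lt_two
    rcases le_or_gt ‖S.p x t‖ 1 with h | h
    · have : ‖S.p x t‖ ^ (2 * P.γ - 2) ≤ 1 := Real.rpow_le_one h0 h (by linarith)
      have : 0 ≤ ‖S.p x t‖ ^ P.γ := by positivity
      linarith
    · have : ‖S.p x t‖ ^ (2 * P.γ - 2) ≤ ‖S.p x t‖ ^ P.γ :=
        Real.rpow_le_rpow_of_exponent_le h.le (by linarith)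
      linarith
  have h5 : S.m x t ^ (1 + P.α) * ‖S.D x t + S.b x t‖ ^ 2
      ≤ S.m x t ^ (1 + P.α) * (P.cD * (‖S.p x t‖ ^ P.γ + 2)) := by
    gcongr
    have := mul_le_mul_of_nonneg_left h4 hD.le
    linarith
  have h6 : 0 ≤ (1 + P.α) * P.α := by positivity
  have h7 : -(S.m x t ^ (P.α - 1) * ‖S.Dm x t‖ ^ 2
        + S.m x t ^ (1 + P.α - 1) * ⟪S.Dm x t, S.D x t + S.b x t⟫_ℝ)
      ≤ -(1 / 2) * (S.m x t ^ (P.α - 1) * ‖S.Dm x t‖ ^ 2)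
        + 1 / 2 * (S.m x t ^ (1 + P.α) * (P.cD * (‖S.p x t‖ ^ P.γ + 2))) := by linarith
  have h8 := mul_le_mul_of_nonneg_left h7 h6
  linarith

/-- Bound of the rate of `∫ u`. -/
lemma le_rate_u (x : Space P.d) {t : ℝ} (ht : t ∈ Icc 0 S.T) :
    -(P.cH * S.m x t ^ P.α) - P.K ≤ S.rate 0 1 0 t x := by
  have hm := S.m_pos x ht
  rw [S.rate_eq ht]
  have h2 : 0 < S.m x t ^ P.α := Real.rpow_pos_of_pos hm _
  have h3 := mul_le_mul_of_nonneg_left (S.neg_cH_le x ht) h2.le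
  have h4 := (abs_le.1 (S.abs_V_le x t)).2
  rw [Real.rpow_zero]
  linarith

end Problem

namespace Problem
variable {P : Constants} (S : Problem P)

lemma zero_mem : (0 : ℝ) ∈ Icc 0 S.T := left_mem_Icc.2 S.T_pos.le

lemma T_mem : S.T ∈ Icc 0 S.T := right_mem_Icc.2 S.T_pos.le

lemma cellIntegral_rpow_α_le {t : ℝ} (ht : t ∈ Icc 0 S.T) {A : ℝ} (hA : 0 < A) :
    cellIntegral (fun x => S.m x t ^ P.α)
      ≤ A ^ P.α + cellIntegral (fun x => S.m x t ^ (1 + P.α)) / A := by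
  have h := cellIntegral_mono (g := fun x => A ^ P.α + S.m x t ^ (1 + P.α) / A)
    (S.continuous_rpow ht P.α)
    (continuous_const.add ((S.continuous_rpow ht (1 + P.α)).div_const A))
    (fun x => rpow_le_add_div (S.m_pos x ht) P.α_nonneg hA)
  refine h.trans (le_of_eq ?_)
  simp only [div_eq_inv_mul]
  have hc := S.continuous_rpow ht (1 + P.α)
  rw [cellIntegral_add (by fun_prop) (by fun_prop),
    cellIntegral_const, cellIntegral_const_mul]

/-- Upper bound of the initial mean value of `u` in terms of a bound of `∫ m^(1+α)`. -/
lemma cellIntegral_u_zero_le {M A : ℝ} (hA : 0 < A)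
    (hM : ∀ t ∈ Icc 0 S.T, cellIntegral (fun x => S.m x t ^ (1 + P.α)) ≤ M) :
    cellIntegral (fun x => S.u x 0) ≤ P.K + (P.cH * (A ^ P.α + M / A) + P.K) * P.Tmax := by
  have hcH := P.cH_pos
  have hK := P.K_nonneg
  have hM0 : 0 ≤ M := le_trans (cellIntegral_nonneg fun x =>
    (Real.rpow_pos_of_pos (S.m_pos x S.zero_mem) _).le) (hM 0 S.zero_mem)
  have he : ∀ t, S.energy 0 1 0 t = cellIntegral (fun x => S.u x t) := fun t => by simp [energy]
  have hr : ∀ t ∈ Ioo 0 S.T, -cellIntegral (S.rate 0 1 0 t)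
      ≤ P.cH * (A ^ P.α + M / A) + P.K := fun t ht => by
    have htc := Ioo_subset_Icc_self ht
    have hc := S.continuous_rpow htc P.α
    have h1 := cellIntegral_mono (f := fun x => -(P.cH * S.m x t ^ P.α) - P.K)
      (((continuous_const.mul hc).neg).sub continuous_const)
      (S.continuous_rate ht 0 1 0) (fun x => S.le_rate_u x htc)
    have e1 : cellIntegral (fun x => -(P.cH * S.m x t ^ P.α) - P.K)
        = -(P.cH * cellIntegral (fun x => S.m x t ^ P.α)) - P.K := by
      rw [cellIntegral_sub (by fun_prop) continuous_const, cellIntegral_const]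
      have : (fun x => -(P.cH * S.m x t ^ P.α)) = fun x => (-P.cH) * S.m x t ^ P.α := by
        funext x; ring
      rw [this, cellIntegral_const_mul]; ring
    rw [e1] at h1
    have h2 := S.cellIntegral_rpow_α_le htc hA
    have h3 : cellIntegral (fun x => S.m x t ^ (1 + P.α)) / A ≤ M / A := by
      gcongr; exact hM t htc
    have h4 := mul_le_mul_of_nonneg_left (h2.trans (add_le_add_right h3 _)) hcH.le
    linarith
  have h1 := sub_le_of_hasDerivAt (S.continuousOn_energy 0 1 0).neg
    (fun t ht => (S.hasDerivAt_energy ht 0 1 0).neg) hr S.zero_mem S.T_mem S.T_pos.le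
  simp only [Pi.neg_apply, he] at h1
  have h2 : cellIntegral (fun x => S.u x S.T) ≤ P.K := by
    have := cellIntegral_mono (S.continuous_u S.T_mem) continuous_const
      (fun x => by rw [S.solution.terminal]; exact (abs_le.1 (S.data.bound_Ψ x)).2)
    rwa [cellIntegral_const] at this
  have h3 : (P.cH * (A ^ P.α + M / A) + P.K) * (S.T - 0)
      ≤ (P.cH * (A ^ P.α + M / A) + P.K) * P.Tmax := by
    rw [sub_zero]
    gcongr
    exact S.T_le
  linarith

lemma energy_um_zero_le :
    S.energy 0 1 1 0
      ≤ P.K * (cellIntegral (fun x => S.u x 0) + P.K * (1 + P.Tmax)) := by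
  have hK := P.K_nonneg
  have hT := P.Tmax_pos
  have h0 := S.zero_mem
  have hc := S.continuous_u h0
  have hcm := S.continuous_rpow h0 1
  have h1 := cellIntegral_mono (f := fun x => (0 + 1 * S.u x 0) * S.m x 0 ^ (1 : ℝ))
    (g := fun x => P.K * (S.u x 0 + P.K * (1 + P.Tmax))) (by fun_prop) (by fun_prop) (fun x => by
      have hu := S.u_lower x h0
      have hm := S.m_pos x h0
      have hmK : S.m x 0 ≤ P.K := by rw [S.solution.initial]; exact S.data.bound_m₀ x
      have h2 : 0 ≤ P.K * (1 + P.Tmax) := by positivity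
      rw [Real.rpow_one]
      nlinarith [mul_nonneg h2 hm.le, mul_nonneg (neg_le_iff_add_nonneg.1 hu)
        (sub_nonneg.2 hmK)])
  rw [cellIntegral_const_mul, cellIntegral_add hc continuous_const, cellIntegral_const] at h1
  exact h1

lemma le_energy_um {t : ℝ} (ht : t ∈ Icc 0 S.T) :
    -(P.K * (1 + P.Tmax)) ≤ S.energy 0 1 1 t := by
  have hc := S.continuous_u ht
  have hcm := S.continuous_rpow ht 1
  have hcm' := S.continuous_m ht
  have h1 := cellIntegral_mono (f := fun x => -(P.K * (1 + P.Tmax)) * S.m x t)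
    (g := fun x => (0 + 1 * S.u x t) * S.m x t ^ (1 : ℝ)) (by fun_prop) (by fun_prop) (fun x => by
      have hu := S.u_lower x ht
      have hm := S.m_pos x ht
      rw [Real.rpow_one, zero_add, one_mul]
      exact mul_le_mul_of_nonneg_right hu hm.le)
  rw [cellIntegral_const_mul, S.mass_eq ht, mul_one] at h1
  exact h1

end Problem

/-- The energy estimate: `∫ m^(1+α)` is bounded on `[0,T]`. The rate of `∫ m^(1+α) + λ ∫ u m` is
bounded since the second rate absorbs `m^(1+α) |p|^γ` and the dissipation absorbs `m^(1+α)`; the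
initial value is controlled by the mean value of `u`, hence, with a small constant, by the
estimated quantity itself. -/
lemma exists_energy_bound (P : Constants) :
    ∃ M : ℝ, 0 < M ∧ ∀ S : Problem P, ∀ t ∈ Icc 0 S.T,
      cellIntegral (fun x => S.m x t ^ (1 + P.α)) ≤ M := by
  have hK := P.K_nonneg
  have hTm := P.Tmax_pos
  have hcH := P.cH_pos
  have hcD := P.cD_pos
  have hc₃ := P.c₃_pos
  have hC₃ := P.C₃_pos
  rcases eq_or_lt_of_le P.α_nonneg with hα0 | hα
  · refine ⟨1, one_pos, fun S t ht => ?_⟩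
    rw [← hα0]
    simp only [add_zero, Real.rpow_one]
    exact (S.mass_eq ht).le
  set c5 := (1 + P.α) * P.α / 2 * P.cD with hc5
  have hc5' : 0 < c5 := by positivity
  set l := c5 / P.c₃ with hl
  have hl0 : 0 < l := by positivity
  set C6 := (1 + P.α) * P.α * P.cD + l * P.C₃ with hC6
  have hC60 : 0 < C6 := by positivity
  have hε : 0 < (1 + P.α) * P.α / 2 / C6 := by positivity
  obtain ⟨Cε, hCε, hint⟩ := exists_mass_interpolation P.d hα hε
  set C7 := C6 * Cε + l * P.K with hC7
  have hC70 : 0 ≤ C7 := by positivity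
  set Cu := P.K * (1 + P.Tmax) with hCu
  have hCu0 : 0 ≤ Cu := by positivity
  set C8 := P.K ^ (1 + P.α) + l * P.K * (P.K + P.K * P.Tmax + Cu) + C7 * P.Tmax + l * Cu with hC8
  have hC80 : 0 ≤ C8 := by positivity
  set B := l * P.K * P.Tmax * P.cH with hB
  have hB0 : 0 ≤ B := by positivity
  set A := 2 * B + 1 with hA
  have hA0 : 0 < A := by positivity
  refine ⟨2 * C8 + 2 * B * A ^ P.α + 1, by positivity, fun S => ?_⟩
  have he : ∀ t, S.energy 1 0 (1 + P.α) t = cellIntegral (fun x => S.m x t ^ (1 + P.α)) :=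
    fun t => by simp [Problem.energy]
  -- the combined rate is bounded
  have hrate : ∀ t ∈ Ioo 0 S.T, cellIntegral (S.rate 1 0 (1 + P.α) t)
      + l * cellIntegral (S.rate 0 1 1 t) ≤ C7 := by
    intro t ht
    have htc := Ioo_subset_Icc_self ht
    have hr1 := S.continuous_rate ht 1 0 (1 + P.α)
    have hr2 := S.continuous_rate ht 0 1 1
    have hcm := S.continuous_m htc
    have hcp := S.continuous_rpow htc (1 + P.α)
    have hcG : Continuous (fun x => S.m x t ^ (P.α - 1) * ‖S.Dm x t‖ ^ 2) :=
      (S.continuous_rpow htc _).mul ((S.continuous_Dm htc).norm.pow 2)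
    have h1 := cellIntegral_mono
      (f := fun x => S.rate 1 0 (1 + P.α) t x + l * S.rate 0 1 1 t x)
      (g := fun x => (-((1 + P.α) * P.α / 2) * (S.m x t ^ (P.α - 1) * ‖S.Dm x t‖ ^ 2)
        + C6 * S.m x t ^ (1 + P.α)) + l * P.K * S.m x t) (by fun_prop) (by fun_prop) (fun x => by
        have e1 := S.rate_pow_le x htc
        have e2 := mul_le_mul_of_nonneg_left (S.rate_um_le x htc) hl0.le
        have e3 : l * P.c₃ = c5 := by rw [hl]; field_simp
        have e4 : l * (-P.c₃ * (S.m x t ^ (1 + P.α) * ‖S.p x t‖ ^ P.γ))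
            = -c5 * (S.m x t ^ (1 + P.α) * ‖S.p x t‖ ^ P.γ) := by rw [← e3]; ring
        rw [mul_add, mul_add, e4, hc5] at e2
        rw [hC6]
        linarith)
    rw [cellIntegral_add hr1 (by fun_prop), cellIntegral_const_mul,
      cellIntegral_add (by fun_prop) (by fun_prop), cellIntegral_add (by fun_prop) (by fun_prop),
      cellIntegral_const_mul, cellIntegral_const_mul, cellIntegral_const_mul, S.mass_eq htc] at h1
    have h2 := hint (fun x => S.m x t) (S.contDiff_m htc) (S.solution.periodic_m t htc)
      (fun x => S.m_pos x htc) (S.mass_eq htc)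
    have h3 := mul_le_mul_of_nonneg_left h2 hC60.le
    have h4 : C6 * ((1 + P.α) * P.α / 2 / C6
        * cellIntegral (fun x => S.m x t ^ (P.α - 1) * ‖gradient (fun x => S.m x t) x‖ ^ 2) + Cε)
        = (1 + P.α) * P.α / 2 * cellIntegral (fun x => S.m x t ^ (P.α - 1) * ‖S.Dm x t‖ ^ 2)
          + C6 * Cε := by
      have : ∀ g : ℝ, C6 * ((1 + P.α) * P.α / 2 / C6 * g + Cε)
        = (1 + P.α) * P.α / 2 * g + C6 * Cε := fun g => by field_simp
      exact this _
    rw [h4] at h3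
    rw [hC7]
    linarith
  have hcE := S.continuousOn_energy 1 0 (1 + P.α)
  obtain ⟨t', ht', hmax⟩ := isCompact_Icc.exists_isMaxOn ⟨0, S.zero_mem⟩ hcE
  set M' := S.energy 1 0 (1 + P.α) t' with hM'
  have hM : ∀ t ∈ Icc 0 S.T, cellIntegral (fun x => S.m x t ^ (1 + P.α)) ≤ M' := fun t ht => by
    rw [← he]; exact isMaxOn_iff.1 hmax t ht
  have hM0 : 0 ≤ M' := le_trans (cellIntegral_nonneg fun x =>
    (Real.rpow_pos_of_pos (S.m_pos x S.zero_mem) _).le) (hM 0 S.zero_mem)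
  suffices hfin : M' ≤ 2 * C8 + 2 * B * A ^ P.α + 1 from fun t ht => (hM t ht).trans hfin
  have h1 := sub_le_of_hasDerivAt
    (hcE.add ((S.continuousOn_energy 0 1 1).const_smul l))
    (fun t ht => (S.hasDerivAt_energy ht 1 0 (1 + P.α)).add
      ((S.hasDerivAt_energy ht 0 1 1).const_smul l)) hrate S.zero_mem ht' ht'.1
  simp only [Pi.add_apply, Pi.smul_apply, smul_eq_mul] at h1
  have h2 := S.le_energy_um ht'
  have h3 := S.energy_um_zero_le
  have h4 := S.cellIntegral_u_zero_le hA0 hM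
  have h5 : S.energy 1 0 (1 + P.α) 0 ≤ P.K ^ (1 + P.α) := by
    rw [he]
    have := cellIntegral_mono (S.continuous_rpow S.zero_mem (1 + P.α)) continuous_const
      (g := fun _ => P.K ^ (1 + P.α)) (fun x => by
        have hm := S.m_pos x S.zero_mem
        have hmK : S.m x 0 ≤ P.K := by rw [S.solution.initial]; exact S.data.bound_m₀ x
        gcongr)
    rwa [cellIntegral_const] at this
  have h6 : C7 * (t' - 0) ≤ C7 * P.Tmax := by
    gcongr
    rw [sub_zero]; exact ht'.2.trans S.T_le
  have h7 : l * S.energy 0 1 1 0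
      ≤ l * (P.K * ((P.K + (P.cH * (A ^ P.α + M' / A) + P.K) * P.Tmax) + Cu)) := by
    gcongr
    refine h3.trans ?_
    gcongr
  have h8 : l * (P.K * ((P.K + (P.cH * (A ^ P.α + M' / A) + P.K) * P.Tmax) + Cu))
      = l * P.K * (P.K + P.K * P.Tmax + Cu) + B * A ^ P.α + B * (M' / A) := by
    rw [hB]; ring
  have h9 : B * (M' / A) ≤ M' / 2 := by
    rw [← mul_div_assoc, div_le_div_iff₀ hA0 two_pos, hA]
    nlinarith
  have h10 := mul_le_mul_of_nonneg_left h2 hl0.le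
  rw [hC8]
  linarith

/-! ### Gaussian averages -/

section Gaussian
variable {d : ℕ}

/-- The Gaussian profile `exp (-|z|² / 4)` of the heat kernel. -/
noncomputable def gauss (z : Space d) : ℝ := Real.exp (-(1 / 4) * ‖z‖ ^ 2)

lemma gauss_pos (z : Space d) : 0 < gauss z := Real.exp_pos _

lemma contDiff_gauss : ContDiff ℝ ∞ (gauss (d := d)) :=
  Real.contDiff_exp.comp (contDiff_const.mul (contDiff_norm_sq ℝ))

lemma continuous_gauss : Continuous (gauss (d := d)) := contDiff_gauss.continuous

lemma integrable_exp_neg_mul_norm_sq {c : ℝ} (hc : 0 < c) :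
    Integrable (fun z : Space d => Real.exp (-c * ‖z‖ ^ 2)) := by
  have h := (GaussianFourier.integrable_cexp_neg_mul_sq_norm_add (b := (c : ℂ)) (V := Space d)
    (by simpa using hc) 0 0).norm
  refine h.congr (ae_of_all _ fun z => ?_)
  simp only [zero_mul, add_zero, Complex.norm_exp]
  congr 1
  have : -(c : ℂ) * (‖z‖ : ℂ) ^ 2 = ((-c * ‖z‖ ^ 2 : ℝ) : ℂ) := by push_cast; ring
  rw [this, Complex.ofReal_re]

lemma integrable_gauss : Integrable (gauss (d := d)) :=
  integrable_exp_neg_mul_norm_sq (by norm_num)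

lemma integrable_norm_mul_gauss : Integrable (fun z : Space d => ‖z‖ * gauss z) := by
  refine ((integrable_exp_neg_mul_norm_sq (d := d) (c := 1 / 8) (by norm_num)).const_mul 2).mono'
    (continuous_norm.mul continuous_gauss).aestronglyMeasurable (ae_of_all _ fun z => ?_)
  rw [Real.norm_of_nonneg (mul_nonneg (norm_nonneg _) (gauss_pos z).le)]
  have h1 : ‖z‖ ≤ 2 * Real.exp (1 / 8 * ‖z‖ ^ 2) := by
    have := Real.add_one_le_exp (1 / 8 * ‖z‖ ^ 2)
    nlinarith [sq_nonneg (‖z‖ / 2 - 1)]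
  calc ‖z‖ * gauss z ≤ 2 * Real.exp (1 / 8 * ‖z‖ ^ 2) * gauss z := by
        gcongr; exact (gauss_pos z).le
    _ = 2 * Real.exp (-(1 / 8) * ‖z‖ ^ 2) := by
        rw [gauss, mul_assoc, ← Real.exp_add]; congr 2; ring

lemma integral_gauss_pos : 0 < ∫ z : Space d, gauss z :=
  (integral_pos_iff_support_of_nonneg (fun z => (gauss_pos z).le) integrable_gauss).2 (by
    have : Function.support (gauss (d := d)) = univ :=
      eq_univ_of_forall fun z => (gauss_pos z).ne'
    rw [this]
    exact isOpen_univ.measure_pos volume univ_nonempty)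

lemma integrable_gauss_mul {f : Space d → ℝ} (hf : Continuous f) {B : ℝ} (hB : ∀ z, |f z| ≤ B) :
    Integrable (fun z => gauss z * f z) := by
  refine (integrable_gauss.mul_const B).mono' (continuous_gauss.mul hf).aestronglyMeasurable
    (ae_of_all _ fun z => ?_)
  rw [norm_mul, Real.norm_of_nonneg (gauss_pos z).le]
  exact mul_le_mul_of_nonneg_left (hB z) (gauss_pos z).le

lemma hasFDerivAt_gauss (z : Space d) :
    HasFDerivAt (gauss (d := d)) ((-(1 / 2) * gauss z) • innerSL ℝ z) z := by
  have h1 := ((hasStrictFDerivAt_norm_sq z).hasFDerivAt.const_mul (-(1 / 4 : ℝ))).exp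
  refine h1.congr_fderiv ?_
  ext v
  simp [gauss, two_smul]
  ring

/-- Gaussian integration by parts. -/
lemma integral_gauss_inner_gradient {v : Space d → ℝ} (hv : ContDiff ℝ ∞ v) (hper : IsPeriodic v)
    (x₀ : Space d) (σ : ℝ) :
    ∫ z, gauss z * ⟪gradient v (x₀ + σ • z), z⟫_ℝ
      = 2 * σ * ∫ z, gauss z * Laplacian.laplacian v (x₀ + σ • z) := by
  have hgv := contDiff_gradient hv
  have hgp : IsPeriodic (gradient v) := hper.gradient
  obtain ⟨B₁, hB₁0, hB₁⟩ := hgp.exists_norm_le hgv.continuous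
  have hfg : Continuous (fderiv ℝ (gradient v)) := hgv.continuous_fderiv (by simp)
  have hfgp : IsPeriodic (fderiv ℝ (gradient v)) := hgp.fderiv
  obtain ⟨B₂, hB₂0, hB₂⟩ := hfgp.exists_norm_le hfg
  set g : Fin d → Space d → ℝ := fun i z => gradient v (x₀ + σ • z) i with hg
  have hgd : ∀ i z, HasFDerivAt (g i) ((EuclideanSpace.proj i : Space d →L[ℝ] ℝ).comp
      ((fderiv ℝ (gradient v) (x₀ + σ • z)).comp (σ • ContinuousLinearMap.id ℝ (Space d)))) z := by
    intro i z
    have h1 : HasFDerivAt (fun z : Space d => x₀ + σ • z)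
        (σ • ContinuousLinearMap.id ℝ (Space d)) z :=
      ((hasFDerivAt_id z).const_smul σ).const_add x₀
    have h2 : HasFDerivAt (gradient v) _ (x₀ + σ • z) :=
      (hgv.differentiable (by simp) _).hasFDerivAt
    exact (EuclideanSpace.proj (𝕜 := ℝ) i : Space d →L[ℝ] ℝ).hasFDerivAt.comp z
      (HasFDerivAt.comp (f := fun z : Space d => x₀ + σ • z) z h2 h1)
  have hgc : ∀ i, Continuous (g i) := fun i =>
    continuous_iff_continuousAt.2 fun z => (hgd i z).continuousAt
  have hgb : ∀ i z, |g i z| ≤ B₁ := fun i z =>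
    (PiLp.norm_apply_le _ i).trans (hB₁ _)
  set q : Fin d → Space d → ℝ := fun i z =>
    fderiv ℝ (gradient v) (x₀ + σ • z) (EuclideanSpace.single i 1) i with hq
  have hqc : ∀ i, Continuous (q i) := fun i => by
    have : Continuous fun z : Space d =>
        fderiv ℝ (gradient v) (x₀ + σ • z) (EuclideanSpace.single i 1) := by fun_prop
    exact (EuclideanSpace.proj (𝕜 := ℝ) i : Space d →L[ℝ] ℝ).continuous.comp this
  have hqb : ∀ i z, |q i z| ≤ B₂ := fun i z => by
    have h1 := (fderiv ℝ (gradient v) (x₀ + σ • z)).le_opNorm (EuclideanSpace.single i 1)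
    rw [PiLp.norm_single, norm_one, mul_one] at h1
    exact (PiLp.norm_apply_le _ i).trans (h1.trans (hB₂ _))
  have hgq : ∀ i z, fderiv ℝ (g i) z (EuclideanSpace.single i 1) = σ * q i z := fun i z => by
    rw [(hgd i z).fderiv]
    simp [hq]
  have hzi : ∀ i, Integrable (fun z : Space d => gauss z * (z i * g i z)) := fun i => by
    refine (integrable_norm_mul_gauss.mul_const B₁).mono'
      ((continuous_gauss.mul ((EuclideanSpace.proj (𝕜 := ℝ) i : Space d →L[ℝ] ℝ).continuous.mul
        (hgc i))).aestronglyMeasurable) (ae_of_all _ fun z => ?_)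
    have h1 : |z i| ≤ ‖z‖ := PiLp.norm_apply_le z i
    rw [Real.norm_eq_abs, abs_mul, abs_mul, abs_of_pos (gauss_pos z)]
    have := gauss_pos z
    calc gauss z * (|z i| * |g i z|) ≤ gauss z * (‖z‖ * B₁) := by
          gcongr
          exact hgb i z
      _ = _ := by ring
  have hqi : ∀ i, Integrable (fun z : Space d => gauss z * q i z) := fun i =>
    integrable_gauss_mul (hqc i) (hqb i)
  have hcomp : ∀ i, ∫ z, gauss z * (z i * g i z) = 2 * σ * ∫ z, gauss z * q i z := by
    intro i
    have hder : ∀ z : Space d, fderiv ℝ gauss z (EuclideanSpace.single i 1)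
        = -(1 / 2) * gauss z * z i := fun z => by
      rw [(hasFDerivAt_gauss z).fderiv]
      simp [EuclideanSpace.inner_single_right]
    have key := integral_mul_fderiv_eq_neg_fderiv_mul_of_integrable (μ := volume)
      (f := gauss (d := d)) (g := g i) (v := EuclideanSpace.single i 1)
      (by
        refine ((hzi i).const_mul (-(1 / 2))).congr (ae_of_all _ fun z => ?_)
        simp only [hder]; ring)
      (by
        refine ((hqi i).const_mul σ).congr (ae_of_all _ fun z => ?_)
        simp only [hgq]; ring)
      (integrable_gauss_mul (hgc i) (hgb i))
      (fun z _ => (hasFDerivAt_gauss z).differentiableAt)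
      (fun z _ => (hgd i z).differentiableAt)
    have e1 : ∀ z : Space d, gauss z * (fderiv ℝ (g i) z) (EuclideanSpace.single i 1)
        = σ * (gauss z * q i z) := fun z => by rw [hgq]; ring
    have e2 : ∀ z : Space d, (fderiv ℝ gauss z) (EuclideanSpace.single i 1) * g i z
        = (-(1 / 2)) * (gauss z * (z i * g i z)) := fun z => by rw [hder]; ring
    simp only [e1, e2, integral_const_mul] at key
    linarith
  have e1 : ∀ z, gauss z * ⟪gradient v (x₀ + σ • z), z⟫_ℝ
      = ∑ i, gauss z * (z i * g i z) := fun z => by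
    rw [inner_eq_sum, Finset.mul_sum]
    refine Finset.sum_congr rfl fun i _ => ?_
    simp only [hg]; ring
  have e2 : ∀ z, gauss z * Laplacian.laplacian v (x₀ + σ • z)
      = ∑ i, gauss z * q i z := fun z => by
    rw [laplacian_eq_divergence hv, divergence, Finset.mul_sum]
  simp only [e1, e2]
  rw [integral_finsetSum _ fun i _ => hzi i, integral_finsetSum _ fun i _ => hqi i, Finset.mul_sum]
  exact Finset.sum_congr rfl fun i _ => hcomp i

/-- Gaussian averages at scale `σ` of a periodic function are bounded by `σ^(-d)` times its
integral over the cell. -/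
lemma exists_gauss_average_le {R : ℝ} (hR : 0 < R) :
    ∃ C : ℝ, 0 < C ∧ ∀ σ : ℝ, 0 < σ → σ ≤ R → ∀ g : Space d → ℝ, Continuous g → IsPeriodic g →
      (∀ x, 0 ≤ g x) → ∀ x₀ : Space d,
      ∫ z, gauss z * g (x₀ + σ • z) ≤ C * (σ ^ d)⁻¹ * cellIntegral g := by
  set c := 1 / (8 * R ^ 2) with hc
  have hc0 : 0 < c := by positivity
  set E := Real.exp (2 * c * d) with hE
  set Q : Space d → ℝ := fun y => E * Real.exp (-c * ‖y‖ ^ 2) with hQ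
  have hQc : Continuous Q := by fun_prop
  have hQi : Integrable Q := (integrable_exp_neg_mul_norm_sq hc0).const_mul E
  have hQ0 : ∀ y, 0 < Q y := fun y => by positivity
  refine ⟨(∫ y, Q y) + 1, by
    have : 0 ≤ ∫ y, Q y := integral_nonneg fun y => (hQ0 y).le
    linarith, fun σ hσ hσR g hg hper hg0 x₀ => ?_⟩
  obtain ⟨B, hB0, hB⟩ := hper.exists_norm_le hg
  have hgx : IsPeriodic (fun y => g (x₀ + y)) := fun k x => by
    have := hper k (x₀ + x)
    simpa [add_assoc] using this
  have hgxc : Continuous (fun y => g (x₀ + y)) := by fun_prop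
  -- rescaling
  have h1 : ∫ z, gauss z * g (x₀ + σ • z)
      = (σ ^ d)⁻¹ * ∫ y, gauss (σ⁻¹ • y) * g (x₀ + y) := by
    have := Measure.integral_comp_smul (volume : Measure (Space d))
      (fun y => gauss (σ⁻¹ • y) * g (x₀ + y)) σ
    simp only [inv_smul_smul₀ hσ.ne', finrank_euclideanSpace, Fintype.card_fin, smul_eq_mul] at this
    rw [this, abs_of_pos (by positivity)]
  have hk : ∀ (w y : Space d), w ∈ cell d → gauss (σ⁻¹ • y) ≤ Q (y - w) := by
    intro w y hw
    rw [hQ, gauss, hE]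
    simp only
    rw [← Real.exp_add, Real.exp_le_exp, norm_smul, mul_pow, Real.norm_of_nonneg (by positivity),
      inv_pow]
    have h2 : ‖y - w‖ ^ 2 ≤ 2 * ‖y‖ ^ 2 + 2 * d := by
      have h3 := norm_sub_le y w
      have h4 := norm_le_of_mem_cell hw
      have h5 : ‖y - w‖ ^ 2 ≤ (‖y‖ + ‖w‖) ^ 2 := by gcongr
      nlinarith [sq_nonneg (‖y‖ - ‖w‖)]
    have h6 : 2 * c ≤ 1 / 4 * (σ ^ 2)⁻¹ := by
      rw [hc]
      have : (R ^ 2)⁻¹ ≤ (σ ^ 2)⁻¹ := by gcongr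
      have e : 2 * (1 / (8 * R ^ 2)) = 1 / 4 * (R ^ 2)⁻¹ := by field_simp; norm_num
      rw [e]; gcongr
    have h7 := mul_le_mul_of_nonneg_left h2 hc0.le
    have h8 := mul_le_mul_of_nonneg_right h6 (sq_nonneg ‖y‖)
    linarith
  have hker := lintegral_mul_le_of_le_average
    (k := fun y => ENNReal.ofReal (gauss (σ⁻¹ • y))) (Q := fun y => ENNReal.ofReal (Q y))
    (g := fun y => ENNReal.ofReal (g (x₀ + y)))
    (by fun_prop) (ENNReal.continuous_ofReal.comp hgxc).measurable
    (fun k x => by have := hgx k x; simp only at this ⊢; rw [this])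
    (fun y => by
      calc ENNReal.ofReal (gauss (σ⁻¹ • y))
          = ∫⁻ _w in cell d, ENNReal.ofReal (gauss (σ⁻¹ • y)) := by
            simp
        _ ≤ _ := setLIntegral_mono' (measurableSet_cell d) fun w hw =>
            ENNReal.ofReal_le_ofReal (hk w y hw))
  have hcell : ∫⁻ y in cell d, ENNReal.ofReal (g (x₀ + y)) = ENNReal.ofReal (cellIntegral g) := by
    rw [ofReal_cellIntegral hg hg0]
    exact lintegral_cell_add (g := fun y => ENNReal.ofReal (g y))
      (fun k x => by have := hper k x; simp only [this]) x₀
  have hI0 : 0 ≤ cellIntegral g := cellIntegral_nonneg hg0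
  have hcs : Continuous (fun y : Space d => gauss (σ⁻¹ • y)) :=
    continuous_gauss.comp (by fun_prop)
  have hint : Integrable (fun y : Space d => gauss (σ⁻¹ • y) * g (x₀ + y)) := by
    have hi : Integrable (fun y : Space d => gauss (σ⁻¹ • y)) :=
      integrable_gauss.comp_smul (inv_ne_zero hσ.ne')
    refine (hi.mul_const B).mono' (hcs.mul hgxc).aestronglyMeasurable (ae_of_all _ fun z => ?_)
    rw [norm_mul, Real.norm_of_nonneg (gauss_pos _).le]
    exact mul_le_mul_of_nonneg_left (hB _) (gauss_pos _).le
  have h2 : ∫ y, gauss (σ⁻¹ • y) * g (x₀ + y) ≤ (∫ y, Q y) * cellIntegral g := by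
    have h0 : 0 ≤ ∫ y, Q y := integral_nonneg fun y => (hQ0 y).le
    rw [← ENNReal.ofReal_le_ofReal_iff (by positivity), ENNReal.ofReal_mul h0,
      ofReal_integral_eq_lintegral_ofReal hint
        (ae_of_all _ fun y => mul_nonneg (gauss_pos _).le (hg0 _)),
      ofReal_integral_eq_lintegral_ofReal hQi (ae_of_all _ fun y => (hQ0 y).le), ← hcell]
    refine le_trans (le_of_eq (lintegral_congr fun y => ?_)) hker
    rw [ENNReal.ofReal_mul (gauss_pos _).le]
  rw [h1]
  have h3 : (∫ y, Q y) * cellIntegral g ≤ ((∫ y, Q y) + 1) * cellIntegral g := by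
    gcongr; linarith
  calc (σ ^ d)⁻¹ * ∫ y, gauss (σ⁻¹ • y) * g (x₀ + y)
      ≤ (σ ^ d)⁻¹ * (((∫ y, Q y) + 1) * cellIntegral g) := by
        gcongr; exact h2.trans h3
    _ = _ := by ring

end Gaussian

/-! ### The value function is bounded from above -/

namespace Problem
variable {P : Constants} (S : Problem P)

lemma isPeriodic_fderiv_u {t : ℝ} (ht : t ∈ Ioo 0 S.T) (k : Fin P.d → ℤ) (x : Space P.d) :
    fderiv ℝ (fun z : Space P.d × ℝ => S.u z.1 z.2) (x + WithLp.toLp 2 (fun i => (k i : ℝ)), t)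
      = fderiv ℝ (fun z : Space P.d × ℝ => S.u z.1 z.2) (x, t) := by
  have h1 : (x + WithLp.toLp 2 (fun i => (k i : ℝ)), t)
      = (x, t) + ((WithLp.toLp 2 (fun i => (k i : ℝ)) : Space P.d), (0 : ℝ)) := by simp
  rw [h1, ← fderiv_comp_add_right]
  refine Filter.EventuallyEq.fderiv_eq ?_
  have h2 : ∀ᶠ z : Space P.d × ℝ in 𝓝 (x, t), z.2 ∈ Ioo 0 S.T :=
    continuous_snd.continuousAt.eventually (isOpen_Ioo.mem_nhds ht)
  filter_upwards [h2] with z hz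
  have := S.solution.periodic_u z.2 (Ioo_subset_Icc_self hz) k z.1
  simpa using this

/-- The average of `u(·,s)` against the heat kernel with pole `(x₀,t₀)`, up to normalization. -/
noncomputable def heatAverage (x₀ : Space P.d) (t₀ s : ℝ) : ℝ :=
  ∫ z, gauss z * S.u (x₀ + √(s - t₀) • z) s

lemma continuousOn_heatAverage (x₀ : Space P.d) {t₀ : ℝ} (ht₀ : 0 ≤ t₀) :
    ContinuousOn (S.heatAverage x₀ t₀) (Icc t₀ S.T) := by
  obtain ⟨B, hB0, hB⟩ := exists_norm_le_of_periodic S.solution.smooth_u.continuousOn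
    S.solution.periodic_u
  have hsub : Icc t₀ S.T ⊆ Icc 0 S.T := Icc_subset_Icc_left ht₀
  refine continuousOn_of_dominated (bound := fun z => gauss z * B) ?_ ?_
    (integrable_gauss.mul_const B) ?_
  · intro s hs
    have h1 : Continuous fun z : Space P.d => S.u (x₀ + √(s - t₀) • z) s :=
      (S.continuous_u (hsub hs)).comp (f := fun z : Space P.d => x₀ + √(s - t₀) • z)
        (by fun_prop)
    exact (continuous_gauss.mul h1).aestronglyMeasurable
  · intro s hs
    refine ae_of_all _ fun z => ?_
    rw [norm_mul, Real.norm_of_nonneg (gauss_pos z).le]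
    exact mul_le_mul_of_nonneg_left (hB _ s (hsub hs)) (gauss_pos z).le
  · refine ae_of_all _ fun z => continuousOn_const.mul ?_
    exact S.solution.smooth_u.continuousOn.comp
      (f := fun s : ℝ => (x₀ + √(s - t₀) • z, s)) (by fun_prop)
      (fun s hs => ⟨mem_univ _, hsub hs⟩)

/-- The derivative of the heat kernel average is the average of the heat operator. -/
lemma hasDerivAt_heatAverage (x₀ : Space P.d) {t₀ s : ℝ} (ht₀ : 0 ≤ t₀) (hs : s ∈ Ioo t₀ S.T) :
    HasDerivAt (S.heatAverage x₀ t₀)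
      (∫ z, gauss z * (deriv (S.u (x₀ + √(s - t₀) • z)) s
        + Laplacian.laplacian (fun y => S.u y s) (x₀ + √(s - t₀) • z))) s := by
  have hu := S.solution.smoothOnStrip_u
  have hs0 : s ∈ Ioo 0 S.T := ⟨ht₀.trans_lt hs.1, hs.2⟩
  have hsc : s ∈ Icc 0 S.T := Ioo_subset_Icc_self hs0
  set U : Space P.d × ℝ → ℝ := fun z => S.u z.1 z.2 with hU
  -- a compact time interval around `s`
  obtain ⟨l, hl1, hl2⟩ := exists_between hs.1
  obtain ⟨r, hr1, hr2⟩ := exists_between hs.2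
  have hlr : Icc l r ⊆ Ioo 0 S.T := fun τ hτ =>
    ⟨ht₀.trans_lt (hl1.trans_le hτ.1), hτ.2.trans_lt hr2⟩
  obtain ⟨B, hB0, hB⟩ := exists_norm_le_of_periodic (f := fun x τ => fderiv ℝ U (x, τ))
    (hu.continuousOn_fderiv.mono (prod_mono le_rfl hlr))
    (fun τ hτ k x => S.isPeriodic_fderiv_u (hlr hτ) k x)
  set F' : ℝ → Space P.d → ℝ := fun τ z => gauss z *
    fderiv ℝ U (x₀ + √(τ - t₀) • z, τ) ((1 / (2 * √(τ - t₀))) • z, 1) with hF'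
  have hF'c : Continuous (F' s) := by
    refine continuous_gauss.mul (Continuous.clm_apply ?_ (by fun_prop))
    rw [← continuousOn_univ]
    exact hu.continuousOn_fderiv.comp (f := fun z : Space P.d => (x₀ + √(s - t₀) • z, s))
      (by fun_prop) (fun z _ => ⟨mem_univ _, hs0⟩)
  have hcont : ∀ τ ∈ Ioo 0 S.T,
      Continuous fun z : Space P.d => gauss z * S.u (x₀ + √(τ - t₀) • z) τ := fun τ hτ =>
    continuous_gauss.mul ((S.continuous_u (Ioo_subset_Icc_self hτ)).comp
      (f := fun z : Space P.d => x₀ + √(τ - t₀) • z) (by fun_prop))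
  have hsq : ∀ τ ∈ Icc l r, 0 < √(τ - t₀) := fun τ hτ =>
    Real.sqrt_pos.2 (by linarith [hτ.1])
  have hpath : ∀ z : Space P.d, ∀ τ ∈ Icc l r, HasDerivAt
      (fun τ => (x₀ + √(τ - t₀) • z, τ)) ((1 / (2 * √(τ - t₀))) • z, (1 : ℝ)) τ := by
    intro z τ hτ
    have h1 : HasDerivAt (fun τ => √(τ - t₀)) (1 / (2 * √(τ - t₀))) τ :=
      ((hasDerivAt_id τ).sub_const t₀).sqrt (by simpa using (by linarith [hτ.1] : τ - t₀ ≠ 0))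
    exact ((h1.smul_const z).const_add x₀).prodMk (hasDerivAt_id τ)
  obtain ⟨Bu, hBu0, hBu⟩ := exists_norm_le_of_periodic S.solution.smooth_u.continuousOn
    S.solution.periodic_u
  have key := hasDerivAt_integral_of_dominated_loc_of_deriv_le (μ := volume)
    (F := fun τ z => gauss z * S.u (x₀ + √(τ - t₀) • z) τ) (F' := F')
    (bound := fun z => (B * (1 / (2 * √(l - t₀)))) * (‖z‖ * gauss z) + B * gauss z)
    (Icc_mem_nhds hl2 hr1)
    (by filter_upwards [isOpen_Ioo.mem_nhds hs0] with τ hτ using (hcont τ hτ).aestronglyMeasurable)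
    (integrable_gauss_mul ((S.continuous_u hsc).comp
      (f := fun z : Space P.d => x₀ + √(s - t₀) • z) (by fun_prop)) (fun z => hBu _ s hsc))
    hF'c.aestronglyMeasurable
    (ae_of_all _ fun z τ hτ => by
      have h1 := hB (x₀ + √(τ - t₀) • z) τ hτ
      have h2 := (fderiv ℝ U (x₀ + √(τ - t₀) • z, τ)).le_opNorm
        ((1 / (2 * √(τ - t₀))) • z, (1 : ℝ))
      have h3 : ‖((1 / (2 * √(τ - t₀))) • z, (1 : ℝ))‖ ≤ 1 / (2 * √(l - t₀)) * ‖z‖ + 1 := by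
        have h4 : 1 / (2 * √(τ - t₀)) ≤ 1 / (2 * √(l - t₀)) := by
          have := hsq l ⟨le_rfl, (hl2.trans hr1).le⟩
          have : √(l - t₀) ≤ √(τ - t₀) := Real.sqrt_le_sqrt (by linarith [hτ.1])
          gcongr
        have h5 : 0 ≤ 1 / (2 * √(τ - t₀)) := by positivity
        have h6 : 0 ≤ 1 / (2 * √(l - t₀)) * ‖z‖ := by positivity
        refine norm_prod_le_iff.2 ⟨?_, ?_⟩
        · rw [norm_smul, Real.norm_of_nonneg h5]
          nlinarith [mul_le_mul_of_nonneg_right h4 (norm_nonneg z)]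
        · rw [norm_one]; linarith
      rw [hF', norm_mul, Real.norm_of_nonneg (gauss_pos z).le]
      have hg := gauss_pos z
      calc gauss z * ‖fderiv ℝ U (x₀ + √(τ - t₀) • z, τ) ((1 / (2 * √(τ - t₀))) • z, 1)‖
          ≤ gauss z * (B * (1 / (2 * √(l - t₀)) * ‖z‖ + 1)) := by
            gcongr
            exact h2.trans (mul_le_mul h1 h3 (norm_nonneg _) hB0)
        _ = _ := by ring)
    ((integrable_norm_mul_gauss.const_mul _).add (integrable_gauss.const_mul _))
    (ae_of_all _ fun z τ hτ => by
      have h1 := HasFDerivAt.comp_hasDerivAt (f := fun τ => (x₀ + √(τ - t₀) • z, τ)) τ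
        (hu.hasFDerivAt (x := x₀ + √(τ - t₀) • z) (hlr hτ)) (hpath z τ hτ)
      exact h1.const_mul (gauss z))
  refine key.2.congr_deriv ?_
  -- integration by parts turns the radial derivative into the Laplacian
  set σ := √(s - t₀) with hσ
  have hσ0 : 0 < σ := hsq s ⟨hl2.le, hr1.le⟩
  have hus := S.contDiff_u hsc
  have hup := S.solution.periodic_u s hsc
  have hIBP := integral_gauss_inner_gradient hus hup x₀ σ
  obtain ⟨B₁, -, hB₁⟩ := IsPeriodic.exists_norm_le
    (f := fun y => Laplacian.laplacian (fun y => S.u y s) y)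
    (by
      intro k x
      simp only [laplacian_eq_divergence hus, divergence]
      rw [hup.gradient.fderiv k x]) (continuous_laplacian hus)
  have hcd : Continuous fun z : Space P.d => deriv (S.u (x₀ + σ • z)) s :=
    (hu.continuous_deriv_slice hs0).comp (f := fun z : Space P.d => x₀ + σ • z) (by fun_prop)
  have hdb : ∀ z : Space P.d, |deriv (S.u (x₀ + σ • z)) s| ≤ B := fun z => by
    rw [(hu.hasDerivAt hs0).deriv]
    refine ((fderiv ℝ U (x₀ + σ • z, s)).le_opNorm (0, 1)).trans ?_
    have h1 := hB (x₀ + σ • z) s ⟨hl2.le, hr1.le⟩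
    have h2 : ‖((0 : Space P.d), (1 : ℝ))‖ ≤ 1 := norm_prod_le_iff.2 ⟨by simp, by simp⟩
    calc _ ≤ B * 1 := mul_le_mul h1 h2 (norm_nonneg _) hB0
      _ = B := mul_one B
  have hi1 : Integrable (fun z : Space P.d => gauss z * deriv (S.u (x₀ + σ • z)) s) :=
    integrable_gauss_mul hcd hdb
  have hi2 : Integrable (fun z : Space P.d =>
      gauss z * Laplacian.laplacian (fun y => S.u y s) (x₀ + σ • z)) :=
    integrable_gauss_mul ((continuous_laplacian hus).comp (by fun_prop)) (fun z => hB₁ _)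
  have hsplit : ∀ z : Space P.d, F' s z = gauss z * deriv (S.u (x₀ + σ • z)) s
      + 1 / (2 * σ) * (gauss z * ⟪gradient (fun y => S.u y s) (x₀ + σ • z), z⟫_ℝ) := by
    intro z
    have e1 : (((1 / (2 * σ)) • z, (1 : ℝ)) : Space P.d × ℝ)
        = (0, 1) + (1 / (2 * σ)) • (z, (0 : ℝ)) := by simp
    rw [hF']
    simp only
    rw [← hσ, e1, map_add, map_smul, ← hu.fderiv_slice hs0, (hu.hasDerivAt hs0).deriv,
      inner_gradient, smul_eq_mul]
    ring
  have hi3 : Integrable (fun z : Space P.d =>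
      gauss z * ⟪gradient (fun y => S.u y s) (x₀ + σ • z), z⟫_ℝ) := by
    have h1 : Integrable (fun z => (2 * σ) * (F' s z - gauss z * deriv (S.u (x₀ + σ • z)) s)) :=
      (key.1.sub hi1).const_mul _
    refine h1.congr (ae_of_all _ fun z => ?_)
    simp only [hsplit z]
    field_simp
    ring
  simp only [hsplit, mul_add]
  rw [integral_add hi1 (hi3.const_mul _), integral_add hi1 hi2, integral_const_mul, hIBP]
  field_simp

lemma neg_le_heat_operator (x : Space P.d) {t : ℝ} (ht : t ∈ Ioo 0 S.T) :
    -(P.cH * S.m x t ^ P.α + P.K)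
      ≤ deriv (S.u x) t + Laplacian.laplacian (fun y => S.u y t) x := by
  have htc := Ioo_subset_Icc_self ht
  have h1 := S.solution.hamilton_jacobi x t ht
  have h2 := mul_le_mul_of_nonneg_left (S.neg_cH_le x htc)
    (Real.rpow_pos_of_pos (S.m_pos x htc) P.α).le
  have h3 := (abs_le.1 (S.abs_V_le x t)).2
  rw [S.gradient_u_eq htc, inner_smul_right] at h1
  change -deriv (S.u x) t - _ + S.m x t ^ P.α * hamiltonian S.L x (S.p x t) + _ = _ at h1
  linarith

end Problem

/-- The scaling exponent of the heat kernel average of `m^α`. -/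
noncomputable def Constants.β (P : Constants) : ℝ := P.d * P.α / (2 * (1 + P.α))

lemma Constants.β_nonneg (P : Constants) : 0 ≤ P.β := by
  have := P.α_nonneg
  unfold Constants.β
  positivity

/-- The growth condition on `α` says that the heat kernel average of `m^α` is integrable in
time. -/
lemma Constants.β_lt_one (P : Constants) : P.β < 1 := by
  have hα := P.α_nonneg
  unfold Constants.β
  rw [div_lt_one (by positivity)]
  rcases le_or_gt P.d 2 with h | h
  · have : (P.d : ℝ) ≤ 2 := by exact_mod_cast h
    nlinarith
  · have h1 := P.α_lt h
    have h2 : (0 : ℝ) < P.d - 2 := by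
      have : (2 : ℝ) < P.d := by exact_mod_cast h
      linarith
    rw [lt_div_iff₀ h2] at h1
    linarith

/-- Heat kernel averages of `m^α`: the function is split at the level `σ^(-d/(1+α))`. -/
lemma exists_gauss_average_rpow_le (P : Constants) :
    ∃ C : ℝ, 0 < C ∧ ∀ S : Problem P, ∀ t ∈ Icc 0 S.T, ∀ x₀ : Space P.d, ∀ τ : ℝ, 0 < τ →
      τ ≤ P.Tmax → ∫ z, gauss z * S.m (x₀ + √τ • z) t ^ P.α ≤ C * τ ^ (-P.β) := by
  obtain ⟨M, hM0, hM⟩ := exists_energy_bound P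
  have hR : 0 < √P.Tmax := Real.sqrt_pos.2 P.Tmax_pos
  obtain ⟨C, hC, hav⟩ := exists_gauss_average_le (d := P.d) hR
  have hI := integral_gauss_pos (d := P.d)
  have hα := P.α_nonneg
  refine ⟨(∫ z : Space P.d, gauss z) + C * M, by positivity, fun S t ht x₀ τ hτ hτT => ?_⟩
  set σ := √τ with hσ
  have hσ0 : 0 < σ := Real.sqrt_pos.2 hτ
  have hστ : τ = σ ^ (2 : ℝ) := by
    rw [hσ, Real.rpow_two, Real.sq_sqrt hτ.le]
  set A := σ ^ (-(P.d / (1 + P.α))) with hA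
  have hA0 : 0 < A := Real.rpow_pos_of_pos hσ0 _
  have hAα : A ^ P.α = τ ^ (-P.β) := by
    rw [hA, hστ, ← Real.rpow_mul hσ0.le, ← Real.rpow_mul hσ0.le]
    congr 1
    unfold Constants.β
    field_simp
  have hAinv : (σ ^ P.d)⁻¹ / A = τ ^ (-P.β) := by
    rw [hA, hστ, ← Real.rpow_natCast, ← Real.rpow_neg hσ0.le, ← Real.rpow_sub hσ0,
      ← Real.rpow_mul hσ0.le]
    congr 1
    unfold Constants.β
    field_simp
    ring
  have hcp := S.continuous_rpow ht P.α
  have hcp1 := S.continuous_rpow ht (1 + P.α)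
  have hper : ∀ q : ℝ, IsPeriodic (fun x => S.m x t ^ q) := fun q k x => by
    have := S.solution.periodic_m t ht k x
    simp only at this ⊢
    rw [this]
  have haff : Continuous fun z : Space P.d => x₀ + σ • z := by fun_prop
  have hint : ∀ q : ℝ, Integrable (fun z : Space P.d => gauss z * S.m (x₀ + σ • z) t ^ q) :=
    fun q => by
      obtain ⟨B, -, hB⟩ := (hper q).exists_norm_le (S.continuous_rpow ht q)
      exact integrable_gauss_mul ((S.continuous_rpow ht q).comp haff) (fun z => hB _)
  have h1 : ∫ z, gauss z * S.m (x₀ + σ • z) t ^ P.α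
      ≤ ∫ z, (gauss z * A ^ P.α + A⁻¹ * (gauss z * S.m (x₀ + σ • z) t ^ (1 + P.α))) := by
    refine integral_mono (hint _) ((integrable_gauss.mul_const _).add ((hint _).const_mul _))
      fun z => ?_
    have h2 := mul_le_mul_of_nonneg_left
      (rpow_le_add_div (S.m_pos (x₀ + σ • z) ht) hα hA0) (gauss_pos z).le
    simp only
    rw [mul_add, div_eq_inv_mul] at h2
    linarith
  rw [integral_add (integrable_gauss.mul_const _) ((hint _).const_mul _), integral_mul_const,
    integral_const_mul] at h1
  have h2 := hav σ hσ0 (Real.sqrt_le_sqrt hτT) (fun x => S.m x t ^ (1 + P.α)) hcp1 (hper _)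
    (fun x => (Real.rpow_pos_of_pos (S.m_pos x ht) _).le) x₀
  have h3 : A⁻¹ * ∫ z, gauss z * S.m (x₀ + σ • z) t ^ (1 + P.α) ≤ C * M * τ ^ (-P.β) := by
    calc _ ≤ A⁻¹ * (C * (σ ^ P.d)⁻¹ * M) := by
          gcongr
          refine h2.trans ?_
          gcongr
          exact hM S t ht
      _ = C * M * ((σ ^ P.d)⁻¹ / A) := by ring
      _ = _ := by rw [hAinv]
  rw [hAα] at h1
  linarith

/-- The upper bound of `u`, by Duhamel's formula for the heat kernel. -/
lemma exists_u_upper (P : Constants) :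
    ∃ C : ℝ, 0 < C ∧ ∀ S : Problem P, ∀ x, ∀ t ∈ Icc 0 S.T, S.u x t ≤ C := by
  obtain ⟨C₁, hC₁, hav⟩ := exists_gauss_average_rpow_le P
  have hI := integral_gauss_pos (d := P.d)
  set I := ∫ z : Space P.d, gauss z with hIdef
  have hβ0 := P.β_nonneg
  have hβ1 := P.β_lt_one
  have hβ2 : 0 < 1 - P.β := by linarith
  have hcH := P.cH_pos
  have hK := P.K_nonneg
  have hT := P.Tmax_pos
  set a := P.K * I with ha
  set c := P.cH * C₁ with hc
  have ha0 : 0 ≤ a := by positivity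
  have hc0 : 0 < c := by positivity
  refine ⟨P.K + (a * P.Tmax + c / (1 - P.β) * P.Tmax ^ (1 - P.β)) / I + 1, by positivity,
    fun S x₀ t₀ ht₀ => ?_⟩
  set Φ : ℝ → ℝ := fun s => S.heatAverage x₀ t₀ s
    + (a * (s - t₀) + c / (1 - P.β) * (s - t₀) ^ (1 - P.β)) with hΦ
  have hderiv : ∀ s ∈ Ioo t₀ S.T, ∃ D, 0 ≤ D ∧ HasDerivAt Φ D s := by
    intro s hs
    have hτ : 0 < s - t₀ := by linarith [hs.1]
    have hs0 : s ∈ Ioo 0 S.T := ⟨ht₀.1.trans_lt hs.1, hs.2⟩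
    have hsc := Ioo_subset_Icc_self hs0
    have h1 := S.hasDerivAt_heatAverage x₀ ht₀.1 hs
    have h2 : HasDerivAt (fun s => s - t₀) 1 s := (hasDerivAt_id s).sub_const t₀
    have h3 := (h2.const_mul a).add ((h2.rpow_const (p := 1 - P.β) (Or.inl hτ.ne')).const_mul
      (c / (1 - P.β)))
    refine ⟨_, ?_, h1.add h3⟩
    have h4 := hav S s hsc x₀ (s - t₀) hτ (by linarith [hs.2, ht₀.1, S.T_le])
    set σ := √(s - t₀) with hσ
    have haff : Continuous fun z : Space P.d => x₀ + σ • z := by fun_prop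
    have hus := S.contDiff_u hsc
    have hcα := (S.continuous_rpow hsc P.α).comp haff
    have hper : IsPeriodic (fun x => S.m x s ^ P.α) := fun k x => by
      have := S.solution.periodic_m s hsc k x
      simp only at this ⊢
      rw [this]
    obtain ⟨B, -, hB⟩ := hper.exists_norm_le (S.continuous_rpow hsc P.α)
    have hi1 : Integrable (fun z : Space P.d => gauss z * S.m (x₀ + σ • z) s ^ P.α) :=
      integrable_gauss_mul hcα (fun z => hB _)
    have hcop : Continuous (fun x => deriv (S.u x) s
        + Laplacian.laplacian (fun y => S.u y s) x) :=
      (S.solution.smoothOnStrip_u.continuous_deriv_slice hs0).add (continuous_laplacian hus)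
    have hpop : IsPeriodic (fun x => deriv (S.u x) s
        + Laplacian.laplacian (fun y => S.u y s) x) := by
      intro k x
      have e1 := S.isPeriodic_fderiv_u hs0 k x
      have e2 := (S.solution.periodic_u s hsc).gradient.fderiv k x
      simp only [laplacian_eq_divergence hus, divergence]
      rw [(S.solution.smoothOnStrip_u.hasDerivAt hs0).deriv,
        (S.solution.smoothOnStrip_u.hasDerivAt hs0).deriv, e1, e2]
    obtain ⟨B', -, hB'⟩ := hpop.exists_norm_le hcop
    have hi2 : Integrable (fun z : Space P.d => gauss z * (deriv (S.u (x₀ + σ • z)) s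
        + Laplacian.laplacian (fun y => S.u y s) (x₀ + σ • z))) :=
      integrable_gauss_mul (f := fun z => deriv (S.u (x₀ + σ • z)) s
        + Laplacian.laplacian (fun y => S.u y s) (x₀ + σ • z)) (hcop.comp haff)
        (fun z => hB' _)
    have h5 : ∫ z : Space P.d, ((-P.cH) * (gauss z * S.m (x₀ + σ • z) s ^ P.α) - gauss z * P.K)
        ≤ ∫ z, gauss z * (deriv (S.u (x₀ + σ • z)) s
        + Laplacian.laplacian (fun y => S.u y s) (x₀ + σ • z)) := by
      refine integral_mono ((hi1.const_mul _).sub (integrable_gauss.mul_const _)) hi2 fun z => ?_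
      have := mul_le_mul_of_nonneg_left (S.neg_le_heat_operator (x₀ + σ • z) hs0) (gauss_pos z).le
      simp only
      linarith
    rw [integral_sub (hi1.const_mul _) (integrable_gauss.mul_const _), integral_const_mul,
      integral_mul_const, ← hIdef] at h5
    have h6 := mul_le_mul_of_nonneg_left h4 hcH.le
    have h7 : c / (1 - P.β) * (1 * (1 - P.β) * (s - t₀) ^ (1 - P.β - 1))
        = c * (s - t₀) ^ (-P.β) := by
      have : 1 - P.β - 1 = -P.β := by ring
      rw [this]
      field_simp
    rw [h7, hc, ha]
    linarith
  have hmono : MonotoneOn Φ (Icc t₀ S.T) := by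
    refine monotoneOn_of_deriv_nonneg (convex_Icc _ _) ?_ ?_ ?_
    · refine (S.continuousOn_heatAverage x₀ ht₀.1).add (Continuous.continuousOn ?_)
      have : Continuous fun s : ℝ => (s - t₀) ^ (1 - P.β) :=
        (continuous_id.sub continuous_const).rpow_const fun _ => Or.inr hβ2.le
      fun_prop
    · rw [interior_Icc]
      intro s hs
      obtain ⟨D, -, hD⟩ := hderiv s hs
      exact hD.differentiableAt.differentiableWithinAt
    · rw [interior_Icc]
      intro s hs
      obtain ⟨D, hD0, hD⟩ := hderiv s hs
      rw [hD.deriv]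
      exact hD0
  have hle := hmono (left_mem_Icc.2 ht₀.2) (right_mem_Icc.2 ht₀.2) ht₀.2
  simp only [hΦ, sub_self, mul_zero, Real.zero_rpow hβ2.ne', add_zero] at hle
  have e0 : S.heatAverage x₀ t₀ t₀ = I * S.u x₀ t₀ := by
    simp [Problem.heatAverage, integral_mul_const, hIdef]
  have e1 : S.heatAverage x₀ t₀ S.T ≤ I * P.K := by
    rw [Problem.heatAverage, hIdef, ← integral_mul_const]
    simp only [S.solution.terminal]
    have hc : Continuous fun z : Space P.d => S.Ψ (x₀ + √(S.T - t₀) • z) :=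
      (continuousOn_univ.1 S.data.smooth_Ψ.1.continuousOn).comp (by fun_prop)
    refine integral_mono (integrable_gauss_mul hc fun z => S.data.bound_Ψ _)
      (integrable_gauss.mul_const _) fun z => ?_
    exact mul_le_mul_of_nonneg_left (abs_le.1 (S.data.bound_Ψ _)).2 (gauss_pos z).le
  have hτ0 : 0 ≤ S.T - t₀ := by linarith [ht₀.2]
  have hτ1 : S.T - t₀ ≤ P.Tmax := by linarith [ht₀.1, S.T_le]
  have e2 : a * (S.T - t₀) ≤ a * P.Tmax := by gcongr
  have e3 : c / (1 - P.β) * (S.T - t₀) ^ (1 - P.β)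
      ≤ c / (1 - P.β) * P.Tmax ^ (1 - P.β) := by gcongr
  rw [e0] at hle
  have e4 : I * S.u x₀ t₀
      ≤ I * (P.K + (a * P.Tmax + c / (1 - P.β) * P.Tmax ^ (1 - P.β)) / I) := by
    rw [mul_add, mul_div_cancel₀ _ hI.ne']
    linarith
  have := le_of_mul_le_mul_left e4 hI
  linarith

/-! ### Negative powers of the density -/

lemma rpow_neg_le_one_add {m s q : ℝ} (hm : 0 < m) (hs : 0 ≤ s) (hsq : s ≤ q) :
    m ^ (-s) ≤ 1 + m ^ (-q) := by
  have h0 : 0 < m ^ (-q) := Real.rpow_pos_of_pos hm _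
  rcases le_or_gt m 1 with h | h
  · have : m ^ (-s) ≤ m ^ (-q) := Real.rpow_le_rpow_of_exponent_ge hm h (by linarith)
    linarith
  · have : m ^ (-s) ≤ 1 := Real.rpow_le_one_of_one_le_of_nonpos h.le (by linarith)
    linarith

namespace Constants
variable (P : Constants)

/-- The ratio of the growth exponent of the squared drift to that of the Hamiltonian. -/
noncomputable def τ : ℝ := (2 * P.γ - 2) / P.γ

lemma τ_pos : 0 < P.τ := by
  have := P.one_lt_γ
  unfold τ
  exact div_pos (by linarith) (by linarith)

/-- The ratio is less than one because the Hamiltonian is subquadratic. -/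
lemma τ_lt_one : P.τ < 1 := by
  have h1 := P.one_lt_γ
  have h2 := P.γ_lt_two
  unfold τ
  rw [div_lt_one (by linarith)]
  linarith

/-- The loss of integrability of `1 / m` in the estimate of the drift. -/
noncomputable def κ : ℝ := P.α * P.τ * (1 / (1 - P.τ))

lemma κ_nonneg : 0 ≤ P.κ := by
  have h1 := P.τ_pos
  have h2 := P.τ_lt_one
  have h3 := P.α_nonneg
  have : 0 < 1 - P.τ := by linarith
  unfold κ
  positivity

/-- The squared drift is absorbed by the Hamiltonian up to a fixed negative power of the density. -/
lemma exists_drift_absorption {ε : ℝ} (hε : 0 < ε) :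
    ∃ C : ℝ, 0 < C ∧ ∀ m X : ℝ, 0 < m → 0 ≤ X →
      X ^ (2 * P.γ - 2) ≤ ε * (m ^ P.α * X ^ P.γ) + C * m ^ (-P.κ) := by
  obtain ⟨C, hC, h⟩ := exists_rpow_mul_le P.τ_pos P.τ_lt_one hε
  refine ⟨C, hC, fun m X hm hX => ?_⟩
  have hγ : 0 < P.γ := by linarith [P.one_lt_γ]
  have h1 := h (m ^ P.α * X ^ P.γ) (m ^ (-(P.α * P.τ))) (by positivity) (by positivity)
  have e1 : (m ^ P.α * X ^ P.γ) ^ P.τ * m ^ (-(P.α * P.τ)) = X ^ (2 * P.γ - 2) := by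
    have e2 : P.γ * P.τ = 2 * P.γ - 2 := by unfold τ; field_simp
    rw [Real.mul_rpow (by positivity) (by positivity), ← Real.rpow_mul hm.le,
      ← Real.rpow_mul hX, e2, mul_right_comm, ← Real.rpow_add hm]
    simp
  have e3 : (m ^ (-(P.α * P.τ))) ^ (1 / (1 - P.τ)) = m ^ (-P.κ) := by
    rw [← Real.rpow_mul hm.le]; congr 1; unfold κ; ring
  rwa [e1, e3] at h1

end Constants

namespace Problem
variable {P : Constants} (S : Problem P)

/-- Bound of the rate of `∫ (A - u) m^(-r)`. The Hamilton-Jacobi equation contributes the good term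
`m^(α-r) |p|^γ`, and the Fokker-Planck equation the dissipation. -/
lemma rate_neg_pow_le (x : Space P.d) {t : ℝ} (ht : t ∈ Icc 0 S.T) {A U r ε C q : ℝ}
    (hε : 0 ≤ ε) (hC : 0 ≤ C)
    (hdrift : ∀ m X : ℝ, 0 < m → 0 ≤ X →
      X ^ (2 * P.γ - 2) ≤ ε * (m ^ P.α * X ^ P.γ) + C * m ^ (-P.κ))
    (hr : 0 < r) (hrα : P.α ≤ r) (hrκ : r + P.κ ≤ q) (hu1 : 1 ≤ A - S.u x t)
    (hu2 : A - S.u x t ≤ U)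
    (hεr : 1 / 2 * (r * (r + 1)) * U * P.cD * ε ≤ r * P.c₃) :
    S.rate A (-1) (-r) t x
      ≤ -(1 / 2 * (r * (r + 1))) * (S.m x t ^ (-r - 2) * ‖S.Dm x t‖ ^ 2)
        + ((1 + r) * P.cH + r * P.C₃ + P.K + 1 / 2 * (r * (r + 1)) * U * P.cD * (1 + C))
          * (1 + S.m x t ^ (-q)) := by
  have hm := S.m_pos x ht
  have hα := P.α_nonneg
  have hκ := P.κ_nonneg
  have hK := P.K_nonneg
  have hcH := P.cH_pos
  have hcD := P.cD_pos
  have hC₃ := P.C₃_pos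
  have hU : 0 < U := by linarith
  set X := ‖S.p x t‖ with hX
  have hX0 : 0 ≤ X := norm_nonneg _
  set R := r * (r + 1) with hR
  have hR0 : 0 < R := by positivity
  have hmr : 0 < S.m x t ^ (-r) := Real.rpow_pos_of_pos hm _
  have hma : 0 < S.m x t ^ P.α := Real.rpow_pos_of_pos hm _
  have hG0 : 0 ≤ S.m x t ^ (-r - 2) * ‖S.Dm x t‖ ^ 2 := by
    have := Real.rpow_pos_of_pos hm (-r - 2); positivity
  -- powers of the density
  have e1 : S.m x t ^ (-r) * S.m x t ^ P.α ≤ 1 + S.m x t ^ (-q) := by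
    rw [← Real.rpow_add hm]
    have := rpow_neg_le_one_add hm (s := r - P.α) (q := q) (by linarith) (by linarith)
    rwa [neg_sub, sub_eq_neg_add] at this
  have e2 : S.m x t ^ (-r) ≤ 1 + S.m x t ^ (-q) :=
    rpow_neg_le_one_add hm hr.le (by linarith)
  have e3 : S.m x t ^ (-r) * S.m x t ^ (-P.κ) ≤ 1 + S.m x t ^ (-q) := by
    rw [← Real.rpow_add hm]
    have := rpow_neg_le_one_add hm (s := r + P.κ) (q := q) (by linarith) hrκ
    rwa [neg_add] at this
  -- the Hamiltonian terms
  have h1 : r * P.c₃ * X ^ P.γ - ((1 + r) * P.cH + r * P.C₃)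
      ≤ hamiltonian S.L x (S.p x t) + ⟪S.b x t, S.p x t⟫_ℝ
        - -r * (⟪S.p x t, S.D x t⟫_ℝ + ⟪S.b x t, S.p x t⟫_ℝ) := by
    have a1 := mul_le_mul_of_nonneg_left (S.neg_cH_le x ht) (by linarith : 0 ≤ 1 + r)
    have a2 := mul_le_mul_of_nonneg_left (S.coercive x t) hr.le
    rw [← hX] at a2
    linarith
  have h2 := mul_le_mul_of_nonneg_left h1 (mul_pos hmr hma).le
  -- the potential
  have h3 := mul_le_mul_of_nonneg_left (abs_le.1 (S.abs_V_le x t)).2 hmr.le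
  -- the diffusion and the drift
  have h4 : -(S.m x t ^ (-r - 2) * ‖S.Dm x t‖ ^ 2
        + S.m x t ^ (-r - 1) * ⟪S.Dm x t, S.D x t + S.b x t⟫_ℝ)
      ≤ -(1 / 2) * (S.m x t ^ (-r - 2) * ‖S.Dm x t‖ ^ 2)
        + 1 / 2 * (S.m x t ^ (-r)
          * (P.cD * (ε * (S.m x t ^ P.α * X ^ P.γ) + C * S.m x t ^ (-P.κ) + 1))) := by
    refine (S.neg_cross_le x ht (-r)).trans ?_
    have a1 := S.norm_drift_sq_le x ht
    have a2 := hdrift (S.m x t) X hm hX0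
    have a3 : ‖S.D x t + S.b x t‖ ^ 2
        ≤ P.cD * (ε * (S.m x t ^ P.α * X ^ P.γ) + C * S.m x t ^ (-P.κ) + 1) := by
      refine a1.trans ?_
      gcongr
    have a4 := mul_le_mul_of_nonneg_left a3 hmr.le
    linarith
  set J := P.cD * (ε * (S.m x t ^ P.α * X ^ P.γ) + C * S.m x t ^ (-P.κ) + 1) with hJ
  have hJ0 : 0 ≤ J := by
    have := Real.rpow_pos_of_pos hm (-P.κ)
    positivity
  have h5 : R * (A - S.u x t) * -(S.m x t ^ (-r - 2) * ‖S.Dm x t‖ ^ 2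
        + S.m x t ^ (-r - 1) * ⟪S.Dm x t, S.D x t + S.b x t⟫_ℝ)
      ≤ -(1 / 2 * R) * (S.m x t ^ (-r - 2) * ‖S.Dm x t‖ ^ 2)
        + 1 / 2 * R * U * (S.m x t ^ (-r) * J) := by
    have a1 := mul_le_mul_of_nonneg_left h4 (mul_nonneg hR0.le (by linarith : 0 ≤ A - S.u x t))
    have a2 : R * 1 * (S.m x t ^ (-r - 2) * ‖S.Dm x t‖ ^ 2)
        ≤ R * (A - S.u x t) * (S.m x t ^ (-r - 2) * ‖S.Dm x t‖ ^ 2) := by gcongr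
    have a3 : R * (A - S.u x t) * (S.m x t ^ (-r) * J) ≤ R * U * (S.m x t ^ (-r) * J) := by
      gcongr
    linarith
  set W := 1 / 2 * R * U * P.cD with hW
  have hW0 : 0 < W := by positivity
  have h6 : 1 / 2 * R * U * (S.m x t ^ (-r) * J)
      ≤ r * P.c₃ * (S.m x t ^ (-r) * S.m x t ^ P.α * X ^ P.γ)
        + W * (1 + C) * (1 + S.m x t ^ (-q)) := by
    have a0 : 0 ≤ S.m x t ^ (-r) * S.m x t ^ P.α * X ^ P.γ := by positivity
    have a1 : 1 / 2 * R * U * (S.m x t ^ (-r) * J)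
        = W * ε * (S.m x t ^ (-r) * S.m x t ^ P.α * X ^ P.γ)
          + W * C * (S.m x t ^ (-r) * S.m x t ^ (-P.κ)) + W * S.m x t ^ (-r) := by
      rw [hJ, hW]; ring
    have a2 := mul_le_mul_of_nonneg_right hεr a0
    have a3 := mul_le_mul_of_nonneg_left e3 (mul_nonneg hW0.le hC)
    have a4 := mul_le_mul_of_nonneg_left e2 hW0.le
    rw [a1]
    linarith
  have h7 := mul_le_mul_of_nonneg_left e1 (by positivity : 0 ≤ (1 + r) * P.cH + r * P.C₃)
  have h8 := mul_le_mul_of_nonneg_left e2 hK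
  rw [S.rate_eq ht]
  have e5 : -r * (-r - 1) = R := by rw [hR]; ring
  have e6 : A + -1 * S.u x t = A - S.u x t := by ring
  rw [e5, e6]
  linarith

end Problem

/-- If the rate of a function is bounded as long as the function does not exceed its initial bound
by more than one, then the function stays below that level for a short time. -/
lemma le_of_rate_bound {Y Y' : ℝ → ℝ} {T Y₀ B : ℝ} (hc : ContinuousOn Y (Icc 0 T))
    (hd : ∀ t ∈ Ioo 0 T, HasDerivAt Y (Y' t) t) (h0 : Y 0 ≤ Y₀) (hB : 0 < B)
    (hle : ∀ t ∈ Ioo 0 T, Y t ≤ Y₀ + 1 → Y' t ≤ B) {t : ℝ} (ht : t ∈ Icc 0 T) (htB : t < 1 / B) :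
    Y t ≤ Y₀ + 1 := by
  by_contra! hgt
  have hsub : Icc 0 t ⊆ Icc 0 T := Icc_subset_Icc_right ht.2
  have hcl : IsCompact (Icc 0 t ∩ Y ⁻¹' Ici (Y₀ + 1)) :=
    isCompact_Icc.of_isClosed_subset
      ((hc.mono hsub).preimage_isClosed_of_isClosed isClosed_Icc isClosed_Ici) inter_subset_left
  -- the first time at which the level is reached
  obtain ⟨s, ⟨hs, hYs⟩, hmin⟩ := hcl.exists_isLeast ⟨t, right_mem_Icc.2 ht.1, hgt.le⟩
  have hsT : Icc 0 s ⊆ Icc 0 T := Icc_subset_Icc_right (hs.2.trans ht.2)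
  have h1 := sub_le_of_hasDerivAt (hc.mono hsT)
    (fun τ hτ => hd τ ⟨hτ.1, hτ.2.trans_le (hs.2.trans ht.2)⟩) (C := B) (fun τ hτ => by
      refine hle τ ⟨hτ.1, hτ.2.trans_le (hs.2.trans ht.2)⟩ ?_
      by_contra! hlt
      exact absurd (hmin ⟨⟨hτ.1.le, hτ.2.le.trans hs.2⟩, hlt.le⟩) (not_le.2 hτ.2))
    (left_mem_Icc.2 hs.1) (right_mem_Icc.2 hs.1) hs.1
  have h2 : B * (s - 0) < 1 := by
    have := hs.2.trans_lt htB
    rw [lt_div_iff₀ hB] at this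
    linarith
  have h3 : Y₀ + 1 ≤ Y s := hYs
  linarith

/-- Short-time bound of the integrals of negative powers of the density. -/
lemma exists_negative_power_bound (P : Constants) :
    ∃ r₀ : ℝ, 0 < r₀ ∧ ∀ r : ℝ, r₀ ≤ r → ∃ t₁ : ℝ, 0 < t₁ ∧ ∃ C : ℝ, 0 < C ∧
      ∀ S : Problem P, ∀ t ∈ Icc 0 S.T, t < t₁ →
        cellIntegral (fun x => S.m x t ^ (-r)) ≤ C := by
  obtain ⟨U₁, hU₁, hup⟩ := exists_u_upper P
  obtain ⟨N, hN, hint⟩ := exists_negative_power_interpolation P.one_le_d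
  have hα := P.α_nonneg
  have hκ := P.κ_nonneg
  have hK := P.K_nonneg
  have hcH := P.cH_pos
  have hcD := P.cD_pos
  have hc₃ := P.c₃_pos
  have hC₃ := P.C₃_pos
  have hk₀ := P.k₀_pos
  have hT := P.Tmax_pos
  set p : ℝ := 1 + 1 / ((P.d : ℝ) + 1) with hp
  set A := U₁ + 1 with hA
  set U := A + P.K * (1 + P.Tmax) with hU
  have hU0 : 0 < U := by positivity
  refine ⟨P.α + P.κ * (P.d + 1) + 1, by positivity, fun r hr => ?_⟩
  have hκd : 0 ≤ P.κ * (P.d + 1) := by positivity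
  have hr0 : 0 < r := by linarith
  have hrκ : r + P.κ ≤ r * p := by
    have h1 : P.κ ≤ r / ((P.d : ℝ) + 1) := by
      rw [le_div_iff₀ (by positivity)]; linarith
    rw [hp, mul_add, mul_one, mul_one_div]
    linarith
  set W := 1 / 2 * (r * (r + 1)) * U * P.cD with hW
  have hW0 : 0 < W := by positivity
  obtain ⟨C₁, hC₁, hdrift⟩ := P.exists_drift_absorption (ε := r * P.c₃ / W) (by positivity)
  set C₂ := (1 + r) * P.cH + r * P.C₃ + P.K + W * (1 + C₁) with hC₂
  have hC₂0 : 0 < C₂ := by positivity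
  obtain ⟨C₃, hC₃0, hinter⟩ := hint r (1 / 2 * (r * (r + 1)) / C₂) hr0 (by positivity)
  set Y₀ := U * P.k₀ ^ (-r) with hY₀
  have hY₀0 : 0 < Y₀ := by positivity
  set B := C₂ * (1 + C₃ * (1 + (Y₀ + 1)) ^ N) with hB
  have hB0 : 0 < B := by positivity
  refine ⟨1 / B, by positivity, Y₀ + 1, by positivity, fun S t ht htB => ?_⟩
  have hu1 : ∀ x, ∀ t ∈ Icc 0 S.T, 1 ≤ A - S.u x t := fun x t ht => by
    have := hup S x t ht
    linarith
  have hu2 : ∀ x, ∀ t ∈ Icc 0 S.T, A - S.u x t ≤ U := fun x t ht => by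
    have := S.u_lower x ht
    linarith
  have hXY : ∀ t ∈ Icc 0 S.T,
      cellIntegral (fun x => S.m x t ^ (-r)) ≤ S.energy A (-1) (-r) t := fun t ht => by
    have hc1 := S.continuous_rpow ht (-r)
    have hc2 := S.continuous_u ht
    refine cellIntegral_mono hc1 (by fun_prop) fun x => ?_
    have := hu1 x t ht
    have hm := Real.rpow_pos_of_pos (S.m_pos x ht) (-r)
    nlinarith
  refine (hXY t ht).trans (le_of_rate_bound (S.continuousOn_energy A (-1) (-r))
    (fun t ht => S.hasDerivAt_energy ht A (-1) (-r)) ?_ hB0 ?_ ht htB)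
  · -- the initial value
    have h0 := S.zero_mem
    have hc1 := S.continuous_rpow h0 (-r)
    have hc2 := S.continuous_u h0
    have h1 := cellIntegral_mono (f := fun x => (A + -1 * S.u x 0) * S.m x 0 ^ (-r))
      (g := fun _ => U * P.k₀ ^ (-r)) (by fun_prop) continuous_const (fun x => by
        have a1 := hu1 x 0 h0
        have a2 := hu2 x 0 h0
        have a3 : P.k₀ ≤ S.m x 0 := by rw [S.solution.initial]; exact S.data.lower_m₀ x
        have a4 : S.m x 0 ^ (-r) ≤ P.k₀ ^ (-r) :=
          Real.rpow_le_rpow_of_nonpos hk₀ a3 (by linarith)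
        have a5 := Real.rpow_pos_of_pos (S.m_pos x h0) (-r)
        have a6 : A + -1 * S.u x 0 = A - S.u x 0 := by ring
        rw [a6]
        exact mul_le_mul a2 a4 a5.le hU0.le)
    rwa [cellIntegral_const] at h1
  · intro t ht hYt
    have htc := Ioo_subset_Icc_self ht
    have hcq := S.continuous_rpow htc (-(r * p))
    have hcG : Continuous (fun x => S.m x t ^ (-r - 2) * ‖S.Dm x t‖ ^ 2) :=
      (S.continuous_rpow htc _).mul ((S.continuous_Dm htc).norm.pow 2)
    have h1 := cellIntegral_mono (f := S.rate A (-1) (-r) t)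
      (g := fun x => -(1 / 2 * (r * (r + 1))) * (S.m x t ^ (-r - 2) * ‖S.Dm x t‖ ^ 2)
        + C₂ * (1 + S.m x t ^ (-(r * p)))) (S.continuous_rate ht _ _ _) (by fun_prop)
      (fun x => S.rate_neg_pow_le x htc (by positivity) hC₁.le hdrift hr0 (by linarith) hrκ
        (hu1 x t htc) (hu2 x t htc) (by rw [← hW]; exact (mul_div_cancel₀ _ hW0.ne').le))
    rw [cellIntegral_add (by fun_prop) (by fun_prop), cellIntegral_const_mul,
      cellIntegral_const_mul, cellIntegral_add continuous_const hcq, cellIntegral_const] at h1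
    have h2 := hinter (fun x => S.m x t) (S.contDiff_m htc) (S.solution.periodic_m t htc)
      (fun x => S.m_pos x htc)
    rw [neg_mul] at h2
    have h3 := mul_le_mul_of_nonneg_left h2 hC₂0.le
    have h4 : ∀ g z : ℝ, C₂ * (1 / 2 * (r * (r + 1)) / C₂ * g + z)
        = 1 / 2 * (r * (r + 1)) * g + C₂ * z := fun g z => by field_simp
    rw [h4] at h3
    have h5 : (1 + cellIntegral (fun x => S.m x t ^ (-r))) ^ N ≤ (1 + (Y₀ + 1)) ^ N := by
      have h6 : 0 ≤ cellIntegral (fun x => S.m x t ^ (-r)) := cellIntegral_nonneg fun x =>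
        (Real.rpow_pos_of_pos (S.m_pos x htc) _).le
      have h7 := (hXY t htc).trans hYt
      gcongr
    have h6 : C₂ * (C₃ * (1 + cellIntegral (fun x => S.m x t ^ (-r))) ^ N)
        ≤ C₂ * (C₃ * (1 + (Y₀ + 1)) ^ N) := by gcongr
    have h7 : cellIntegral (fun x => S.m x t ^ (-r - 2) * ‖gradient (fun x => S.m x t) x‖ ^ 2)
        = cellIntegral (fun x => S.m x t ^ (-r - 2) * ‖S.Dm x t‖ ^ 2) := rfl
    rw [h7] at h3
    rw [hB]
    linarith

end CongestionMFG

theorem mainTheorem3 (d : ℕ) (hd : 1 ≤ d) (α γ γ' : ℝ)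
    (hα : 0 ≤ α) (hαd : 2 < d → α < 2 / ((d : ℝ) - 2))
    (hγγ' : γ.HolderConjugate γ') (hγ : γ < 2)
    (C₁ c₁ C₂ c₂ c₃ C₃ C₄ : ℝ)
    (hC₁ : 0 < C₁) (hc₁ : 0 < c₁) (hC₂ : 0 < C₂) (hc₂ : 0 < c₂)
    (hc₃ : 0 < c₃) (hC₃ : 0 < C₃) (hC₄ : 0 < C₄)
    (K k₀ Tmax : ℝ) (hk₀ : 0 < k₀) :
    ∃ r₀ : ℝ, 0 < r₀ ∧ ∃ δ : ℝ, 0 < δ ∧ ∀ r : ℝ, r₀ ≤ r →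
      ∃ t₁ : ℝ, 0 < t₁ ∧ ∃ C : ℝ, 0 < C ∧
        ∀ (T : ℝ), 0 < T → T ≤ Tmax →
        ∀ (L : CongestionMFG.Space d → CongestionMFG.Space d → ℝ)
          (Ψ : CongestionMFG.Space d → ℝ)
          (b : CongestionMFG.Space d → ℝ → CongestionMFG.Space d)
          (V : CongestionMFG.Space d → ℝ → ℝ)
          (m₀ : CongestionMFG.Space d → ℝ),
          CongestionMFG.IsLagrangian γ γ' C₁ c₁ C₂ c₂ c₃ C₃ C₄ L →
          CongestionMFG.IsData K k₀ T Ψ b V m₀ →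
        ∀ u m : CongestionMFG.Space d → ℝ → ℝ,
          CongestionMFG.IsSolution α T L Ψ b V m₀ u m →
        ∀ t : ℝ, 0 ≤ t → t ≤ T → t < t₁ →
          CongestionMFG.cellIntegral (fun x => 1 / m x t ^ r)
            ≤ C * (1 + 1 / (t₁ - t) ^ δ) := by

  have hγ1 : 1 < γ := hγγ'.lt
  have hγ'1 : 1 < γ' := hγγ'.symm.lt
  rcases lt_or_ge K 0 with hK | hK
  · -- there are no data, since the sup norms are nonnegative
    refine ⟨1, one_pos, 1, one_pos, fun r _ => ⟨1, one_pos, 1, one_pos, ?_⟩⟩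
    intro T _ _ L Ψ b V m₀ _ hdata
    exact absurd ((abs_nonneg _).trans (hdata.bound_Ψ 0)) (not_le.2 hK)
  rcases le_or_gt Tmax 0 with hTm | hTm
  · -- there are no admissible terminal times
    refine ⟨1, one_pos, 1, one_pos, fun r _ => ⟨1, one_pos, 1, one_pos, ?_⟩⟩
    intro T hT hTT
    exact absurd (hT.trans_le hTT) (not_lt.2 hTm)
  obtain ⟨r₀, hr₀, h⟩ := CongestionMFG.exists_negative_power_bound
    ⟨d, α, γ, γ', C₁, c₁, C₂, c₂, c₃, C₃, C₄, K, k₀, Tmax, hd, hα, hαd, hγ1, hγ, hγ'1,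
      hC₁, hC₂, hc₂, hc₃, hC₃, hC₄, hK, hk₀, hTm⟩
  -- the bound is uniform up to `t₁`, so that any exponent `δ` will do
  refine ⟨r₀, hr₀, 1, one_pos, fun r hr => ?_⟩
  obtain ⟨t₁, ht₁, C, hC, hbound⟩ := h r hr
  refine ⟨t₁, ht₁, C, hC, fun T hT hTT L Ψ b V m₀ hL hdata u m hsol t ht0 htT htt₁ => ?_⟩
  have h1 := hbound ⟨T, L, Ψ, b, V, m₀, u, m, hT, hTT, hL, hdata, hsol⟩ t ⟨ht0, htT⟩ htt₁
  have h2 : (fun x => 1 / m x t ^ r) = fun x => m x t ^ (-r) := by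
    funext x
    rw [Real.rpow_neg (hsol.pos x t ⟨ht0, htT⟩).le, one_div]
  have h3 : 0 ≤ 1 / (t₁ - t) ^ (1 : ℝ) := by
    have : 0 < t₁ - t := sub_pos.2 htt₁
    positivity
  rw [h2]
  refine h1.trans (le_mul_of_one_le_right hC.le ?_)
  linarith
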